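/- Let $m\ge 1$ and consider non-isentropic compressible flow on $\mathbb R^n$ with $n=2m$ or $n=2m+1$ (i.e. any $n>1$), governed by $$\rho_t+\nabla\cdot(\rho\mathbf u)=0,\qquad S_t+\mathbf u\cdot\nabla S=0,\qquad \mathbf u_t+\mathbf u\cdot\nabla\mathbf u+\rho^{-1}\nabla p=0,\qquad p=P(\rho,S),$$ where $P$ is smooth on $\rho>0$ and non-isentropic: $\partial P/\partial S$ does not vanish identically on any nonempty open set of states $(\rho,S)$, $\rho>0$. Let $\omega_{ij}=\tfrac12(\partial_ju_i-\partial_iu_j)$ and let $\epsilon$ be the Levi-Civita symbol. Put $$\varpi=\ast(\omega^m)=\epsilon^{i_1j_1\cdots i_mj_m}\omega_{i_1j_1}\cdots\omega_{i_mj_m}\ (n=2m),\qquad \varpi^i=\epsilon^{i\,i_1j_1\cdots i_mj_m}\omega_{i_1j_1}\cdots\omega_{i_mj_m}\ (n=2m+1),$$ and, for $n=2m$, $w^{ij}=\epsilon^{ij\,i_1j_1\cdots i_{m-1}j_{m-1}}\omega_{i_1j_1}\cdots\omega_{i_{m-1}j_{m-1}}$. A local function is a smooth function, on $\rho>0$,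 of $t,\mathbf x,\rho,S,\mathbf u$ and finitely many spatial derivatives of $\rho,S,\mathbf u$. A local function $T$ is a conserved density if $\mathcal D_tT+D_{\mathbf x}\cdot\mathbf X=0$ identically for some local vector function $\mathbf X$, where $\mathcal D_t$ is the total time derivative with $\rho_t,S_t,\mathbf u_t$ eliminated by the equations of motion; $\boldsymbol\xi=\mathbf X-T\mathbf u$ is the flux through the boundary of a domain $V(t)$ moving with the fluid. $T$ is trivial if $T=D_{\mathbf x}\cdot\boldsymbol\Theta$ for a local $\boldsymbol\Theta$. A density is kinematic if it has the form $K(\rho,S,\mathbf u)$. A density of vorticity form $T(\rho,S,\mathbf u,\ast(\omega^m))$, smooth on $\rho>0$, defines a nontrivial vorticity conservation law if it is a conserved density and it is not the sum of a kinematic density and a trivial density. Then: (a) If $n=2m$, a density $T(\rho,S,\mathbf u,\varpi)$ defines a nontrivial vorticity conservation law if and only if $T=f(S)\varpi+K(\rho,S,\mathbf u)$ with $f$ a smooth non-constant function and $K$ a kinematic conserved density. (b) If $n=2m$, $f=F'$ with $F$ smooth, and $e(\rho,S)$ is any smooth function on $\rho>0$ with $e_\rho=\rho^{-2}P$, then $T=f(S)\varpi$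 is conserved with moving flux $\xi^j=-m\,e_S\,w^{ij}\partial_iF(S)$, i.e. $\mathcal D_tT+D_{\mathbf x}\cdot(T\mathbf u+\boldsymbol\xi)=0$, which is the local form of $$\frac{d}{dt}\int_{V(t)}f(S)\varpi\,d^nx=m\int_{\partial V(t)}e_S\,w^{ij}\,\partial_iF(S)\,\hat n_j\,d^{n-1}\sigma .$$ (c) If $n=2m$, the enstrophy density $\rho\,g(\varpi/\rho)$ is not a conserved density for any smooth $g:\mathbb R\to\mathbb R$ that is not of the form $g(y)=ay+b$. (d) If $n=2m+1$, no density $T(\rho,S,\mathbf u,\boldsymbol\varpi)$ defines a nontrivial vorticity conservation law. (e) If $n=2m+1$, the helicity density $\mathbf u\cdot\boldsymbol\varpi$ is not a conserved density. In particular, no special non-isentropic equation of state admits further vorticity conservation laws. -/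

import Mathlib

open scoped ContDiff

noncomputable section

namespace FluidFlow

/-! ### Fluid states, jets and local functions -/

/-- Euclidean space `ℝⁿ`. -/
abbrev Space (n : ℕ) := EuclideanSpace ℝ (Fin n)

/-- Values `(ρ, S, u)` of the fluid variables: density, entropy per unit mass, velocity. -/
abbrev FluidVar (n : ℕ) := ℝ × ℝ × Space n

/-- The partial derivative `∂f/∂xⁱ` at `x`. -/
def partialD {n : ℕ} (i : Fin n) (f : Space n → ℝ) (x : Space n) : ℝ :=
  fderiv ℝ f x (EuclideanSpace.single i 1)

/-- A smooth fluid configuration `x ↦ (ρ, S, u)` on `ℝⁿ` with positive density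
(the instantaneous state of a fluid). -/
def IsFluidState {n : ℕ} (w : Space n → FluidVar n) : Prop :=
  ContDiff ℝ ∞ w ∧ ∀ x, 0 < (w x).1

/-- `k`-jets: values of the fluid variables and of their spatial derivatives up to order `k`. -/
abbrev Jet (n k : ℕ) := (j : Fin (k + 1)) → (Space n) [×(j : ℕ)]→L[ℝ] (FluidVar n)

/-- The `k`-jet of a configuration at a point. -/
def jet {n : ℕ} (k : ℕ) (w : Space n → FluidVar n) (x : Space n) : Jet n k :=
  fun j => iteratedFDeriv ℝ (j : ℕ) w x

/-- Points `(t, x, jet)` at which local functions of order `k` are evaluated. -/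
abbrev JetPoint (n k : ℕ) := ℝ × Space n × Jet n k

/-- The values `(ρ, S, u)` at a jet point (a `0`-linear map evaluated at the empty tuple). -/
def fluidVar {n k : ℕ} (q : JetPoint n k) : FluidVar n := q.2.2 0 (fun _ => 0)

/-- The values `∂ᵢ(ρ, S, u)` at a first-order jet point. -/
def fluidVarD {n : ℕ} (q : JetPoint n 1) (i : Fin n) : FluidVar n :=
  q.2.2 1 (fun _ => EuclideanSpace.single i 1)

/-- `F` is smooth on the region `ρ > 0` of the jet space: a local function of
`t, x, ρ, S, u` and their spatial derivatives up to order `k`. -/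
def IsLocalFunction {n k : ℕ} {Y : Type*} [NormedAddCommGroup Y] [NormedSpace ℝ Y]
    (F : JetPoint n k → Y) : Prop :=
  ContDiffOn ℝ ∞ F {q | 0 < (fluidVar q).1}

/-! ### The Euler equations and local conservation laws -/

/-- The time derivatives `(ρ_t, S_t, u_t)` prescribed by the Euler equations with pressure
`p = P(ρ, S)`: `ρ_t = -∇·(ρu)`, `S_t = -u·∇S`, `u_t = -u·∇u - ρ⁻¹∇p`. -/
def eulerRHS {n : ℕ} (P : ℝ → ℝ → ℝ) (w : Space n → FluidVar n) (x : Space n) : FluidVar n :=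
  (-∑ i, partialD i (fun y => (w y).1 * (w y).2.2 i) x,
   -∑ i, (w x).2.2 i * partialD i (fun y => (w y).2.1) x,
   WithLp.toLp 2 (fun i =>
    -(∑ j, (w x).2.2 j * partialD j (fun y => (w y).2.2 i) x)
      - ((w x).1)⁻¹ * partialD i (fun y => P (w y).1 (w y).2.1) x))

/-- The total time derivative of `T` evaluated on solutions of the Euler equations: the chain
rule, in which the time derivative of the `r`-jet of the fluid variables is the `r`-jet of the
right-hand side of the Euler equations. -/
def onShellDt {n r : ℕ} (P : ℝ → ℝ → ℝ) (T : JetPoint n r → ℝ)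
    (w : Space n → FluidVar n) (t : ℝ) (x : Space n) : ℝ :=
  fderiv ℝ T (t, x, jet r w x) (1, 0, jet r (eulerRHS P w) x)

/-- The total spatial divergence `D_x · X`. -/
def totalDiv {n k : ℕ} (X : JetPoint n k → Space n)
    (w : Space n → FluidVar n) (t : ℝ) (x : Space n) : ℝ :=
  ∑ i, partialD i (fun y => X (t, y, jet k w y) i) x

/-- The local continuity equation `D_t T + D_x · X = 0`, holding formally on all solutions of the
Euler equations. -/
def ContinuityEquation {n r k : ℕ} (P : ℝ → ℝ → ℝ) (T : JetPoint n r → ℝ)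
    (X : JetPoint n k → Space n) : Prop :=
  ∀ w : Space n → FluidVar n, IsFluidState w → ∀ (t : ℝ) (x : Space n),
    onShellDt P T w t x + totalDiv X w t x = 0

/-- `T` is a conserved density: the continuity equation holds for some spatial flux that is a
local function (of any finite order). -/
def IsConservedDensity {n r : ℕ} (P : ℝ → ℝ → ℝ) (T : JetPoint n r → ℝ) : Prop :=
  ∃ (k : ℕ) (X : JetPoint n k → Space n), IsLocalFunction X ∧ ContinuityEquation P T X

/-- `ξ` is a moving flux of `T`: the spatial flux is `u T + ξ`, i.e.
`d/dt ∫_{V(t)} T dx = -∫_{∂V(t)} ξ·n̂ dσ` on domains `V(t)` transported by the fluid. -/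
def IsMovingFlux {n r : ℕ} (P : ℝ → ℝ → ℝ) (T : JetPoint n r → ℝ)
    (ξ : JetPoint n r → Space n) : Prop :=
  IsLocalFunction ξ ∧ ContinuityEquation P T (fun q => T q • (fluidVar q).2.2 + ξ q)

/-- `T` is trivial: it is a total spatial divergence of a local vector function. -/
def IsTrivialDensity {n r : ℕ} (T : JetPoint n r → ℝ) : Prop :=
  ∃ (k : ℕ) (Θ : JetPoint n k → Space n), IsLocalFunction Θ ∧
    ∀ w : Space n → FluidVar n, IsFluidState w → ∀ (t : ℝ) (x : Space n),
      T (t, x, jet r w x) = totalDiv Θ w t x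

/-! ### Equations of state -/

/-- A non-isentropic equation of state `p = P(ρ, S)`, smooth on `ρ > 0`: `∂P/∂S` is not
identically zero on any nonempty open set of states. -/
def IsNonIsentropic (P : ℝ → ℝ → ℝ) : Prop :=
  ContDiffOn ℝ ∞ (fun q : ℝ × ℝ => P q.1 q.2) {q | 0 < q.1} ∧
  ∀ U : Set (ℝ × ℝ), IsOpen U → U.Nonempty → U ⊆ {q | 0 < q.1} →
    ∃ q ∈ U, deriv (fun s => P q.1 s) q.2 ≠ 0

/-- `e` is an internal energy for the equation of state `P`: `∂e/∂ρ = ρ⁻² P(ρ, S)`. -/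
def IsInternalEnergy (P e : ℝ → ℝ → ℝ) : Prop :=
  ContDiffOn ℝ ∞ (fun q : ℝ × ℝ => e q.1 q.2) {q | 0 < q.1} ∧
  ∀ ρ S : ℝ, 0 < ρ → HasDerivAt (fun r => e r S) ((ρ ^ 2)⁻¹ * P ρ S) ρ

/-! ### Vorticity -/

/-- The components `ω_{ij} = ½(∂_j u_i - ∂_i u_j)` of the curl of the velocity. -/
def curl {n : ℕ} (q : JetPoint n 1) (i j : Fin n) : ℝ :=
  ((fluidVarD q j).2.2 i - (fluidVarD q i).2.2 j) / 2

/-- The components of `∗(ω^k)`, a tensor of rank `r = n - 2k`: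
`ε^{c₁⋯c_r i₁j₁⋯i_kj_k} ω_{i₁j₁} ⋯ ω_{i_kj_k}`, summed over all `i`'s and `j`'s. Only index
tuples that are permutations `σ` contribute, and `ε` is the sign of `σ`. -/
def starCurlPow {n : ℕ} (r k : ℕ) (h : r + 2 * k = n) (q : JetPoint n 1) (c : Fin r → Fin n) : ℝ :=
  ∑ σ : Equiv.Perm (Fin n),
    if ∀ a : Fin r, σ ⟨a, by omega⟩ = c a then
      ((Equiv.Perm.sign σ : ℤ) : ℝ) *
        ∏ l : Fin k, curl q (σ ⟨r + 2 * l, by omega⟩) (σ ⟨r + 2 * l + 1, by omega⟩)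
    else 0

/-- The vorticity scalar `ϖ = ∗(ω^m)` in dimension `2m`. -/
def vortScalar {m : ℕ} (q : JetPoint (2 * m) 1) : ℝ :=
  starCurlPow 0 m (by omega) q (fun a => a.elim0)

/-- The vorticity vector `ϖ = ∗(ω^m)` in dimension `2m + 1`. -/
def vortVector {m : ℕ} (q : JetPoint (2 * m + 1) 1) : Space (2 * m + 1) :=
  WithLp.toLp 2 (fun i => starCurlPow 1 m (by omega) q (fun _ => i))

/-- The tensor `w = ∗(ω^{m-1})` in dimension `2m`, `m ≥ 1`. -/
def vortTensor {m : ℕ} (hm : 1 ≤ m) (q : JetPoint (2 * m) 1) (i j : Fin (2 * m)) : ℝ :=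
  starCurlPow 2 (m - 1) (by omega) q ![i, j]

/-! ### Densities of kinematic and vorticity form -/

/-- The kinematic density `K(ρ, S, u)`. -/
def kinematicDensity {n : ℕ} (K : FluidVar n → ℝ) : JetPoint n 1 → ℝ :=
  fun q => K (fluidVar q)

/-- `K` is smooth on `ρ > 0`. -/
def IsKinematic {n : ℕ} (K : FluidVar n → ℝ) : Prop :=
  ContDiffOn ℝ ∞ K {v | 0 < v.1}

/-- The density `T(ρ, S, u, ϖ)` in dimension `2m`. -/
def evenVortDensity {m : ℕ} (T : FluidVar (2 * m) × ℝ → ℝ) : JetPoint (2 * m) 1 → ℝ :=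
  fun q => T (fluidVar q, vortScalar q)

/-- The density `T(ρ, S, u, ϖ)` in dimension `2m + 1`. -/
def oddVortDensity {m : ℕ} (T : FluidVar (2 * m + 1) × Space (2 * m + 1) → ℝ) :
    JetPoint (2 * m + 1) 1 → ℝ :=
  fun q => T (fluidVar q, vortVector q)

/-- `T` is smooth on `ρ > 0`. -/
def IsVortFunction {n : ℕ} {Y : Type*} [NormedAddCommGroup Y] [NormedSpace ℝ Y]
    (T : FluidVar n × Y → ℝ) : Prop :=
  ContDiffOn ℝ ∞ T {v | 0 < v.1.1}

/-- `T` gives a nontrivial vorticity conservation law: it is conserved, and its dependence on the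
curl is essential, that is, it does not reduce to a (possibly zero) kinematic density after
subtraction of a trivial density. -/
def IsNontrivialVorticityLaw {n : ℕ} (P : ℝ → ℝ → ℝ) (T : JetPoint n 1 → ℝ) : Prop :=
  IsConservedDensity P T ∧
    ¬ ∃ K : FluidVar n → ℝ, IsKinematic K ∧
      IsTrivialDensity (fun q => T q - kinematicDensity K q)

/-- The moving flux `ξ^j = -m e_S w^{ij} ∂_i F(S)` in dimension `2m`, so that
`-ξ·n̂ = m e_S w·(∇F(S) ∧ n̂)`. -/
def circulatoryFlux {m : ℕ} (hm : 1 ≤ m) (e : ℝ → ℝ → ℝ) (F : ℝ → ℝ)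
    (q : JetPoint (2 * m) 1) : Space (2 * m) :=
  WithLp.toLp 2 (fun j =>
    -((m : ℝ) * deriv (fun s => e (fluidVar q).1 s) (fluidVar q).2.1 *
      ∑ i, vortTensor hm q i j * (deriv F (fluidVar q).2.1 * (fluidVarD q i).2.1)))

end FluidFlow

end

open FluidFlow

open scoped ContDiff

noncomputable section

namespace FluidFlow

open Equiv Finset

/-! For a density `T(ρ, S, u, Z(∇u))` put `lag = T ∇·u + DT/Dt`, with `D/Dt` the material derivative
on solutions. It differs from the time derivative of `T` by the divergence of `T u`
(`onShellDt_vortDensity`), and since `Z` sees only the curl, the second derivatives in it drop out: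
`lag` is a function of the first-order jet. If `T` is conserved, `lag` is a total divergence
(`isDivergence_lag`). Compactly supported variations of `S` and `u` then give Euler–Lagrange
equations, and because jets at a point can be prescribed freely these become identities on jets:
`lag` is affine along rank-one directions of the gradient (`IsDivergence.rankOne`), and a
first-order identity remains (`IsDivergence.lowerOrder`).

The entropy gradient enters `lag` linearly, with factor `∂P/∂S`, through the pressure force and the
baroclinic term `ρ⁻² P_S ∇S ∧ ∇ρ`. As `P_S` is nonzero on a dense set, rank-one affinity can be
divided by it. With `∇ρ = 0` this controls `∂T/∂u`; with `∇ρ` along the velocity direction of the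
perturbation it makes `T` affine in the vorticity (`fderiv_vel_eq`, `affine_vort`), so `T = K +
c·ϖ`. A second difference of `lag` at `∇ρ = ∇S = 0` shows that `c` does not depend on `ρ`
(`fderiv_coeff_rho`), and `fderiv_coeff_vel` restricts the dependence on `u`. The test gradients are
sums of decomposable forms, on which powers of the curl are determinants (`curlPow_sum_outer`).

In dimension `2m` the vorticity is a scalar, so `c = f(S)` (`even_classification`). Conversely
`f(S)ϖ` is conserved: the trace identity `fderiv_curlPow_sq` cancels dilation against stretching,
and the baroclinic remainder is the divergence of the circulatory flux, since `∗(ω^{m-1})` is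
divergence-free and antisymmetric and `e_{ρS} = ρ⁻² P_S`. If `f(S)ϖ` is kinematic modulo trivial
densities, the entropy Euler–Lagrange equation forces `f' = 0`; for constant `f` the density is
trivial because `ϖ` is a divergence. Enstrophy fails the classification unless `g` is affine.

In dimension `2m + 1` the two constraints give `c = γ(S) + λ(S) u`. The first-order identity for
entropy variations splits by homogeneity in the gradients into a kinematic and a vorticity part; the
latter yields `γ' = λ' = 0` and then, wherever `P_S ≠ 0`, `λ = 0` (`odd_classification`). So `c` is
constant and `c·ϖ` is a divergence: no nontrivial law remains, and helicity, where `c = u`, is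
excluded. -/

/-! ### Alternating products of covectors and bilinear forms -/

/-- Velocity gradients, `A i j = ∂_j u_i`. -/
abbrev Grad (n : ℕ) := Fin n → Fin n → ℝ

section Slots

variable {n r k : ℕ}

/-- The index slot of the covector number `a`. -/
def slotC (h : r + 2 * k = n) (a : Fin r) : Fin n := ⟨a, by omega⟩

/-- The first index slot of the bilinear form number `l`. -/
def slotL (h : r + 2 * k = n) (l : Fin k) : Fin n := ⟨r + 2 * l, by omega⟩

/-- The second index slot of the bilinear form number `l`. -/
def slotR (h : r + 2 * k = n) (l : Fin k) : Fin n := ⟨r + 2 * l + 1, by omega⟩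

/-- All index slots. -/
def slotEquiv (h : r + 2 * k = n) : Fin r ⊕ (Fin k × Fin 2) ≃ Fin n :=
  ((Equiv.refl (Fin r)).sumCongr finProdFinEquiv).trans
    (finSumFinEquiv.trans (finCongr (by omega)))

lemma slotEquiv_inl (h : r + 2 * k = n) (a : Fin r) : slotEquiv h (.inl a) = slotC h a := by
  ext; simp [slotEquiv, slotC]

lemma slotEquiv_inr_zero (h : r + 2 * k = n) (l : Fin k) :
    slotEquiv h (.inr (l, 0)) = slotL h l := by
  ext; simp [slotEquiv, slotL, finProdFinEquiv]

lemma slotEquiv_inr_one (h : r + 2 * k = n) (l : Fin k) :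
    slotEquiv h (.inr (l, 1)) = slotR h l := by
  ext; simp [slotEquiv, slotR, finProdFinEquiv]; omega

lemma sum_slots (h : r + 2 * k = n) (f : Fin n → ℝ) :
    ∑ p, f p = ∑ a, f (slotC h a) + ∑ l, (f (slotL h l) + f (slotR h l)) := by
  rw [← (slotEquiv h).sum_comp, Fintype.sum_sum_type, Fintype.sum_prod_type]
  simp [slotEquiv_inl, slotEquiv_inr_zero, slotEquiv_inr_one, Fin.sum_univ_two]

lemma prod_slots (h : r + 2 * k = n) (f : Fin n → ℝ) :
    ∏ p, f p = (∏ a, f (slotC h a)) * ∏ l, (f (slotL h l) * f (slotR h l)) := by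
  rw [← (slotEquiv h).prod_comp, Fintype.prod_sum_type, Fintype.prod_prod_type]
  simp [slotEquiv_inl, slotEquiv_inr_zero, slotEquiv_inr_one, Fin.prod_univ_two]

@[simp] lemma slotC_ne_slotL (h : r + 2 * k = n) (a : Fin r) (l : Fin k) :
    slotC h a ≠ slotL h l := by simp [slotC, slotL]; omega

@[simp] lemma slotC_ne_slotR (h : r + 2 * k = n) (a : Fin r) (l : Fin k) :
    slotC h a ≠ slotR h l := by simp [slotC, slotR]; omega

@[simp] lemma slotL_ne_slotR (h : r + 2 * k = n) (l l' : Fin k) :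
    slotL h l ≠ slotR h l' := by simp [slotL, slotR]; omega

@[simp] lemma slotR_ne_slotL (h : r + 2 * k = n) (l l' : Fin k) :
    slotR h l ≠ slotL h l' := (slotL_ne_slotR h l' l).symm

@[simp] lemma slotL_inj (h : r + 2 * k = n) (l l' : Fin k) :
    slotL h l = slotL h l' ↔ l = l' := by simp [slotL, Fin.ext_iff]

@[simp] lemma slotR_inj (h : r + 2 * k = n) (l l' : Fin k) :
    slotR h l = slotR h l' ↔ l = l' := by simp [slotR, Fin.ext_iff]

@[simp] lemma slotC_inj (h : r + 2 * k = n) (a a' : Fin r) :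
    slotC h a = slotC h a' ↔ a = a' := by simp [slotC, Fin.ext_iff]

end Slots

/-- Right translation by `τ` in an alternating sum. -/
lemma sum_sign_mul_right {n : ℕ} (τ : Perm (Fin n)) (F : Perm (Fin n) → ℝ) :
    ∑ σ : Perm (Fin n), ((Perm.sign σ : ℤ) : ℝ) * F (σ * τ) =
      ((Perm.sign τ : ℤ) : ℝ) * ∑ σ : Perm (Fin n), ((Perm.sign σ : ℤ) : ℝ) * F σ := by
  rw [← Equiv.sum_comp (Equiv.mulRight τ) (fun σ => ((Perm.sign σ : ℤ) : ℝ) * F σ), mul_sum]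
  refine sum_congr rfl fun σ _ => ?_
  have : ((Perm.sign τ : ℤ) : ℝ) * ((Perm.sign τ : ℤ) : ℝ) = 1 := by
    rcases Int.units_eq_one_or (Perm.sign τ) with h | h <;> simp [h]
  simp only [Equiv.coe_mulRight, map_mul, Units.val_mul, Int.cast_mul]
  linear_combination (-((Perm.sign σ : ℤ) : ℝ) * F (σ * τ)) * this

/-- An alternating sum of terms invariant under a transposition vanishes. -/
lemma sum_sign_eq_zero {n : ℕ} {p q : Fin n} (hpq : p ≠ q) (F : Perm (Fin n) → ℝ)
    (hF : ∀ σ, F (σ * swap p q) = F σ) :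
    ∑ σ : Perm (Fin n), ((Perm.sign σ : ℤ) : ℝ) * F σ = 0 := by
  have := sum_sign_mul_right (swap p q) F
  simp only [hF, Perm.sign_swap hpq] at this
  push_cast at this
  linarith

section AltForm

variable {n r k : ℕ}

/-- The alternating product of `r` covectors with `k` bilinear forms in dimension `n = r + 2k`,
as a multilinear function of the bilinear forms. -/
def altForm (h : r + 2 * k = n) (c : Fin r → Fin n → ℝ) :
    ContinuousMultilinearMap ℝ (fun _ : Fin k => Grad n) ℝ :=
  ∑ σ : Perm (Fin n), (((Perm.sign σ : ℤ) : ℝ) * ∏ a, c a (σ (slotC h a))) •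
    (ContinuousMultilinearMap.mkPiAlgebra ℝ (Fin k) ℝ).compContinuousLinearMap
      (fun l => (ContinuousLinearMap.proj (R := ℝ) (φ := fun _ : Fin n => ℝ)
        (σ (slotR h l))).comp
          (ContinuousLinearMap.proj (R := ℝ) (φ := fun _ : Fin n => Fin n → ℝ) (σ (slotL h l))))

/-- One summand of `altForm`. -/
def altTerm (h : r + 2 * k = n) (c : Fin r → Fin n → ℝ) (W : Fin k → Grad n)
    (g : Fin n → Fin n) : ℝ :=
  (∏ a, c a (g (slotC h a))) * ∏ l, W l (g (slotL h l)) (g (slotR h l))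

lemma altForm_apply (h : r + 2 * k = n) (c : Fin r → Fin n → ℝ) (W : Fin k → Grad n) :
    altForm h c W = ∑ σ : Perm (Fin n), ((Perm.sign σ : ℤ) : ℝ) * altTerm h c W σ := by
  simp [altForm, altTerm, mul_assoc]

lemma altTerm_update (h : r + 2 * k = n) (c : Fin r → Fin n → ℝ) (W : Fin k → Grad n)
    (l : Fin k) (X : Grad n) (g : Fin n → Fin n) :
    altTerm h c (Function.update W l X) g = (∏ a, c a (g (slotC h a))) *
      (X (g (slotL h l)) (g (slotR h l)) *
        ∏ l' ∈ univ.erase l, W l' (g (slotL h l')) (g (slotR h l'))) := by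
  unfold altTerm
  rw [← Finset.mul_prod_erase univ _ (mem_univ l)]
  congr 2
  · simp
  · refine prod_congr rfl fun l' hl' => ?_
    rw [Function.update_of_ne (Finset.ne_of_mem_erase hl')]

/-- Transposing one of the forms changes the sign. -/
lemma altForm_update_transpose (h : r + 2 * k = n) (c : Fin r → Fin n → ℝ) (W : Fin k → Grad n)
    (l : Fin k) (X : Grad n) :
    altForm h c (Function.update W l (fun i j => X j i)) =
      - altForm h c (Function.update W l X) := by
  have := sum_sign_mul_right (swap (slotL h l) (slotR h l))
    (fun σ => altTerm h c (Function.update W l X) σ)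
  rw [altForm_apply, altForm_apply, ← neg_one_mul]
  rw [Perm.sign_swap (slotL_ne_slotR h l l)] at this
  push_cast at this
  rw [← this]
  refine sum_congr rfl fun σ _ => ?_
  congr 1
  rw [altTerm_update, altTerm_update]
  congr 1
  · refine prod_congr rfl fun a _ => ?_
    rw [Function.comp_apply, swap_apply_of_ne_of_ne (slotC_ne_slotL h a l) (slotC_ne_slotR h a l)]
  · congr 1
    · simp
    · refine prod_congr rfl fun l' hl' => ?_
      have hne := Finset.ne_of_mem_erase hl'
      rw [Function.comp_apply, Function.comp_apply, swap_apply_of_ne_of_ne, swap_apply_of_ne_of_ne] <;>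
        simp [hne]

/-- The form vanishes if the terms are invariant under a transposition of two slots. -/
lemma altForm_eq_zero (h : r + 2 * k = n) (c : Fin r → Fin n → ℝ) (W : Fin k → Grad n)
    {p q : Fin n} (hpq : p ≠ q)
    (H : ∀ g : Fin n → Fin n, altTerm h c W (g ∘ swap p q) = altTerm h c W g) :
    altForm h c W = 0 := by
  rw [altForm_apply]
  exact sum_sign_eq_zero hpq _ fun σ => H σ

/-- Two decomposable forms with a common right factor. -/
lemma altForm_eq_zero_of_right (h : r + 2 * k = n) (c : Fin r → Fin n → ℝ) (W : Fin k → Grad n)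
    {l l' : Fin k} (hl : l ≠ l') {a d b : Fin n → ℝ} (h₁ : W l = fun i j => a i * b j)
    (h₂ : W l' = fun i j => d i * b j) : altForm h c W = 0 := by
  refine altForm_eq_zero h c W (p := slotR h l) (q := slotR h l') (by simpa using hl) fun g => ?_
  unfold altTerm
  congr 1
  · refine prod_congr rfl fun a _ => ?_
    simp [swap_apply_of_ne_of_ne]
  · have hL : ∀ x, swap (slotR h l) (slotR h l') (slotL h x) = slotL h x := fun x =>
      swap_apply_of_ne_of_ne (by simp) (by simp)
    have hm : l' ∈ univ.erase l := by simp [hl.symm]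
    rw [← Finset.mul_prod_erase univ _ (mem_univ l), ← Finset.mul_prod_erase univ _ (mem_univ l),
      ← Finset.mul_prod_erase _ _ hm, ← Finset.mul_prod_erase _ _ hm, h₁, h₂]
    simp only [Function.comp_apply, hL, swap_apply_left, swap_apply_right]
    rw [prod_congr rfl (g := fun x => W x (g (slotL h x)) (g (slotR h x)))]
    · ring
    · intro x hx
      simp only [mem_erase, mem_univ, and_true] at hx
      rw [swap_apply_of_ne_of_ne] <;> simp [hx.1, hx.2]

/-- The form is symmetric in the bilinear forms. -/
lemma altForm_comp_perm (h : r + 2 * k = n) (c : Fin r → Fin n → ℝ) (W : Fin k → Grad n)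
    (π : Perm (Fin k)) : altForm h c (W ∘ π) = altForm h c W := by
  -- Permuting whole pairs of slots applies `π` to the first and to the second members alike, so the
  -- sign is `sign(π)² = 1`.
  set e : Perm (Fin r ⊕ (Fin k × Fin 2)) :=
    Equiv.sumCongr 1 (Equiv.prodCongrLeft fun _ : Fin 2 => π) with he
  set τ : Perm (Fin n) := (slotEquiv h).permCongr e with hτ
  have hs : Perm.sign τ = 1 := by
    rw [hτ, Perm.sign_permCongr, he, Perm.sign_sumCongr, Perm.sign_prodCongrLeft]
    simp
  have hC : ∀ a, τ (slotC h a) = slotC h a := fun a => by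
    rw [← slotEquiv_inl]; simp [hτ, he, Equiv.permCongr_apply]
  have hL : ∀ l, τ (slotL h l) = slotL h (π l) := fun l => by
    rw [← slotEquiv_inr_zero, ← slotEquiv_inr_zero]; simp [hτ, he, Equiv.permCongr_apply]
  have hR : ∀ l, τ (slotR h l) = slotR h (π l) := fun l => by
    rw [← slotEquiv_inr_one, ← slotEquiv_inr_one]; simp [hτ, he, Equiv.permCongr_apply]
  have := sum_sign_mul_right τ (fun σ => altTerm h c (W ∘ π) σ)
  rw [hs] at this
  rw [altForm_apply, altForm_apply]
  simp only [Units.val_one, Int.cast_one, one_mul] at this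
  rw [← this]
  refine sum_congr rfl fun σ _ => ?_
  congr 1
  unfold altTerm
  congr 1
  · simp [hC]
  · rw [← Equiv.prod_comp π fun l => W l (σ (slotL h l)) (σ (slotR h l))]
    simp [hL, hR]

/-- The alternating form of decomposable bilinear forms is a determinant. -/
lemma altForm_decomposable (h : r + 2 * k = n) (c : Fin r → Fin n → ℝ)
    (M : Matrix (Fin n) (Fin n) ℝ) (hc : ∀ a, M (slotC h a) = c a) :
    altForm h c (fun l i j => M (slotL h l) i * M (slotR h l) j) = M.det := by
  rw [← Matrix.det_transpose, Matrix.det_apply', altForm_apply]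
  refine sum_congr rfl fun σ _ => ?_
  congr 1
  rw [prod_slots h]
  simp [altTerm, hc]

/-- The derivation induced by a linear map acts on top-degree forms as its trace. -/
lemma altForm_trace (h : r + 2 * k = n) (c : Fin r → Fin n → ℝ) (W : Fin k → Grad n)
    (A : Grad n) :
    ∑ a, altForm h (Function.update c a fun j => ∑ i, c a i * A i j) W +
      ∑ l, altForm h c (Function.update W l fun i j =>
        ∑ p, A p i * W l p j + ∑ p, W l i p * A p j) = (∑ i, A i i) * altForm h c W := by
  -- Leibniz rule for one index tuple: acting with `A` on the argument in slot `q` replaces the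
  -- value `g q` by a summed index `p` with weight `A p (g q)`, for every kind of slot.
  have key : ∀ g : Fin n → Fin n, ∑ a, altTerm h (Function.update c a fun j => ∑ i, c a i * A i j) W g +
      ∑ l, altTerm h c (Function.update W l fun i j =>
        ∑ p, A p i * W l p j + ∑ p, W l i p * A p j) g =
      ∑ q, ∑ p, A p (g q) * altTerm h c W (Function.update g q p) := by
    intro g
    rw [sum_slots h]
    congr 1
    · refine sum_congr rfl fun a _ => ?_
      unfold altTerm
      rw [← Finset.mul_prod_erase univ _ (mem_univ a)]
      simp only [Function.update_self, sum_mul]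
      refine sum_congr rfl fun i _ => ?_
      rw [← Finset.mul_prod_erase univ _ (mem_univ a)]
      simp only [Function.update_self]
      rw [prod_congr rfl (g := fun x => c x (g (slotC h x)))]
      · rw [prod_congr rfl (s₁ := univ.erase a)
          (f := fun x => c x (Function.update g (slotC h a) i (slotC h x))) (g := fun x => c x (g (slotC h x)))]
        · rw [prod_congr (M := ℝ) rfl (s₁ := (univ : Finset (Fin k)))
            (f := fun l => W l (Function.update g (slotC h a) i (slotL h l))
              (Function.update g (slotC h a) i (slotR h l)))
            (g := fun l => W l (g (slotL h l)) (g (slotR h l)))]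
          · ring
          · intro l _
            rw [Function.update_of_ne (slotC_ne_slotL h a l).symm,
              Function.update_of_ne (slotC_ne_slotR h a l).symm]
        · intro x hx
          rw [Function.update_of_ne]
          simpa using Finset.ne_of_mem_erase hx
      · intro x hx
        rw [Function.update_of_ne]
        simpa using Finset.ne_of_mem_erase hx
    · refine sum_congr rfl fun l _ => ?_
      have hcL : ∀ (p : Fin n) (x : Fin r), Function.update g (slotL h l) p (slotC h x) =
          g (slotC h x) := fun p x => Function.update_of_ne (slotC_ne_slotL h x l) _ _
      have hcR : ∀ (p : Fin n) (x : Fin r), Function.update g (slotR h l) p (slotC h x) =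
          g (slotC h x) := fun p x => Function.update_of_ne (slotC_ne_slotR h x l) _ _
      rw [altTerm_update]
      simp only [add_mul, mul_add, sum_mul, mul_sum]
      congr 1
      · refine sum_congr rfl fun p _ => ?_
        unfold altTerm
        simp only [hcL]
        rw [← Finset.mul_prod_erase univ _ (mem_univ l)]
        rw [prod_congr rfl (s₁ := univ.erase l)
          (f := fun x => W x (Function.update g (slotL h l) p (slotL h x))
            (Function.update g (slotL h l) p (slotR h x)))
          (g := fun x => W x (g (slotL h x)) (g (slotR h x)))]
        · simp; ring
        · intro x hx
          rw [Function.update_of_ne, Function.update_of_ne] <;>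
            simp [Finset.ne_of_mem_erase hx]
      · refine sum_congr rfl fun p _ => ?_
        unfold altTerm
        simp only [hcR]
        rw [← Finset.mul_prod_erase univ _ (mem_univ l)]
        rw [prod_congr rfl (s₁ := univ.erase l)
          (f := fun x => W x (Function.update g (slotR h l) p (slotL h x))
            (Function.update g (slotR h l) p (slotR h x)))
          (g := fun x => W x (g (slotL h x)) (g (slotR h x)))]
        · simp; ring
        · intro x hx
          rw [Function.update_of_ne, Function.update_of_ne] <;>
            simp [Finset.ne_of_mem_erase hx]
  -- As `σ` is a bijection, the replacing index is `σ q'` for some slot `q'`. Exchanging the slots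
  -- `q ≠ q'` makes `a` antisymmetric off the diagonal, so only `q = q'` contributes, and this is
  -- the trace.
  set a : Fin n → Fin n → ℝ := fun q q' => ∑ σ : Perm (Fin n), ((Perm.sign σ : ℤ) : ℝ) *
    (A (σ q') (σ q) * altTerm h c W (Function.update σ q (σ q'))) with ha
  have hanti : ∀ q q', q ≠ q' → a q q' = - a q' q := by
    intro q q' hq
    have := sum_sign_mul_right (swap q q')
      (fun σ => A (σ q) (σ q') * altTerm h c W (Function.update σ q' (σ q)))
    rw [Perm.sign_swap hq] at this
    push_cast at this
    rw [neg_one_mul] at this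
    rw [ha]
    simp only
    rw [← this]
    refine sum_congr rfl fun σ _ => ?_
    simp only [Function.comp_apply, swap_apply_left, swap_apply_right]
    congr 3
    funext x
    by_cases h1 : x = q'
    · subst h1; simp [hq.symm]
    · by_cases h2 : x = q
      · subst h2; simp [h1]
      · simp [h1, h2, swap_apply_of_ne_of_ne]
  have hsum : ∑ q, ∑ q', a q q' = ∑ q, a q q := by
    have h0 : ∑ q, ∑ q', (a q q' - if q' = q then a q q else 0) = 0 := by
      have : ∑ q, ∑ q', (a q q' - if q' = q then a q q else 0) =
          - ∑ q, ∑ q', (a q q' - if q' = q then a q q else 0) := by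
        conv_lhs => rw [sum_comm]
        rw [← sum_neg_distrib]
        refine sum_congr rfl fun q _ => ?_
        rw [← sum_neg_distrib]
        refine sum_congr rfl fun q' _ => ?_
        by_cases hq : q = q'
        · subst hq; simp
        · simp [hq, Ne.symm hq, hanti q q' hq]
      linarith
    simpa [sum_sub_distrib, sub_eq_zero] using h0
  calc _ = ∑ σ : Perm (Fin n), ((Perm.sign σ : ℤ) : ℝ) *
        ∑ q, ∑ p, A p (σ q) * altTerm h c W (Function.update σ q p) := by
        simp only [altForm_apply, ← key, mul_add, mul_sum, sum_add_distrib]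
        rw [sum_comm]
        congr 1
        rw [sum_comm]
    _ = ∑ q, ∑ q', a q q' := by
        simp only [ha, mul_sum]
        rw [sum_comm]
        refine sum_congr rfl fun q _ => ?_
        rw [sum_comm, ← Equiv.sum_comp (Equiv.refl _)]
        conv_rhs => rw [sum_comm]
        rw [sum_comm]
        refine sum_congr rfl fun σ _ => ?_
        exact (Equiv.sum_comp σ _).symm
    _ = ∑ q, a q q := hsum
    _ = _ := by
        simp only [ha, Function.update_eq_self]
        rw [sum_comm, altForm_apply, mul_sum]
        refine sum_congr rfl fun σ _ => ?_
        rw [← mul_sum, ← sum_mul, Equiv.sum_comp σ fun i => A i i]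
        ring

end AltForm

end FluidFlow

end

noncomputable section

namespace FluidFlow

open Equiv Finset

/-! ### Vorticity as a function of the velocity gradient -/

/-- The decomposable bilinear form `a ⊗ b`. -/
def outer {n : ℕ} (a b : Fin n → ℝ) : Grad n := fun i j => a i * b j

@[simp] lemma outer_apply {n : ℕ} (a b : Fin n → ℝ) (i j : Fin n) : outer a b i j = a i * b j := rfl

lemma outer_smul_left {n : ℕ} (s : ℝ) (a b : Fin n → ℝ) : outer (s • a) b = s • outer a b := by
  ext i j; simp [outer, mul_assoc]

lemma outer_smul_right {n : ℕ} (s : ℝ) (a b : Fin n → ℝ) : outer a (s • b) = s • outer a b := by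
  ext i j; simp [outer]; ring

lemma outer_add_left {n : ℕ} (a a' b : Fin n → ℝ) :
    outer (a + a') b = outer a b + outer a' b := by
  ext i j; simp [outer, add_mul]

lemma transpose_outer {n : ℕ} (a b : Fin n → ℝ) :
    (fun i j => outer a b j i) = outer b a := by
  ext i j; simp [outer, mul_comm]

/-- Functions of the velocity gradient that depend only on the curl and are affine along
decomposable directions. -/
structure IsCurlForm {n : ℕ} {Y : Type*} [NormedAddCommGroup Y] [NormedSpace ℝ Y]
    (Z : Grad n → Y) : Prop where
  contDiff : ContDiff ℝ ∞ Z
  transpose : ∀ A X : Grad n, fderiv ℝ Z A (fun i j => X j i) = - fderiv ℝ Z A X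
  outer : ∀ (A : Grad n) (a b d : Fin n → ℝ),
    fderiv ℝ Z (A + outer a b) (outer d b) = fderiv ℝ Z A (outer d b)

namespace IsCurlForm

variable {n : ℕ} {Y : Type*} [NormedAddCommGroup Y] [NormedSpace ℝ Y] {Z : Grad n → Y}

lemma differentiable (hZ : IsCurlForm Z) : Differentiable ℝ Z :=
  hZ.contDiff.differentiable (by simp)

lemma fderiv_symm (hZ : IsCurlForm Z) (A X : Grad n) (hX : ∀ i j, X i j = X j i) :
    fderiv ℝ Z A X = 0 := by
  have h := hZ.transpose A X
  have : (fun i j => X j i) = X := by ext i j; exact hX j i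
  rw [this] at h
  have h2 : (2 : ℝ) • fderiv ℝ Z A X = 0 := by
    rw [two_smul]; nth_rewrite 2 [h]; exact add_neg_cancel _
  exact (smul_eq_zero.1 h2).resolve_left two_ne_zero

lemma hasDerivAt_line (hZ : IsCurlForm Z) (A X : Grad n) (s : ℝ) :
    HasDerivAt (fun t : ℝ => Z (A + t • X)) (fderiv ℝ Z (A + s • X) X) s := by
  have h1 : HasDerivAt (fun t : ℝ => A + t • X) X s := by
    simpa using ((hasDerivAt_id s).smul_const X).const_add A
  exact ((hZ.differentiable _).hasFDerivAt).comp_hasDerivAt s h1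

lemma add_symm (hZ : IsCurlForm Z) (A X : Grad n) (hX : ∀ i j, X i j = X j i) :
    Z (A + X) = Z A := by
  have := is_const_of_deriv_eq_zero (f := fun t : ℝ => Z (A + t • X))
    (fun t => (hZ.hasDerivAt_line A X t).differentiableAt)
    (fun t => by rw [(hZ.hasDerivAt_line A X t).deriv, hZ.fderiv_symm _ _ hX]) 1 0
  simpa using this

lemma fderiv_add_symm (hZ : IsCurlForm Z) (A X : Grad n) (hX : ∀ i j, X i j = X j i) :
    fderiv ℝ Z (A + X) = fderiv ℝ Z A := by
  rw [← fderiv_comp_add_right]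
  congr 1
  funext B
  exact hZ.add_symm B X hX

lemma fderiv_swap (hZ : IsCurlForm Z) (A : Grad n) (a b : Fin n → ℝ) :
    fderiv ℝ Z A (FluidFlow.outer b a) = - fderiv ℝ Z A (FluidFlow.outer a b) := by
  rw [← hZ.transpose, transpose_outer]

/-- Up to the symmetric form `a ⊗ b + b ⊗ a`, the shift `a ⊗ b` equals `(-b) ⊗ a`; invariance for a
common right factor thus becomes invariance for a common left factor. -/
lemma outer_left (hZ : IsCurlForm Z) (A : Grad n) (a b d : Fin n → ℝ) :
    fderiv ℝ Z (A + FluidFlow.outer a b) (FluidFlow.outer a d) =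
      fderiv ℝ Z A (FluidFlow.outer a d) := by
  have h1 : A + FluidFlow.outer a b = (A + FluidFlow.outer (-b) a) +
      (FluidFlow.outer a b + FluidFlow.outer b a) := by
    ext i j; simp [FluidFlow.outer]; ring
  rw [h1, hZ.fderiv_add_symm _ _ (fun i j => by simp [FluidFlow.outer]; ring),
    ← neg_inj, ← hZ.fderiv_swap, ← hZ.fderiv_swap, hZ.outer]

/-- The derivative in the direction `a ⊗ b` is constant along that direction, by the field `outer`.
-/
lemma add_outer (hZ : IsCurlForm Z) (A : Grad n) (a b : Fin n → ℝ) :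
    Z (A + FluidFlow.outer a b) = Z A + fderiv ℝ Z A (FluidFlow.outer a b) := by
  have hd : ∀ t : ℝ, HasDerivAt (fun t : ℝ => Z (A + t • FluidFlow.outer a b) -
      t • fderiv ℝ Z A (FluidFlow.outer a b)) 0 t := by
    intro t
    have h1 := (hZ.hasDerivAt_line A (FluidFlow.outer a b) t).fun_sub
      ((hasDerivAt_id t).smul_const (fderiv ℝ Z A (FluidFlow.outer a b)))
    rw [← outer_smul_left, hZ.outer] at h1
    simpa using h1
  have := is_const_of_deriv_eq_zero (fun t => (hd t).differentiableAt) (fun t => (hd t).deriv) 1 0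
  simp only [one_smul, zero_smul, add_zero, sub_zero] at this
  rw [← this]; abel

/-- The derivative in a fixed direction is affine along decomposable directions. -/
lemma fderiv_add_outer_affine (hZ : IsCurlForm Z) (A X : Grad n) (a b : Fin n → ℝ) :
    fderiv ℝ Z (A + FluidFlow.outer a b) X + fderiv ℝ Z (A - FluidFlow.outer a b) X =
      (2 : ℝ) • fderiv ℝ Z A X := by
  have key : ∀ B : Grad n, Z (B + FluidFlow.outer a b) + Z (B - FluidFlow.outer a b) =
      (2 : ℝ) • Z B := by
    intro B
    have h1 : B - FluidFlow.outer a b = B + FluidFlow.outer (-a) b := by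
      ext i j; simp [FluidFlow.outer]; ring
    have h2 : FluidFlow.outer (-a) b = - FluidFlow.outer a b := by
      ext i j; simp [FluidFlow.outer]
    rw [h1, hZ.add_outer, hZ.add_outer, h2, map_neg, two_smul]
    abel
  have hp := (hasFDerivAt_comp_add_right (FluidFlow.outer a b)).2
    (hZ.differentiable (A + FluidFlow.outer a b)).hasFDerivAt
  have hm := (hasFDerivAt_comp_sub (FluidFlow.outer a b)).2
    (hZ.differentiable (A - FluidFlow.outer a b)).hasFDerivAt
  have h0 := (hZ.differentiable A).hasFDerivAt.const_smul (2 : ℝ)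
  have hs := hp.add hm
  have : ((fun B => Z (B + FluidFlow.outer a b)) + fun B => Z (B - FluidFlow.outer a b)) =
      fun B => (2 : ℝ) • Z B := by
    funext B; exact key B
  rw [this] at hs
  simpa using congrArg (fun L : Grad n →L[ℝ] Y => L X) (hs.unique h0)

/-- Vector-valued forms are treated componentwise. -/
lemma of_components {Z : Grad n → Space n} (h : ∀ i, IsCurlForm fun A => Z A i) :
    IsCurlForm Z := by
  have hs : ContDiff ℝ ∞ Z := by
    rw [contDiff_euclidean]; exact fun i => (h i).contDiff
  have hc : ∀ A X i, (fderiv ℝ Z A X) i = fderiv ℝ (fun A => Z A i) A X := by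
    intro A X i
    have h1 : HasFDerivAt Z (fderiv ℝ Z A) A := (hs.differentiable (by simp) A).hasFDerivAt
    have h2 := ((EuclideanSpace.proj i : Space n →L[ℝ] ℝ).hasFDerivAt
      (x := Z A)).comp A h1
    exact (congrArg (fun L : Grad n →L[ℝ] ℝ => L X) h2.fderiv).symm
  refine ⟨hs, fun A X => ?_, fun A a b d => ?_⟩
  · ext i
    simpa [hc] using (h i).transpose A X
  · ext i
    simpa [hc] using (h i).outer A a b d

end IsCurlForm

/-! ### Powers of a single bilinear form, their derivatives and determinant values -/

section CurlPow

variable {n r k : ℕ}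

/-- The alternating product of `r` covectors with `k` copies of one bilinear form. -/
def curlPow (h : r + 2 * k = n) (c : Fin r → Fin n → ℝ) (A : Grad n) : ℝ :=
  altForm h c fun _ => A

lemma hasFDerivAt_curlPow (h : r + 2 * k = n) (c : Fin r → Fin n → ℝ) (A : Grad n) :
    HasFDerivAt (curlPow h c) (((altForm h c).linearDeriv fun _ => A).comp
      (ContinuousLinearMap.pi fun _ => ContinuousLinearMap.id ℝ (Grad n))) A := by
  have h1 : HasFDerivAt (fun A : Grad n => (fun _ : Fin k => A))
      (ContinuousLinearMap.pi fun _ => ContinuousLinearMap.id ℝ (Grad n)) A :=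
    (ContinuousLinearMap.pi fun _ : Fin k => ContinuousLinearMap.id ℝ (Grad n)).hasFDerivAt
  exact ((altForm h c).hasFDerivAt (fun _ => A)).comp A h1

lemma fderiv_curlPow (h : r + 2 * k = n) (c : Fin r → Fin n → ℝ) (A X : Grad n) :
    fderiv ℝ (curlPow h c) A X = ∑ l, altForm h c (Function.update (fun _ => A) l X) := by
  rw [(hasFDerivAt_curlPow h c A).fderiv]
  simp [ContinuousMultilinearMap.linearDeriv_apply]

lemma altForm_update_eq (h : r + 2 * k = n) (c : Fin r → Fin n → ℝ) (A X : Grad n) (l l' : Fin k) :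
    altForm h c (Function.update (fun _ => A) l X) =
      altForm h c (Function.update (fun _ => A) l' X) := by
  rw [← altForm_comp_perm h c (Function.update (fun _ => A) l' X) (swap l l')]
  congr 1
  funext x
  by_cases hx : x = l
  · subst hx; simp
  · by_cases hx' : x = l'
    · subst hx'; simp [Function.update_of_ne hx, Function.update_of_ne (Ne.symm hx)]
    · simp [Function.update_of_ne, hx, hx', swap_apply_of_ne_of_ne]

lemma fderiv_curlPow_eq_mul (h : r + 2 * k = n) (c : Fin r → Fin n → ℝ) (A X : Grad n)
    (l : Fin k) :
    fderiv ℝ (curlPow h c) A X = k * altForm h c (Function.update (fun _ => A) l X) := by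
  rw [fderiv_curlPow, Finset.sum_congr rfl fun l' _ => altForm_update_eq h c A X l' l]
  simp

/-- The remaining factors are changed one at a time: every increment `a ⊗ b` meets `d ⊗ b` with the
same right factor, so its contribution vanishes by `altForm_eq_zero_of_right`. -/
lemma altForm_update_add_outer (h : r + 2 * k = n) (c : Fin r → Fin n → ℝ) (A : Grad n)
    (a b d : Fin n → ℝ) (l : Fin k) :
    altForm h c (Function.update (fun _ => A + outer a b) l (outer d b)) =
      altForm h c (Function.update (fun _ => A) l (outer d b)) := by
  have key : ∀ s : Finset (Fin k), l ∉ s →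
      altForm h c (Function.update (s.piecewise (fun _ => A + outer a b) (fun _ => A))
        l (outer d b)) = altForm h c (Function.update (fun _ => A) l (outer d b)) := by
    intro s
    induction s using Finset.induction_on with
    | empty => intro _; simp
    | insert x s hx ih =>
      intro hl
      have hxl : x ≠ l := fun hh => hl (by simp [hh])
      have hl' : l ∉ s := fun hh => hl (by simp [hh])
      rw [Finset.piecewise_insert, Function.update_comm hxl,
        (altForm h c).map_update_add, ← ih hl']
      have h0 := altForm_eq_zero_of_right h c
        (Function.update (Function.update (s.piecewise (fun _ => A + outer a b) fun _ => A) l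
          (outer d b)) x (outer a b)) hxl (a := a) (b := b) (d := d) (by simp; rfl)
        (by simp [Function.update_of_ne hxl.symm]; rfl)
      rw [h0, add_zero]
      congr 1
      rw [Function.update_comm hxl.symm]
      congr 1
      funext y
      by_cases hy : y = x
      · subst hy; simp [hx]
      · simp [Function.update_of_ne hy]
  have := key (univ.erase l) (by simp)
  rw [← this]
  congr 1
  funext y
  by_cases hy : y = l
  · subst hy; simp
  · simp [hy]

lemma isCurlForm_curlPow (h : r + 2 * k = n) (c : Fin r → Fin n → ℝ) :
    IsCurlForm (curlPow h c) where
  contDiff := (altForm h c).contDiff.comp (contDiff_pi.2 fun _ => contDiff_id)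
  transpose A X := by
    simp only [fderiv_curlPow, altForm_update_transpose, Finset.sum_neg_distrib]
  outer A a b d := by
    simp only [fderiv_curlPow, altForm_update_add_outer]

/-- The trace identity for the derivative of `curlPow` along the square of its argument. -/
lemma fderiv_curlPow_sq (h : r + 2 * k = n) (c : Fin r → Fin n → ℝ) (A : Grad n) :
    fderiv ℝ (curlPow h c) A (fun i j => ∑ p, A i p * A p j) =
      (∑ i, A i i) * curlPow h c A -
        ∑ a, curlPow h (Function.update c a fun j => ∑ i, c a i * A i j) A := by
  -- `curlPow` sees only the antisymmetric part `W` of `A`, and the antisymmetric part of `A²` is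
  -- `AᵀW + WA`, the derivation induced by `A`. This brings the claim under `altForm_trace`.
  set W : Grad n := fun i j => (A i j - A j i) / 2 with hW
  have hA : A = W + fun i j => (A i j + A j i) / 2 := by
    ext i j; simp [hW]; ring
  have hsym : ∀ i j, (fun i j => (A i j + A j i) / 2 : Grad n) i j =
      (fun i j => (A i j + A j i) / 2 : Grad n) j i := fun i j => by simp; ring
  have hval : ∀ c', curlPow h c' A = curlPow h c' W := fun c' => by
    conv_lhs => rw [hA]
    exact (isCurlForm_curlPow h c').add_symm _ _ hsym
  have hder : fderiv ℝ (curlPow h c) A = fderiv ℝ (curlPow h c) W := by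
    conv_lhs => rw [hA]
    exact (isCurlForm_curlPow h c).fderiv_add_symm _ _ hsym
  have htr := altForm_trace h c (fun _ => W) A
  have hX : (fun i j => ∑ p, A i p * A p j : Grad n) =
      (fun i j => ∑ p, A p i * W p j + ∑ p, W i p * A p j) +
        fun i j => ((∑ p, A i p * A p j + ∑ p, A j p * A p i)) / 2 := by
    ext i j
    simp only [hW, Pi.add_apply, add_div, ← Finset.sum_add_distrib, Finset.sum_div]
    refine Finset.sum_congr rfl fun p _ => ?_
    ring
  have hX0 : fderiv ℝ (curlPow h c) W
      (fun i j => ((∑ p, A i p * A p j + ∑ p, A j p * A p i)) / 2) = 0 :=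
    (isCurlForm_curlPow h c).fderiv_symm _ _ fun i j => by rw [add_comm]
  rw [hder, hX, map_add, hX0, add_zero, fderiv_curlPow]
  simp only [hval]
  rw [eq_sub_iff_add_eq, add_comm]
  exact htr

/-- The value on a sum of decomposable forms. -/
lemma curlPow_sum_outer (h : r + 2 * k = n) (c : Fin r → Fin n → ℝ)
    (M : Matrix (Fin n) (Fin n) ℝ) (hc : ∀ a, M (slotC h a) = c a) :
    curlPow h c (∑ l, outer (M (slotL h l)) (M (slotR h l))) = (k.factorial : ℝ) * M.det := by
  set W : Fin k → Grad n := fun l => outer (M (slotL h l)) (M (slotR h l)) with hW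
  -- Multilinear expansion over all maps `p`. A map that is not injective repeats a form `a ⊗ b` and
  -- contributes zero; the `k!` bijections all contribute the same determinant.
  have h1 : curlPow h c (∑ l, W l) = ∑ p : Fin k → Fin k, altForm h c (W ∘ p) := by
    unfold curlPow
    exact (altForm h c).map_sum (g := fun _ l => W l)
  have h2 : ∀ p : Fin k → Fin k, ¬ Function.Bijective p → altForm h c (W ∘ p) = 0 := by
    intro p hp
    rw [← Finite.injective_iff_bijective, Function.Injective] at hp
    push Not at hp
    obtain ⟨l, l', hll, hne⟩ := hp
    exact altForm_eq_zero_of_right h c _ hne (a := M (slotL h (p l))) (d := M (slotL h (p l)))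
      (b := M (slotR h (p l))) rfl (by rw [hll]; rfl)
  have h3 : ∑ p : Fin k → Fin k, altForm h c (W ∘ p) =
      ∑ π : Perm (Fin k), altForm h c (W ∘ π) := by
    rw [← Finset.sum_filter_of_ne (p := Function.Bijective)
      (fun p _ hp => by by_contra hb; exact hp (h2 p hb))]
    exact Finset.sum_bij (fun p h => Equiv.ofBijective p (mem_filter.1 h).2) (fun _ _ => mem_univ _)
      (fun _ _ _ _ hh => by injection hh) (fun b _ => ⟨b, mem_filter.2 ⟨mem_univ _, b.bijective⟩, by ext; simp⟩)
      (fun _ _ => rfl)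
  rw [h1, h3, Finset.sum_congr rfl fun π _ => altForm_comp_perm h c W π]
  have h4 : altForm h c W = M.det := altForm_decomposable h c M hc
  simp [h4, Fintype.card_perm]

/-- All pairs but the first. -/
def partialSum (h : r + 2 * k = n) (M : Matrix (Fin n) (Fin n) ℝ) (l₀ : Fin k) : Grad n :=
  ∑ l ∈ univ.erase l₀, outer (M (slotL h l)) (M (slotR h l))

lemma partialSum_add (h : r + 2 * k = n) (M : Matrix (Fin n) (Fin n) ℝ) (l₀ : Fin k) :
    partialSum h M l₀ + outer (M (slotL h l₀)) (M (slotR h l₀)) =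
      ∑ l, outer (M (slotL h l)) (M (slotR h l)) := by
  rw [partialSum, Finset.sum_erase_add _ _ (mem_univ l₀)]

lemma curlPow_partialSum (h : r + 2 * k = n) (c : Fin r → Fin n → ℝ)
    (M : Matrix (Fin n) (Fin n) ℝ) (l₀ : Fin k) : curlPow h c (partialSum h M l₀) = 0 := by
  -- `M` with the first row of the omitted pair set to zero and the covector rows set to `c`. The
  -- omitted pair then adds nothing to the sum, while the determinant vanishes.
  set M' : Matrix (Fin n) (Fin n) ℝ := fun p => if p = slotL h l₀ then 0 else
    (slotEquiv h).symm p |>.elim c fun _ => M p with hM'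
  have hC : ∀ a, M' (slotC h a) = c a := fun a => by
    simp only [hM', slotC_ne_slotL, if_false]
    rw [← slotEquiv_inl]; simp
  have hL : ∀ l, l ≠ l₀ → M' (slotL h l) = M (slotL h l) := fun l hl => by
    simp only [hM', slotL_inj, hl, if_false]
    rw [← slotEquiv_inr_zero]; simp
  have hR : ∀ l, M' (slotR h l) = M (slotR h l) := fun l => by
    simp only [hM', slotR_ne_slotL, if_false]
    rw [← slotEquiv_inr_one]; simp
  have h0 : M' (slotL h l₀) = 0 := by simp [hM']
  have hd : M'.det = 0 := Matrix.det_eq_zero_of_row_eq_zero (slotL h l₀) fun j => by rw [h0]; rfl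
  have := curlPow_sum_outer h c M' hC
  rw [hd, mul_zero, ← partialSum_add h M' l₀, h0] at this
  have h5 : partialSum h M' l₀ = partialSum h M l₀ :=
    Finset.sum_congr rfl fun l hl => by rw [hL l (Finset.ne_of_mem_erase hl), hR]
  have h6 : outer 0 (M' (slotR h l₀)) = 0 := by ext i j; simp [outer]
  rwa [h5, h6, add_zero] at this

/-- These are the test points of the classification: base gradients with zero vorticity at which one
decomposable direction produces the vorticity `k! det M`. -/
lemma fderiv_curlPow_partialSum (h : r + 2 * k = n) (c : Fin r → Fin n → ℝ)
    (M : Matrix (Fin n) (Fin n) ℝ) (hc : ∀ a, M (slotC h a) = c a) (l₀ : Fin k) :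
    fderiv ℝ (curlPow h c) (partialSum h M l₀) (outer (M (slotL h l₀)) (M (slotR h l₀))) =
      (k.factorial : ℝ) * M.det := by
  have := (isCurlForm_curlPow h c).add_outer (partialSum h M l₀) (M (slotL h l₀)) (M (slotR h l₀))
  rw [curlPow_partialSum, zero_add, partialSum_add, curlPow_sum_outer h c M hc] at this
  exact this.symm

end CurlPow

end FluidFlow

end

noncomputable section

namespace FluidFlow

open MeasureTheory

/-! ### First-order jets and first-order Lagrangians -/

/-- Values and first derivatives of the fluid variables. -/
abbrev Jet1 (n : ℕ) := FluidVar n × (Fin n → FluidVar n)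

/-- The basis vector `eᵢ` of `ℝⁿ`. -/
abbrev basisVec {n : ℕ} (i : Fin n) : Space n := EuclideanSpace.single i (1 : ℝ)

/-- The values and first derivatives of a configuration. -/
def firstJet {n : ℕ} (w : Space n → FluidVar n) (x : Space n) : Jet1 n :=
  (w x, fun i => fderiv ℝ w x (basisVec i))

variable {n : ℕ}

/-- The first-order jets with positive density. -/
def posJet (n : ℕ) : Set (Jet1 n) := {j | 0 < j.1.1}

lemma isOpen_posJet : IsOpen (posJet n) :=
  isOpen_lt continuous_const (by fun_prop)

lemma firstJet_mem_posJet {w : Space n → FluidVar n} (hw : IsFluidState w) (x : Space n) :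
    firstJet w x ∈ posJet n := hw.2 x

lemma contDiff_firstJet {w : Space n → FluidVar n} (hw : ContDiff ℝ ∞ w) :
    ContDiff ℝ ∞ (firstJet w) := by
  have h1 : ContDiff ℝ ∞ (fderiv ℝ w) := hw.fderiv_right (by simp)
  exact hw.prodMk (contDiff_pi.2 fun i => h1.clm_apply contDiff_const)

lemma contDiff_jet {w : Space n → FluidVar n} (hw : ContDiff ℝ ∞ w) (k : ℕ) :
    ContDiff ℝ ∞ (jet k w) :=
  contDiff_pi.2 fun j => hw.iteratedFDeriv_right (by exact_mod_cast le_top)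

lemma fluidVar_jet {k : ℕ} (w : Space n → FluidVar n) (t : ℝ) (x : Space n) :
    fluidVar ((t, x, jet k w x) : JetPoint n k) = w x := by
  simp only [fluidVar, jet]
  exact iteratedFDeriv_zero_apply _

lemma fluidVarD_jet (w : Space n → FluidVar n) (t : ℝ) (x : Space n) (i : Fin n) :
    fluidVarD ((t, x, jet 1 w x) : JetPoint n 1) i = fderiv ℝ w x (basisVec i) := by
  simp only [fluidVarD, jet]
  exact iteratedFDeriv_one_apply _

lemma contDiff_fluidVar {k : ℕ} : ContDiff ℝ ∞ (fluidVar : JetPoint n k → FluidVar n) := by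
  unfold fluidVar
  have h1 : ContDiff ℝ ∞ fun q : JetPoint n k => q.2.2 0 :=
    (ContinuousLinearMap.proj (R := ℝ)
      (φ := fun j : Fin (k + 1) => (Space n) [×(j : ℕ)]→L[ℝ] (FluidVar n)) 0).contDiff.comp
        (contDiff_snd.comp contDiff_snd)
  exact (ContinuousMultilinearMap.apply ℝ (fun _ : Fin ((0 : Fin (k + 1)) : ℕ) => Space n)
    (FluidVar n) (fun _ => 0)).contDiff.comp h1

/-- Local functions are smooth along smooth states. -/
lemma IsLocalFunction.contDiff_comp_jet {k : ℕ} {Y : Type*} [NormedAddCommGroup Y]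
    [NormedSpace ℝ Y] {F : JetPoint n k → Y} (hF : IsLocalFunction F) {w : Space n → FluidVar n}
    (hw : IsFluidState w) (t : ℝ) : ContDiff ℝ ∞ fun y => F (t, y, jet k w y) := by
  rw [← contDiffOn_univ]
  refine ContDiffOn.comp hF (t := {q | 0 < (fluidVar q).1})
    (f := fun y => ((t, y, jet k w y) : JetPoint n k)) ?_ ?_
  · exact (contDiff_const.prodMk (contDiff_id.prodMk (contDiff_jet hw.1 k))).contDiffOn
  · intro y _
    simp only [Set.mem_ofPred_eq, fluidVar_jet]
    exact hw.2 y

/-- The integral of a derivative of a compactly supported function vanishes. -/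
lemma integral_partialD_eq_zero {g : Space n → ℝ} (hg : ContDiff ℝ ∞ g)
    (hc : HasCompactSupport g) (i : Fin n) : ∫ x, partialD i g x = 0 := by
  have hg' : Continuous (fun x => fderiv ℝ g x (basisVec i)) :=
    (hg.continuous_fderiv (by simp)).clm_apply continuous_const
  have := integral_mul_fderiv_eq_neg_fderiv_mul_of_integrable (𝕜 := ℝ) (μ := volume)
    (f := fun _ : Space n => (1 : ℝ)) (g := g) (v := basisVec i) (by simp)
    (by simpa using hg'.integrable_of_hasCompactSupport (hc.fderiv_apply (𝕜 := ℝ) _))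
    (by simpa using hg.continuous.integrable_of_hasCompactSupport hc)
    (fun x _ => differentiableAt_const _) (fun x _ => hg.differentiable (by simp) x)
  simpa [partialD] using this

/-- A first-order Lagrangian that is a total divergence on all fluid states. -/
def IsDivergence (L : Jet1 n → ℝ) : Prop :=
  ∃ (k : ℕ) (Θ : JetPoint n k → Space n), IsLocalFunction Θ ∧
    ∀ w : Space n → FluidVar n, IsFluidState w → ∀ x : Space n,
      L (firstJet w x) = totalDiv Θ w 0 x

/-- A compactly supported change of state alters the potential `Θ` only inside the support, so the
change of its divergence integrates to zero. -/
lemma IsDivergence.integral_eq_zero {L : Jet1 n → ℝ} (hL : IsDivergence L)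
    {w η : Space n → FluidVar n} (hw : IsFluidState w)
    (hc : HasCompactSupport η) (hwη : IsFluidState (w + η)) :
    ∫ x, (L (firstJet (w + η) x) - L (firstJet w x)) = 0 := by
  obtain ⟨k, Θ, hΘ, h⟩ := hL
  set g : Fin n → Space n → ℝ := fun i y =>
    Θ (0, y, jet k (w + η) y) i - Θ (0, y, jet k w y) i with hg
  have hs₁ := contDiff_euclidean.1 (hΘ.contDiff_comp_jet hwη 0)
  have hs₂ := contDiff_euclidean.1 (hΘ.contDiff_comp_jet hw 0)
  have hgs : ∀ i, ContDiff ℝ ∞ (g i) := fun i => (hs₁ i).sub (hs₂ i)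
  have hgc : ∀ i, HasCompactSupport (g i) := fun i => by
    refine HasCompactSupport.intro hc fun x hx => ?_
    have he : (w + η) =ᶠ[nhds x] w := by
      filter_upwards [(isClosed_tsupport η).isOpen_compl.mem_nhds hx] with y hy
      simp [image_eq_zero_of_notMem_tsupport hy]
    have hj : jet k (w + η) x = jet k w x := by
      funext j
      exact (he.iteratedFDeriv ℝ j).eq_of_nhds
    simp [hg, hj]
  have hsum : ∀ x, L (firstJet (w + η) x) - L (firstJet w x) = ∑ i, partialD i (g i) x := by
    intro x
    rw [h _ hwη, h _ hw, totalDiv, totalDiv, ← Finset.sum_sub_distrib]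
    refine Finset.sum_congr rfl fun i _ => ?_
    have := fderiv_fun_sub ((hs₁ i).differentiable (by simp) x) ((hs₂ i).differentiable (by simp) x)
    simp only [partialD, hg]
    rw [this]; rfl
  simp only [hsum]
  rw [integral_finsetSum]
  · exact Finset.sum_eq_zero fun i _ => integral_partialD_eq_zero (hgs i) (hgc i) i
  · intro i _
    have hg' : Continuous (fun x => fderiv ℝ (g i) x (basisVec i)) :=
      ((hgs i).continuous_fderiv (by simp)).clm_apply continuous_const
    exact hg'.integrable_of_hasCompactSupport ((hgc i).fderiv_apply (𝕜 := ℝ) _)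

/-- Differentiation under the integral sign along a compactly supported variation. -/
lemma integral_firstVariation {L : Jet1 n → ℝ} (hs : ContDiffOn ℝ ∞ L (posJet n))
    {j η : Space n → Jet1 n} (hj : Continuous j) (hη : Continuous η) (hc : HasCompactSupport η)
    (hpos : ∀ (s : ℝ) x, j x + s • η x ∈ posJet n)
    (h0 : ∀ s : ℝ, ∫ x, (L (j x + s • η x) - L (j x)) = 0) :
    ∫ x, fderiv ℝ L (j x) (η x) = 0 := by
  have hLc : ContinuousOn (fderiv ℝ L) (posJet n) :=
    hs.continuousOn_fderiv_of_isOpen isOpen_posJet (by simp)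
  have hd : ∀ q ∈ posJet n, HasFDerivAt L (fderiv ℝ L q) q := fun q hq =>
    ((hs.differentiableOn (by simp)).differentiableAt (isOpen_posJet.mem_nhds hq)).hasFDerivAt
  have hcont : Continuous fun p : ℝ × Space n => j p.2 + p.1 • η p.2 := by fun_prop
  have hD : Continuous fun p : ℝ × Space n => fderiv ℝ L (j p.2 + p.1 • η p.2) (η p.2) := by
    have h1 : Continuous fun p : ℝ × Space n => fderiv ℝ L (j p.2 + p.1 • η p.2) :=
      hLc.comp_continuous hcont fun p => hpos p.1 p.2
    exact h1.clm_apply (hη.comp continuous_snd)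
  have hpos0 : ∀ x, j x ∈ posJet n := fun x => by simpa using hpos 0 x
  have hF : ∀ s : ℝ, Continuous fun x => L (j x + s • η x) - L (j x) := fun s =>
    (hs.continuousOn.comp_continuous (by fun_prop) (hpos s)).sub
      (hs.continuousOn.comp_continuous hj hpos0)
  obtain ⟨C, hC⟩ := (isCompact_Icc (a := (-1 : ℝ)) (b := 1)).prod hc |>.exists_bound_of_continuousOn
    hD.continuousOn
  have hder := (hasDerivAt_integral_of_dominated_loc_of_deriv_le (μ := (volume : Measure (Space n)))
    (F := fun (s : ℝ) x => L (j x + s • η x) - L (j x))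
    (F' := fun (s : ℝ) x => fderiv ℝ L (j x + s • η x) (η x))
    (x₀ := 0) (s := Set.Icc (-1) 1) (bound := (tsupport η).indicator fun _ => C)
    (Icc_mem_nhds (by norm_num) (by norm_num))
    (Filter.Eventually.of_forall fun s => (hF s).aestronglyMeasurable)
    (by simp)
    (by
      have : Continuous fun x => fderiv ℝ L (j x + (0 : ℝ) • η x) (η x) :=
        hD.comp (continuous_const.prodMk continuous_id)
      exact this.aestronglyMeasurable)
    (Filter.Eventually.of_forall fun x s hsm => by
      by_cases hx : x ∈ tsupport η
      · rw [Set.indicator_of_mem hx]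
        exact hC (s, x) ⟨hsm, hx⟩
      · rw [Set.indicator_of_notMem hx, image_eq_zero_of_notMem_tsupport hx]
        simp)
    ((integrable_indicator_iff (isClosed_tsupport η).measurableSet).2
      (integrableOn_const (hs := hc.measure_lt_top.ne)))
    (Filter.Eventually.of_forall fun x s _ => by
      have h1 : HasDerivAt (fun s : ℝ => j x + s • η x) (η x) s := by
        simpa using ((hasDerivAt_id s).smul_const (η x)).const_add (j x)
      exact ((hd _ (hpos s x)).comp_hasDerivAt s h1).sub_const _)).2
  simp only [h0] at hder
  have := hder.unique (hasDerivAt_const (0 : ℝ) (0 : ℝ))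
  simpa using this

/-- The Euler–Lagrange equations hold identically for a total divergence. -/
lemma IsDivergence.eulerLagrange {L : Jet1 n → ℝ} (hL : IsDivergence L)
    (hs : ContDiffOn ℝ ∞ L (posJet n)) {w : Space n → FluidVar n} (hw : IsFluidState w)
    {a : FluidVar n} (ha : a.1 = 0) (x : Space n) :
    fderiv ℝ L (firstJet w x) (a, 0) =
      ∑ i, partialD i (fun y => fderiv ℝ L (firstJet w y) (0, Pi.single i a)) x := by
  have hfd : ContDiffOn ℝ ∞ (fderiv ℝ L) (posJet n) :=
    hs.fderiv_of_isOpen isOpen_posJet (by simp)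
  have hfw : ContDiff ℝ ∞ fun y => fderiv ℝ L (firstJet w y) := by
    rw [← contDiffOn_univ]
    exact hfd.comp (contDiff_firstJet hw.1).contDiffOn fun y _ => firstJet_mem_posJet hw y
  set A0 : Space n → ℝ := fun y => fderiv ℝ L (firstJet w y) (a, 0) with hA0
  set B : Fin n → Space n → ℝ := fun i y => fderiv ℝ L (firstJet w y) (0, Pi.single i a) with hB
  have hA0s : ContDiff ℝ ∞ A0 := hfw.clm_apply contDiff_const
  have hBs : ∀ i, ContDiff ℝ ∞ (B i) := fun i => hfw.clm_apply contDiff_const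
  have hB' : ∀ i, Continuous (partialD i (B i)) := fun i =>
    ((hBs i).continuous_fderiv (by simp)).clm_apply continuous_const
  have hcontD : Continuous fun y => A0 y - ∑ i, partialD i (B i) y :=
    hA0s.continuous.sub (continuous_finsetSum _ fun i _ => hB' i)
  -- The weak form of the claim: the variation is `φ a` with a scalar test function `φ`, and the
  -- derivatives of `φ` are removed by integration by parts.
  have hzero : ∀ φ : Space n → ℝ, ContDiff ℝ ∞ φ → HasCompactSupport φ →
      ∫ y, φ y • (A0 y - ∑ i, partialD i (B i) y) = 0 := by
    intro φ hφ hφc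
    set η : Space n → FluidVar n := fun y => φ y • a with hη
    have hηs : ContDiff ℝ ∞ η := hφ.smul contDiff_const
    have hηc : HasCompactSupport η := hφc.smul_right
    have hηd : ∀ y i, fderiv ℝ η y (basisVec i) = (partialD i φ y) • a := by
      intro y i
      have := ((hφ.differentiable (by simp) y).hasFDerivAt.smul_const a).fderiv
      simp only [hη]
      rw [this]; rfl
    -- Because `a` has no density component, the varied states keep `ρ > 0` for every real `s`, so
    -- no smallness of the variation is needed.
    have hst : ∀ s : ℝ, IsFluidState (w + s • η) := fun s =>
      ⟨hw.1.add (hηs.const_smul s), fun y => by simpa [hη, ha] using hw.2 y⟩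
    have hjet : ∀ (s : ℝ) y, firstJet (w + s • η) y = firstJet w y + s • firstJet η y := by
      intro s y
      have h1 : fderiv ℝ (w + s • η) y = fderiv ℝ w y + s • fderiv ℝ η y := by
        exact ((hw.1.differentiable (by simp) y).hasFDerivAt.add
          ((hηs.differentiable (by simp) y).hasFDerivAt.const_smul s)).fderiv
      simp only [firstJet, h1]
      rfl
    have hjc : HasCompactSupport (firstJet η) := by
      refine HasCompactSupport.intro hηc fun y hy => ?_
      have h1 : fderiv ℝ η y = 0 := by
        by_contra hne
        exact hy (support_fderiv_subset ℝ hne)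
      simp only [firstJet, h1, image_eq_zero_of_notMem_tsupport hy]
      rfl
    have h1 := integral_firstVariation hs (contDiff_firstJet hw.1).continuous
      (contDiff_firstJet hηs).continuous hjc
      (fun s y => by rw [← hjet]; exact firstJet_mem_posJet (hst s) y)
      (fun s => by
        simp only [← hjet]
        exact hL.integral_eq_zero hw (hηc.smul_left (f := fun _ => s)) (hst s))
    have h2 : ∀ y, fderiv ℝ L (firstJet w y) (firstJet η y) =
        φ y * A0 y + ∑ i, B i y * partialD i φ y := by
      intro y
      have : firstJet η y = φ y • ((a, 0) : Jet1 n) +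
          ∑ i, partialD i φ y • ((0, Pi.single i a) : Jet1 n) := by
        simp only [firstJet, hηd]
        refine Prod.ext ?_ ?_
        · simp [hη, Prod.fst_sum]
        · funext l
          simp [Prod.snd_sum, Finset.sum_apply, Pi.single_apply]
      rw [this, map_add, map_smul, map_sum]
      simp only [map_smul, smul_eq_mul, hA0, hB, mul_comm]
    have hφ' : ∀ i, Continuous (partialD i φ) := fun i =>
      (hφ.continuous_fderiv (by simp)).clm_apply continuous_const
    have hφc' : ∀ i, HasCompactSupport (partialD i φ) := fun i =>
      hφc.fderiv_apply (𝕜 := ℝ) _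
    have hi0 : Integrable fun y => φ y * A0 y :=
      (hφ.continuous.mul hA0s.continuous).integrable_of_hasCompactSupport hφc.mul_right
    have hi1 : ∀ i, Integrable fun y => B i y * partialD i φ y := fun i =>
      ((hBs i).continuous.mul (hφ' i)).integrable_of_hasCompactSupport (hφc' i).mul_left
    have hi2 : ∀ i, Integrable fun y => partialD i (B i) y * φ y := fun i =>
      ((hB' i).mul hφ.continuous).integrable_of_hasCompactSupport hφc.mul_left
    have hi3 : ∀ i, Integrable fun y => B i y * φ y := fun i =>
      ((hBs i).continuous.mul hφ.continuous).integrable_of_hasCompactSupport hφc.mul_left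
    have hparts : ∀ i, ∫ y, B i y * partialD i φ y = - ∫ y, partialD i (B i) y * φ y := fun i =>
      integral_mul_fderiv_eq_neg_fderiv_mul_of_integrable (hi2 i) (hi1 i) (hi3 i)
        (fun x _ => (hBs i).differentiable (by simp) x) (fun x _ => hφ.differentiable (by simp) x)
    simp only [h2] at h1
    rw [integral_add hi0 (integrable_finsetSum _ fun i _ => hi1 i),
      integral_finsetSum _ fun i _ => hi1 i] at h1
    simp only [hparts, Finset.sum_neg_distrib] at h1
    simp only [smul_eq_mul, mul_sub, Finset.mul_sum]
    rw [integral_sub hi0 (integrable_finsetSum _ fun i _ => by simpa only [mul_comm] using hi2 i),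
      integral_finsetSum _ fun i _ => by simpa only [mul_comm] using hi2 i]
    simp only [mul_comm (φ _) (partialD _ _ _)]
    linarith
  have hae := ae_eq_zero_of_integral_contDiff_smul_eq_zero (μ := volume)
    hcontD.locallyIntegrable fun φ hφ hc => hzero φ hφ hc
  have := Continuous.ae_eq_iff_eq volume hcontD continuous_const |>.1 hae
  have hx := congrFun this x
  linarith

end FluidFlow

end

/-! ### States with prescribed jets, and Euler–Lagrange identities on jets -/

noncomputable section

namespace FluidFlow

variable {n : ℕ}

/-- A fluid state with prescribed first-order jet at the origin and second derivatives
`∂ᵢ∂ₗ w = bᵢ bₗ a`. -/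
lemma exists_state (v : FluidVar n) (hv : 0 < v.1) (G : Fin n → FluidVar n) (b : Fin n → ℝ)
    (a : FluidVar n) (ha : a.1 = 0) :
    ∃ w : Space n → FluidVar n, IsFluidState w ∧ firstJet w 0 = (v, G) ∧
      ∀ i, fderiv ℝ (firstJet w) 0 (basisVec i) = (G i, fun l => (b i * b l) • a) := by
  set pr : Fin n → (Space n →L[ℝ] ℝ) := fun i => EuclideanSpace.proj i with hpr
  set L : Space n →L[ℝ] FluidVar n := ∑ i, (pr i).smulRight (G i) with hL
  set β : Space n →L[ℝ] ℝ := ∑ i, b i • pr i with hβ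
  set R : Space n →L[ℝ] ℝ := ∑ i, (G i).1 • pr i with hR
  -- Bends a linear density profile into `ρ + (ρ/2) sin(2R/ρ)` with `ρ = v.1`, which stays at least
  -- `ρ/2`. The value and the first two derivatives of `ψ` vanish at `0`, so the prescribed jet is
  -- unaffected.
  set ψ : ℝ → ℝ := fun s => v.1 / 2 * Real.sin (2 / v.1 * s) - s with hψ
  set e : FluidVar n := (1, 0, 0) with he
  set w : Space n → FluidVar n := fun x => v + L x + (β x ^ 2 / 2) • a + ψ (R x) • e with hw
  have hprb : ∀ i l, pr i (basisVec l) = if i = l then 1 else 0 := fun i l => by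
    simp [hpr, basisVec]
  have hLb : ∀ l, L (basisVec l) = G l := fun l => by
    simp [hL, hprb, sum_apply]
  have hβb : ∀ l, β (basisVec l) = b l := fun l => by
    simp [hβ, hprb, sum_apply]
  have hRb : ∀ l, R (basisVec l) = (G l).1 := fun l => by
    simp [hR, hprb, sum_apply]
  have hψs : ContDiff ℝ ∞ ψ := by fun_prop
  have hws : ContDiff ℝ ∞ w := by fun_prop
  have hψ' : ∀ s, HasDerivAt ψ (Real.cos (2 / v.1 * s) - 1) s := by
    intro s
    have h1 : HasDerivAt (fun s : ℝ => 2 / v.1 * s) (2 / v.1) s := by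
      simpa using (hasDerivAt_id s).const_mul (2 / v.1)
    have h2 := ((h1.sin).const_mul (v.1 / 2)).fun_sub (hasDerivAt_id s)
    refine h2.congr_deriv ?_
    have := hv.ne'
    field_simp
  have hwd : ∀ x l, fderiv ℝ w x (basisVec l) = G l + (β x * b l) • a +
      ((Real.cos (2 / v.1 * R x) - 1) * (G l).1) • e := by
    intro x l
    have h1 : HasFDerivAt (fun x => v + L x) L x := L.hasFDerivAt.const_add v
    have h2 : HasFDerivAt (fun x => (β x ^ 2 / 2)) (β x • β) x := by
      have := ((β.hasFDerivAt (x := x)).pow 2).mul_const (1 / 2 : ℝ)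
      refine (this.congr_fderiv ?_).congr_of_eventuallyEq
        (Filter.Eventually.of_forall fun y => by simp; ring)
      ext y; simp; ring
    have h3 : HasFDerivAt (fun x => ψ (R x)) ((Real.cos (2 / v.1 * R x) - 1) • R) x :=
      (hψ' (R x)).comp_hasFDerivAt x R.hasFDerivAt
    have h4 := (h1.add (h2.smul_const a)).add (h3.smul_const e)
    have h5 : fderiv ℝ w x = _ := h4.fderiv
    rw [h5]
    simp [hLb, hβb, hRb]
  refine ⟨w, ⟨hws, fun x => ?_⟩, ?_, fun i => ?_⟩
  · have hLR : (L x).1 = R x := by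
      simp [hL, hR, sum_apply, Prod.fst_sum, mul_comm]
    have h1 : (w x).1 = v.1 + v.1 / 2 * Real.sin (2 / v.1 * R x) := by
      simp [hw, ha, hLR, hψ, he]
    rw [h1]
    nlinarith [Real.neg_one_le_sin (2 / v.1 * R x)]
  · refine Prod.ext ?_ ?_
    · simp [firstJet, hw, hψ]
    · funext l
      simp [firstJet, hwd]
  · have hjet : firstJet w = fun x => (w x, fun l => G l + (β x * b l) • a +
        ((Real.cos (2 / v.1 * R x) - 1) * (G l).1) • e) := by
      funext x
      simp only [firstJet, hwd]
    have h1 : HasFDerivAt w (fderiv ℝ w 0) 0 := (hws.differentiable (by simp) 0).hasFDerivAt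
    have h3 : ∀ l, HasFDerivAt (fun x => (Real.cos (2 / v.1 * R x) - 1) * (G l).1)
        (0 : Space n →L[ℝ] ℝ) 0 := by
      intro l
      have h := ((((R.hasFDerivAt (x := 0)).const_mul (2 / v.1)).cos).sub_const 1).mul_const
        (G l).1
      simpa using h
    have h2 : ∀ l, HasFDerivAt (fun x => G l + (β x * b l) • a +
        ((Real.cos (2 / v.1 * R x) - 1) * (G l).1) • e)
        ((b l • β).smulRight a) 0 := by
      intro l
      have h := ((((β.hasFDerivAt (x := 0)).mul_const (b l)).smul_const a).const_add (G l)).add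
        ((h3 l).smul_const e)
      refine h.congr_fderiv ?_
      ext y <;> simp
    have h4 := (h1.prodMk (hasFDerivAt_pi.2 h2)).fderiv
    rw [← hjet] at h4
    rw [h4]
    refine Prod.ext ?_ ?_
    · simp [hwd]
    · funext l
      simp [hβb, mul_comm]

/-- The Euler–Lagrange equations of a total divergence, as identities on jets. -/
lemma IsDivergence.eulerLagrange_jet {L : Jet1 n → ℝ} (hL : IsDivergence L)
    (hs : ContDiffOn ℝ ∞ L (posJet n)) (v : FluidVar n) (hv : 0 < v.1) (G : Fin n → FluidVar n)
    (b : Fin n → ℝ) {a a' : FluidVar n} (ha : a.1 = 0) (ha' : a'.1 = 0) :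
    fderiv ℝ L (v, G) (a, 0) =
      ∑ i, fderiv ℝ (fun q => fderiv ℝ L q (0, Pi.single i a)) (v, G)
        (G i, fun l => (b i * b l) • a') := by
  obtain ⟨w, hw, hw0, hw1⟩ := exists_state v hv G b a' ha'
  have h := hL.eulerLagrange hs hw ha 0
  rw [hw0] at h
  rw [h]
  refine Finset.sum_congr rfl fun i _ => ?_
  have hfd : ContDiffOn ℝ ∞ (fderiv ℝ L) (posJet n) :=
    hs.fderiv_of_isOpen isOpen_posJet (by simp)
  have hg : DifferentiableAt ℝ (fun q => fderiv ℝ L q (0, Pi.single i a)) (firstJet w 0) :=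
    ((hfd.clm_apply contDiffOn_const).differentiableOn (by simp)).differentiableAt
      (isOpen_posJet.mem_nhds (firstJet_mem_posJet hw 0))
  have hj : DifferentiableAt ℝ (firstJet w) 0 := (contDiff_firstJet hw.1).differentiable (by simp) 0
  have h2 := fderiv_comp 0 hg hj
  unfold partialD
  have h3 : (fun y => fderiv ℝ L (firstJet w y) (0, Pi.single i a)) =
      (fun q => fderiv ℝ L q (0, Pi.single i a)) ∘ firstJet w := rfl
  rw [h3, h2, hw0]
  simp only [ContinuousLinearMap.comp_apply]
  rw [hw1 i]

/-- The zeroth-order part of the Euler–Lagrange equations. -/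
lemma IsDivergence.lowerOrder {L : Jet1 n → ℝ} (hL : IsDivergence L)
    (hs : ContDiffOn ℝ ∞ L (posJet n)) (v : FluidVar n) (hv : 0 < v.1) (G : Fin n → FluidVar n)
    {a : FluidVar n} (ha : a.1 = 0) :
    fderiv ℝ L (v, G) (a, 0) =
      ∑ i, fderiv ℝ (fun q => fderiv ℝ L q (0, Pi.single i a)) (v, G) (G i, 0) := by
  have := hL.eulerLagrange_jet hs v hv G 0 ha (a' := 0) rfl
  simpa [← Pi.zero_def] using this

/-- The second-order part of the Euler–Lagrange equations: total divergences are affine along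
decomposable directions. -/
lemma IsDivergence.rankOne {L : Jet1 n → ℝ} (hL : IsDivergence L)
    (hs : ContDiffOn ℝ ∞ L (posJet n)) (v : FluidVar n) (hv : 0 < v.1) (G : Fin n → FluidVar n)
    (b : Fin n → ℝ) {a : FluidVar n} (ha : a.1 = 0) :
    L (v, fun i => G i + b i • a) + L (v, fun i => G i - b i • a) = 2 * L (v, G) := by
  set D : Fin n → FluidVar n := fun i => b i • a with hD
  have hfd : ContDiffOn ℝ ∞ (fderiv ℝ L) (posJet n) :=
    hs.fderiv_of_isOpen isOpen_posJet (by simp)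
  have hmem : ∀ G' : Fin n → FluidVar n, ((v, G') : Jet1 n) ∈ posJet n := fun G' => hv
  have hDsum : ((0, D) : Jet1 n) = ∑ i, b i • ((0, Pi.single i a) : Jet1 n) := by
    refine Prod.ext ?_ ?_
    · simp [Prod.fst_sum]
    · funext l
      simp [hD, Prod.snd_sum, Finset.sum_apply, Pi.single_apply]
  have hB : ∀ i G', DifferentiableAt ℝ (fun q => fderiv ℝ L q (0, Pi.single i a)) (v, G') :=
    fun i G' => ((hfd.clm_apply contDiffOn_const).differentiableOn (by simp)).differentiableAt
      (isOpen_posJet.mem_nhds (hmem G'))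
  -- Compare the Euler–Lagrange identity for second derivatives `bᵢ bₗ a` with the one for zero
  -- second derivatives: the difference is the second derivative of `L` along `D`.
  have hsecond : ∀ G', fderiv ℝ (fun q => fderiv ℝ L q (0, D)) (v, G') (0, D) = 0 := by
    intro G'
    have h1 := hL.eulerLagrange_jet hs v hv G' b ha ha
    have h2 := hL.lowerOrder hs v hv G' ha
    rw [h2, ← sub_eq_zero, ← Finset.sum_sub_distrib] at h1
    have h3 : (fun q => fderiv ℝ L q (0, D)) =
        fun q => ∑ i, b i * fderiv ℝ L q (0, Pi.single i a) := by
      funext q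
      rw [hDsum, map_sum]
      simp only [map_smul, smul_eq_mul]
    rw [h3, fderiv_fun_sum fun i _ => (hB i G').const_mul (b i)]
    rw [← neg_eq_zero, ← h1, sum_apply, ← Finset.sum_neg_distrib]
    refine Finset.sum_congr rfl fun i _ => ?_
    rw [fderiv_const_mul (hB i G'), ← map_sub]
    simp only [smul_apply, smul_eq_mul]
    rw [← smul_eq_mul, ← map_smul, ← map_neg]
    congr 1
    refine Prod.ext (by simp) ?_
    funext l
    simp [hD, smul_smul]
  have hline : ∀ s : ℝ, HasDerivAt (fun s : ℝ => ((v, G + s • D) : Jet1 n)) (0, D) s := by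
    intro s
    have h1 : HasDerivAt (fun s : ℝ => G + s • D) D s := by
      simpa using ((hasDerivAt_id s).smul_const D).const_add G
    exact (hasDerivAt_const s v).prodMk h1
  have hd1 : ∀ s : ℝ, HasDerivAt (fun s : ℝ => L (v, G + s • D))
      (fderiv ℝ L (v, G + s • D) (0, D)) s := fun s =>
    ((hs.differentiableOn (by simp)).differentiableAt
      (isOpen_posJet.mem_nhds (hmem _))).hasFDerivAt.comp_hasDerivAt s (hline s)
  have hd2 : ∀ s : ℝ, HasDerivAt (fun s : ℝ => fderiv ℝ L (v, G + s • D) (0, D)) 0 s := by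
    intro s
    have h1 : DifferentiableAt ℝ (fun q => fderiv ℝ L q (0, D)) (v, G + s • D) :=
      ((hfd.clm_apply contDiffOn_const).differentiableOn (by simp)).differentiableAt
        (isOpen_posJet.mem_nhds (hmem _))
    have h2 := h1.hasFDerivAt.comp_hasDerivAt s (hline s)
    rw [hsecond] at h2
    exact h2
  have hc : ∀ s : ℝ, fderiv ℝ L (v, G + s • D) (0, D) = fderiv ℝ L (v, G) (0, D) := by
    intro s
    have := is_const_of_deriv_eq_zero (fun s => (hd2 s).differentiableAt)
      (fun s => (hd2 s).deriv) s 0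
    simpa using this
  have hd3 : ∀ s : ℝ, HasDerivAt (fun s : ℝ => L (v, G + s • D) - s * fderiv ℝ L (v, G) (0, D))
      0 s := by
    intro s
    have h1 := (hd1 s).fun_sub ((hasDerivAt_id s).mul_const (fderiv ℝ L (v, G) (0, D)))
    rw [hc] at h1
    simpa using h1
  have hc3 := fun s => is_const_of_deriv_eq_zero (fun s => (hd3 s).differentiableAt)
    (fun s => (hd3 s).deriv) s 0
  have e1 := hc3 1
  have e2 := hc3 (-1)
  have g1 : (fun i => G i + b i • a) = G + (1 : ℝ) • D := by funext i; simp [hD]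
  have g2 : (fun i => G i - b i • a) = G + (-1 : ℝ) • D := by
    funext i; simp [hD, sub_eq_add_neg]
  rw [g1, g2]
  simp only [zero_smul, add_zero, zero_mul, sub_zero] at e1 e2
  linarith

end FluidFlow

end

noncomputable section

namespace FluidFlow

variable {n : ℕ}

/-! ### Calculus of partial derivatives -/

section PartialD

variable {f g : Space n → ℝ} {x : Space n}

lemma contDiff_partialD (hf : ContDiff ℝ ∞ f) (i : Fin n) : ContDiff ℝ ∞ (partialD i f) :=
  (hf.fderiv_right (by simp)).clm_apply contDiff_const

lemma partialD_add (hf : DifferentiableAt ℝ f x) (hg : DifferentiableAt ℝ g x) (i : Fin n) :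
    partialD i (fun y => f y + g y) x = partialD i f x + partialD i g x := by
  simp [partialD, fderiv_fun_add hf hg]

lemma partialD_sub (hf : DifferentiableAt ℝ f x) (hg : DifferentiableAt ℝ g x) (i : Fin n) :
    partialD i (fun y => f y - g y) x = partialD i f x - partialD i g x := by
  simp [partialD, fderiv_fun_sub hf hg]

lemma partialD_neg (i : Fin n) : partialD i (fun y => - f y) x = - partialD i f x := by
  simp [partialD, fderiv_fun_neg]

lemma partialD_mul (hf : DifferentiableAt ℝ f x) (hg : DifferentiableAt ℝ g x) (i : Fin n) :
    partialD i (fun y => f y * g y) x = partialD i f x * g x + f x * partialD i g x := by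
  simp [partialD, fderiv_fun_mul hf hg]; ring

lemma partialD_sum {ι : Type*} (s : Finset ι) {F : ι → Space n → ℝ}
    (hF : ∀ a ∈ s, DifferentiableAt ℝ (F a) x) (i : Fin n) :
    partialD i (fun y => ∑ a ∈ s, F a y) x = ∑ a ∈ s, partialD i (F a) x := by
  simp [partialD, fderiv_fun_sum hF]

lemma partialD_inv (hf : DifferentiableAt ℝ f x) (h0 : f x ≠ 0) (i : Fin n) :
    partialD i (fun y => (f y)⁻¹) x = - ((f x ^ 2)⁻¹ * partialD i f x) := by
  have h := ((hasDerivAt_inv h0).comp_hasFDerivAt x hf.hasFDerivAt).fderiv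
  unfold partialD
  rw [show (fun y => (f y)⁻¹) = Inv.inv ∘ f from rfl, h]
  simp

lemma partialD_comm (hf : ContDiff ℝ ∞ f) (i j : Fin n) :
    partialD i (partialD j f) x = partialD j (partialD i f) x := by
  have hd : DifferentiableAt ℝ (fderiv ℝ f) x :=
    (hf.fderiv_right (m := ∞) (by simp)).differentiable (by simp) x
  have h : ∀ i j : Fin n, partialD i (partialD j f) x =
      fderiv ℝ (fderiv ℝ f) x (basisVec i) (basisVec j) := by
    intro i j
    unfold partialD
    rw [fderiv_clm_apply hd (differentiableAt_const _)]
    simp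
  rw [h, h]
  exact (hf.contDiffAt.isSymmSndFDerivAt
    (by simpa using ENat.LEInfty.out)) _ _

end PartialD

section Components

variable {w : Space n → FluidVar n} {x : Space n}

lemma partialD_rho (hw : DifferentiableAt ℝ w x) (i : Fin n) :
    partialD i (fun y => (w y).1) x = (fderiv ℝ w x (basisVec i)).1 := by
  unfold partialD; rw [hw.hasFDerivAt.fst.fderiv]; rfl

lemma partialD_entropy (hw : DifferentiableAt ℝ w x) (i : Fin n) :
    partialD i (fun y => (w y).2.1) x = (fderiv ℝ w x (basisVec i)).2.1 := by
  unfold partialD; rw [hw.hasFDerivAt.snd.fst.fderiv]; rfl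

lemma partialD_vel (hw : DifferentiableAt ℝ w x) (i k : Fin n) :
    partialD i (fun y => (w y).2.2 k) x = (fderiv ℝ w x (basisVec i)).2.2 k := by
  have h2 := ((EuclideanSpace.proj k : Space n →L[ℝ] ℝ).hasFDerivAt (x := (w x).2.2)).comp x
    hw.hasFDerivAt.snd.snd
  have h3 : fderiv ℝ (fun y => (w y).2.2 k) x = _ := h2.fderiv
  unfold partialD
  rw [h3]; rfl

end Components

/-! ### Thermodynamic derivatives -/

/-- `∂P/∂ρ`. -/
def presRho (P : ℝ → ℝ → ℝ) (q : ℝ × ℝ) : ℝ := fderiv ℝ (fun q : ℝ × ℝ => P q.1 q.2) q (1, 0)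

/-- `∂P/∂S`. -/
def presS (P : ℝ → ℝ → ℝ) (q : ℝ × ℝ) : ℝ := fderiv ℝ (fun q : ℝ × ℝ => P q.1 q.2) q (0, 1)

/-- The half-plane `ρ > 0` of thermodynamic states. -/
def posState : Set (ℝ × ℝ) := {q | 0 < q.1}

lemma isOpen_posState : IsOpen posState := isOpen_lt continuous_const continuous_fst

/-- `P` is smooth on `ρ > 0`. -/
def SmoothState (P : ℝ → ℝ → ℝ) : Prop :=
  ContDiffOn ℝ ∞ (fun q : ℝ × ℝ => P q.1 q.2) posState

lemma SmoothState.contDiffOn_presRho {P : ℝ → ℝ → ℝ} (hP : SmoothState P) :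
    ContDiffOn ℝ ∞ (presRho P) posState :=
  (hP.fderiv_of_isOpen isOpen_posState (by simp)).clm_apply contDiffOn_const

lemma SmoothState.contDiffOn_presS {P : ℝ → ℝ → ℝ} (hP : SmoothState P) :
    ContDiffOn ℝ ∞ (presS P) posState :=
  (hP.fderiv_of_isOpen isOpen_posState (by simp)).clm_apply contDiffOn_const

lemma SmoothState.differentiableAt {P : ℝ → ℝ → ℝ} (hP : SmoothState P) {q : ℝ × ℝ}
    (hq : 0 < q.1) : DifferentiableAt ℝ (fun q : ℝ × ℝ => P q.1 q.2) q :=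
  (hP.differentiableOn (by simp)).differentiableAt (isOpen_posState.mem_nhds hq)

lemma SmoothState.fderiv_apply {P : ℝ → ℝ → ℝ} (q d : ℝ × ℝ) :
    fderiv ℝ (fun q : ℝ × ℝ => P q.1 q.2) q d = presRho P q * d.1 + presS P q * d.2 := by
  have : d = d.1 • ((1, 0) : ℝ × ℝ) + d.2 • ((0, 1) : ℝ × ℝ) := by ext <;> simp
  conv_lhs => rw [this]
  rw [map_add, map_smul, map_smul]
  simp [presRho, presS, mul_comm]

lemma SmoothState.deriv_entropy {P : ℝ → ℝ → ℝ} (hP : SmoothState P) {q : ℝ × ℝ} (hq : 0 < q.1) :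
    HasDerivAt (fun s => P q.1 s) (presS P q) q.2 := by
  have h1 : HasDerivAt (fun s : ℝ => ((q.1, s) : ℝ × ℝ)) (0, 1) q.2 :=
    (hasDerivAt_const _ _).prodMk (hasDerivAt_id _)
  exact (hP.differentiableAt (q := (q.1, q.2)) hq).hasFDerivAt.comp_hasDerivAt q.2 h1

lemma SmoothState.contDiff_comp {P : ℝ → ℝ → ℝ} (hP : SmoothState P) {w : Space n → FluidVar n}
    (hw : IsFluidState w) : ContDiff ℝ ∞ fun y => P (w y).1 (w y).2.1 := by
  rw [← contDiffOn_univ]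
  exact ContDiffOn.comp (g := fun q : ℝ × ℝ => P q.1 q.2) hP
    (f := fun y => ((w y).1, (w y).2.1))
    (hw.1.fst.prodMk hw.1.snd.fst).contDiffOn fun y _ => hw.2 y

lemma SmoothState.partialD_comp {P : ℝ → ℝ → ℝ} (hP : SmoothState P) {w : Space n → FluidVar n}
    (hw : IsFluidState w) (x : Space n) (i : Fin n) :
    partialD i (fun y => P (w y).1 (w y).2.1) x =
      presRho P ((w x).1, (w x).2.1) * (fderiv ℝ w x (basisVec i)).1 +
        presS P ((w x).1, (w x).2.1) * (fderiv ℝ w x (basisVec i)).2.1 := by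
  have hd := (hw.1.differentiable (by simp) x).hasFDerivAt
  have h1 : HasFDerivAt (fun y => ((w y).1, (w y).2.1)) _ x := hd.fst.prodMk hd.snd.fst
  have h2 := (hP.differentiableAt (q := ((w x).1, (w x).2.1)) (hw.2 x)).hasFDerivAt.comp x h1
  have h3 : fderiv ℝ (fun y => P (w y).1 (w y).2.1) x = _ := h2.fderiv
  unfold partialD
  rw [h3, ContinuousLinearMap.comp_apply, SmoothState.fderiv_apply]
  rfl

/-! ### The Lagrangian of a vorticity density -/

/-- The velocity gradient in a first-order jet. -/
def velGrad (G : Fin n → FluidVar n) : Grad n := fun i j => (G j).2.2 i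

/-- The divergence of the velocity in a first-order jet. -/
def velDiv (G : Fin n → FluidVar n) : ℝ := ∑ i, (G i).2.2 i

/-- The material derivatives of the fluid variables. -/
def materialVar (P : ℝ → ℝ → ℝ) (v : FluidVar n) (G : Fin n → FluidVar n) : FluidVar n :=
  (-(v.1 * velDiv G), 0, WithLp.toLp 2 fun i =>
    -(v.1⁻¹ * (presRho P (v.1, v.2.1) * (G i).1 + presS P (v.1, v.2.1) * (G i).2.1)))

/-- The material derivative of the velocity gradient, up to a symmetric form. -/
def materialGrad (P : ℝ → ℝ → ℝ) (v : FluidVar n) (G : Fin n → FluidVar n) : Grad n :=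
  fun i j => -(∑ p, velGrad G i p * velGrad G p j) +
    (v.1 ^ 2)⁻¹ * presS P (v.1, v.2.1) * ((G i).2.1 * (G j).1)

/-- The region `ρ > 0` of vorticity states. -/
def posVort (n : ℕ) (Y : Type*) : Set (FluidVar n × Y) := {q | 0 < q.1.1}

lemma isOpen_posVort {Y : Type*} [NormedAddCommGroup Y] : IsOpen (posVort n Y) :=
  isOpen_lt continuous_const (by fun_prop)

variable {Y : Type*} [NormedAddCommGroup Y] [NormedSpace ℝ Y]

/-- The rate of change of the density `T` per unit volume moving with the fluid. -/
def lag (P : ℝ → ℝ → ℝ) (Z : Grad n → Y) (T : FluidVar n × Y → ℝ) (j : Jet1 n) : ℝ :=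
  T (j.1, Z (velGrad j.2)) * velDiv j.2 +
    fderiv ℝ T (j.1, Z (velGrad j.2))
      (materialVar P j.1 j.2, fderiv ℝ Z (velGrad j.2) (materialGrad P j.1 j.2))

lemma IsVortFunction.contDiffOn {T : FluidVar n × Y → ℝ} (hT : IsVortFunction T) :
    ContDiffOn ℝ ∞ T (posVort n Y) := hT

lemma IsVortFunction.contDiffOn_fderiv {T : FluidVar n × Y → ℝ} (hT : IsVortFunction T) :
    ContDiffOn ℝ ∞ (fderiv ℝ T) (posVort n Y) :=
  hT.contDiffOn.fderiv_of_isOpen isOpen_posVort (by simp)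

lemma IsVortFunction.hasFDerivAt {T : FluidVar n × Y → ℝ} (hT : IsVortFunction T)
    {q : FluidVar n × Y} (hq : 0 < q.1.1) : HasFDerivAt T (fderiv ℝ T q) q :=
  ((hT.contDiffOn.differentiableOn (by simp)).differentiableAt
    (isOpen_posVort.mem_nhds hq)).hasFDerivAt

lemma contDiff_velGrad : ContDiff ℝ ∞ (velGrad : (Fin n → FluidVar n) → Grad n) := by
  unfold velGrad
  fun_prop

lemma contDiff_velDiv : ContDiff ℝ ∞ (velDiv : (Fin n → FluidVar n) → ℝ) := by
  unfold velDiv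
  fun_prop

lemma contDiffOn_lag {P : ℝ → ℝ → ℝ} (hP : SmoothState P) {Z : Grad n → Y} (hZ : IsCurlForm Z)
    {T : FluidVar n × Y → ℝ} (hT : IsVortFunction T) :
    ContDiffOn ℝ ∞ (lag P Z T) (posJet n) := by
  have hst : ContDiff ℝ ∞ fun j : Jet1 n => (j.1.1, j.1.2.1) := by fun_prop
  have hmaps : Set.MapsTo (fun j : Jet1 n => (j.1.1, j.1.2.1)) (posJet n) posState :=
    fun j hj => hj
  have hρ : ContDiffOn ℝ ∞ (fun j : Jet1 n => presRho P (j.1.1, j.1.2.1)) (posJet n) :=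
    hP.contDiffOn_presRho.comp hst.contDiffOn hmaps
  have hS : ContDiffOn ℝ ∞ (fun j : Jet1 n => presS P (j.1.1, j.1.2.1)) (posJet n) :=
    hP.contDiffOn_presS.comp hst.contDiffOn hmaps
  have hA : ContDiff ℝ ∞ fun j : Jet1 n => velGrad j.2 := contDiff_velGrad.comp contDiff_snd
  have hdiv : ContDiff ℝ ∞ fun j : Jet1 n => velDiv j.2 := contDiff_velDiv.comp contDiff_snd
  have hpt : ContDiff ℝ ∞ fun j : Jet1 n => (j.1, Z (velGrad j.2)) :=
    contDiff_fst.prodMk (hZ.contDiff.comp hA)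
  have hpm : Set.MapsTo (fun j : Jet1 n => (j.1, Z (velGrad j.2))) (posJet n) (posVort n Y) :=
    fun j hj => hj
  have hρ0 : ∀ j ∈ posJet n, (j : Jet1 n).1.1 ≠ 0 := fun j hj => ne_of_gt hj
  have hρ1 : ContDiffOn ℝ ∞ (fun j : Jet1 n => j.1.1) (posJet n) := by fun_prop
  have hmv : ContDiffOn ℝ ∞ (fun j : Jet1 n => materialVar P j.1 j.2) (posJet n) := by
    refine ContDiffOn.prodMk (hρ1.mul hdiv.contDiffOn).neg
      (contDiffOn_const.prodMk ?_)
    rw [contDiffOn_euclidean]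
    intro i
    refine ((hρ1.inv hρ0).mul ((hρ.mul ?_).add (hS.mul ?_))).neg <;> fun_prop
  have hmg : ContDiffOn ℝ ∞ (fun j : Jet1 n => materialGrad P j.1 j.2) (posJet n) := by
    refine contDiffOn_pi.2 fun i => contDiffOn_pi.2 fun k => ?_
    have hA' : ∀ i k, ContDiffOn ℝ ∞ (fun j : Jet1 n => velGrad j.2 i k) (posJet n) := fun i k =>
      (contDiff_pi.1 (contDiff_pi.1 hA i) k).contDiffOn
    refine ContDiffOn.add (ContDiffOn.neg (ContDiffOn.sum fun p _ => (hA' i p).mul (hA' p k)))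
      ((((hρ1.pow 2).inv fun j hj => pow_ne_zero 2 (hρ0 j hj)).mul hS).mul ?_)
    fun_prop
  have hZ' : ContDiffOn ℝ ∞ (fun j : Jet1 n =>
      fderiv ℝ Z (velGrad j.2) (materialGrad P j.1 j.2)) (posJet n) :=
    (((hZ.contDiff.fderiv_right (m := ∞) (by simp)).comp hA).contDiffOn).clm_apply hmg
  exact ((hT.contDiffOn.comp hpt.contDiffOn hpm).mul hdiv.contDiffOn).add
    ((hT.contDiffOn_fderiv.comp hpt.contDiffOn hpm).clm_apply (hmv.prodMk hZ'))

end FluidFlow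

end

noncomputable section

namespace FluidFlow

variable {n : ℕ}

/-! ### Time derivatives of vorticity densities -/

/-- `fluidVar` as a continuous linear map. -/
def fluidVarL (n k : ℕ) : JetPoint n k →L[ℝ] FluidVar n :=
  (ContinuousMultilinearMap.apply ℝ (fun _ : Fin ((0 : Fin (k + 1)) : ℕ) => Space n)
    (FluidVar n) (fun _ => 0)).comp
    ((ContinuousLinearMap.proj (R := ℝ)
      (φ := fun j : Fin (k + 1) => (Space n) [×(j : ℕ)]→L[ℝ] (FluidVar n)) 0).comp
      ((ContinuousLinearMap.snd ℝ _ _).comp (ContinuousLinearMap.snd ℝ _ _)))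

lemma fluidVarL_apply {k : ℕ} (q : JetPoint n k) : fluidVarL n k q = fluidVar q := rfl

/-- `fluidVarD` as a continuous linear map. -/
def fluidVarDL (n : ℕ) (i : Fin n) : JetPoint n 1 →L[ℝ] FluidVar n :=
  (ContinuousMultilinearMap.apply ℝ (fun _ : Fin ((1 : Fin 2) : ℕ) => Space n)
    (FluidVar n) (fun _ => basisVec i)).comp
    ((ContinuousLinearMap.proj (R := ℝ)
      (φ := fun j : Fin 2 => (Space n) [×(j : ℕ)]→L[ℝ] (FluidVar n)) 1).comp
      ((ContinuousLinearMap.snd ℝ _ _).comp (ContinuousLinearMap.snd ℝ _ _)))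

/-- The velocity gradient as a continuous linear map. -/
def velGradL (n : ℕ) : JetPoint n 1 →L[ℝ] Grad n :=
  ContinuousLinearMap.pi fun i => ContinuousLinearMap.pi fun j =>
    (EuclideanSpace.proj i : Space n →L[ℝ] ℝ).comp
      ((ContinuousLinearMap.snd ℝ _ _).comp ((ContinuousLinearMap.snd ℝ _ _).comp (fluidVarDL n j)))

lemma velGradL_apply (q : JetPoint n 1) : velGradL n q = velGrad (fluidVarD q) := rfl

/-- The density `T(ρ, S, u, Z(∇u))`. -/
def vortDensity {Y : Type*} (Z : Grad n → Y) (T : FluidVar n × Y → ℝ) (q : JetPoint n 1) : ℝ :=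
  T (fluidVar q, Z (velGrad (fluidVarD q)))

lemma vortDensity_jet {Y : Type*} (Z : Grad n → Y) (T : FluidVar n × Y → ℝ) (w : Space n → FluidVar n)
    (t : ℝ) (x : Space n) :
    vortDensity Z T (t, x, jet 1 w x) = T (w x, Z (velGrad (firstJet w x).2)) := by
  have : fluidVarD ((t, x, jet 1 w x) : JetPoint n 1) = (firstJet w x).2 :=
    funext fun i => fluidVarD_jet w t x i
  simp only [vortDensity, fluidVar_jet, this]

variable {Y : Type*} [NormedAddCommGroup Y] [NormedSpace ℝ Y]

lemma hasFDerivAt_vortDensity {Z : Grad n → Y} (hZ : IsCurlForm Z) {T : FluidVar n × Y → ℝ}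
    (hT : IsVortFunction T) {q : JetPoint n 1} (hq : 0 < (fluidVar q).1) :
    HasFDerivAt (vortDensity Z T) ((fderiv ℝ T (fluidVar q, Z (velGrad (fluidVarD q)))).comp
      ((fluidVarL n 1).prod ((fderiv ℝ Z (velGrad (fluidVarD q))).comp (velGradL n)))) q := by
  have h1 : HasFDerivAt (fun q : JetPoint n 1 => Z (velGrad (fluidVarD q)))
      ((fderiv ℝ Z (velGrad (fluidVarD q))).comp (velGradL n)) q :=
    (hZ.differentiable (velGrad (fluidVarD q))).hasFDerivAt.comp q (velGradL n).hasFDerivAt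
  exact (hT.hasFDerivAt (q := (fluidVar q, Z (velGrad (fluidVarD q)))) hq).comp q
    ((fluidVarL n 1).hasFDerivAt.prodMk h1)

lemma isLocalFunction_vortDensity {Z : Grad n → Y} (hZ : IsCurlForm Z) {T : FluidVar n × Y → ℝ}
    (hT : IsVortFunction T) : IsLocalFunction (vortDensity Z T) := by
  refine ContDiffOn.comp (g := T) hT.contDiffOn
    (f := fun q : JetPoint n 1 => (fluidVar q, Z (velGrad (fluidVarD q)))) ?_ fun q hq => hq
  exact (ContDiff.prodMk contDiff_fluidVar
    (hZ.contDiff.comp (velGradL n).contDiff)).contDiffOn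

lemma contDiff_eulerRHS {P : ℝ → ℝ → ℝ} (hP : SmoothState P) {w : Space n → FluidVar n}
    (hw : IsFluidState w) : ContDiff ℝ ∞ (eulerRHS P w) := by
  have hρ : ContDiff ℝ ∞ fun y => (w y).1 := hw.1.fst
  have hS : ContDiff ℝ ∞ fun y => (w y).2.1 := hw.1.snd.fst
  have hu : ∀ i, ContDiff ℝ ∞ fun y => (w y).2.2 i := fun i =>
    contDiff_euclidean.1 hw.1.snd.snd i
  unfold eulerRHS
  refine ContDiff.prodMk (ContDiff.neg (ContDiff.sum fun i _ =>
    contDiff_partialD (hρ.mul (hu i)) i)) (ContDiff.prodMk (ContDiff.neg (ContDiff.sum fun i _ =>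
      (hu i).mul (contDiff_partialD hS i))) ?_)
  rw [contDiff_euclidean]
  intro i
  exact (ContDiff.neg (ContDiff.sum fun j _ => (hu j).mul (contDiff_partialD (hu i) j))).sub
    ((hρ.inv fun y => (hw.2 y).ne').mul (contDiff_partialD (hP.contDiff_comp hw) i))

lemma eulerRHS_add_transport {P : ℝ → ℝ → ℝ} (hP : SmoothState P) {w : Space n → FluidVar n}
    (hw : IsFluidState w) (x : Space n) :
    eulerRHS P w x + ∑ i, (w x).2.2 i • fderiv ℝ w x (basisVec i) =
      materialVar P (w x) (firstJet w x).2 := by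
  have hd : DifferentiableAt ℝ w x := hw.1.differentiable (by simp) x
  have hρ : DifferentiableAt ℝ (fun y => (w y).1) x := hd.fst
  have hu : ∀ i, DifferentiableAt ℝ (fun y => (w y).2.2 i) x := fun i =>
    (contDiff_euclidean.1 hw.1.snd.snd i).differentiable (by simp) x
  refine Prod.ext ?_ (Prod.ext ?_ ?_)
  · simp only [eulerRHS, materialVar, Prod.fst_add, Prod.fst_sum, Prod.smul_fst, smul_eq_mul,
      velDiv, firstJet]
    rw [Finset.mul_sum, ← Finset.sum_neg_distrib, ← Finset.sum_neg_distrib,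
      ← Finset.sum_add_distrib]
    refine Finset.sum_congr rfl fun i _ => ?_
    rw [partialD_mul hρ (hu i), partialD_rho hd, partialD_vel hd]
    ring
  · simp only [eulerRHS, materialVar, Prod.snd_add, Prod.fst_add, Prod.snd_sum, Prod.fst_sum,
      Prod.smul_snd, Prod.smul_fst, smul_eq_mul, partialD_entropy hd, neg_add_cancel]
  · ext i
    simp only [eulerRHS, materialVar, Prod.snd_add, Prod.snd_sum, firstJet,
      Prod.smul_snd, PiLp.add_apply, hP.partialD_comp hw, partialD_vel hd, WithLp.ofLp_sum,
      Finset.sum_apply, PiLp.smul_apply, smul_eq_mul]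
    ring

/-- The gradient of the momentum equation contains second derivatives only through transport by `u`,
which is split off, and through the Hessian of the pressure, which is symmetric and so invisible to
a function of the curl. Of `∇p ⊗ ∇ρ` likewise only the entropy part survives. -/
lemma fderiv_curl_rate {P : ℝ → ℝ → ℝ} (hP : SmoothState P) {Z : Grad n → Y} (hZ : IsCurlForm Z)
    {w : Space n → FluidVar n} (hw : IsFluidState w) (x : Space n) (A : Grad n) :
    fderiv ℝ Z A (velGrad (firstJet (eulerRHS P w) x).2) =
      fderiv ℝ Z A (materialGrad P (w x) (firstJet w x).2) -
        fderiv ℝ Z A (∑ k, (w x).2.2 k •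
          fderiv ℝ (fun y => velGrad (firstJet w y).2) x (basisVec k)) := by
  have hd : DifferentiableAt ℝ w x := hw.1.differentiable (by simp) x
  have hds : Differentiable ℝ w := hw.1.differentiable (by simp)
  have hρs : ContDiff ℝ ∞ fun y => (w y).1 := hw.1.fst
  have hρ : DifferentiableAt ℝ (fun y => (w y).1) x := hd.fst
  have hus : ∀ i, ContDiff ℝ ∞ fun y => (w y).2.2 i := fun i =>
    contDiff_euclidean.1 hw.1.snd.snd i
  have hp := hP.contDiff_comp hw
  have hdiff : ∀ {f : Space n → ℝ}, ContDiff ℝ ∞ f → DifferentiableAt ℝ f x := fun hf =>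
    hf.differentiable (by simp) x
  have hgs : ContDiff ℝ ∞ fun y => velGrad (firstJet w y).2 :=
    contDiff_velGrad.comp (contDiff_firstJet hw.1).snd
  have hA : ∀ k i j, fderiv ℝ (fun y => velGrad (firstJet w y).2) x (basisVec k) i j =
      partialD j (partialD k fun y => (w y).2.2 i) x := by
    intro k i j
    have h1 := (hgs.differentiable (by simp) x).hasFDerivAt
    have h2 := (hasFDerivAt_pi'.1 ((hasFDerivAt_pi'.1 h1) i)) j
    have h3 : partialD k (fun y => velGrad (firstJet w y).2 i j) x =
        fderiv ℝ (fun y => velGrad (firstJet w y).2) x (basisVec k) i j := by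
      unfold partialD
      rw [h2.fderiv]; rfl
    rw [← h3, partialD_comm (hus i)]
    congr 1
    funext y
    simp only [velGrad, firstJet, partialD_vel (hds y)]
  -- The last summand collects the symmetric terms: `∇ρ ⊗ ∇ρ` with factor `ρ⁻² P_ρ`, and the Hessian
  -- of `p`.
  have key : velGrad (firstJet (eulerRHS P w) x).2 =
      (materialGrad P (w x) (firstJet w x).2 - ∑ k, (w x).2.2 k •
          fderiv ℝ (fun y => velGrad (firstJet w y).2) x (basisVec k)) +
      fun i j => (((w x).1 ^ 2)⁻¹ * presRho P ((w x).1, (w x).2.1) *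
        ((firstJet w x).2 i).1 * ((firstJet w x).2 j).1 -
        ((w x).1)⁻¹ * partialD j (partialD i fun y => P (w y).1 (w y).2.1) x) := by
    funext i j
    have h1 : velGrad (firstJet (eulerRHS P w) x).2 i j =
        partialD j (fun y => (eulerRHS P w y).2.2 i) x :=
      (partialD_vel ((contDiff_eulerRHS hP hw).differentiable (by simp) x) j i).symm
    rw [h1]
    simp only [eulerRHS]
    have h2 : ∀ k, DifferentiableAt ℝ
        (fun y => (w y).2.2 k * partialD k (fun y => (w y).2.2 i) y) x := fun k =>
      hdiff ((hus k).mul (contDiff_partialD (hus i) k))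
    rw [partialD_sub, partialD_neg, partialD_sum _ fun k _ => h2 k, partialD_mul,
      partialD_inv hρ (hw.2 x).ne', hP.partialD_comp hw, partialD_rho hd]
    · simp only [Pi.add_apply, Pi.sub_apply, materialGrad, Finset.sum_apply, Pi.smul_apply, hA,
        smul_eq_mul]
      have h3 : ∑ k, partialD j (fun y => (w y).2.2 k * partialD k (fun y => (w y).2.2 i) y) x =
          ∑ p, velGrad (firstJet w x).2 i p * velGrad (firstJet w x).2 p j +
          ∑ k, (w x).2.2 k * partialD j (partialD k fun y => (w y).2.2 i) x := by
        rw [← Finset.sum_add_distrib]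
        refine Finset.sum_congr rfl fun k _ => ?_
        rw [partialD_mul (hdiff (hus k)) (hdiff (contDiff_partialD (hus i) k)),
          partialD_vel hd, partialD_vel hd]
        simp only [velGrad, firstJet]
        ring
      rw [h3]
      simp only [firstJet]
      ring
    · exact hdiff (hρs.inv fun y => (hw.2 y).ne')
    · exact hdiff (contDiff_partialD hp i)
    · exact hdiff (ContDiff.neg (ContDiff.sum fun k _ => (hus k).mul (contDiff_partialD (hus i) k)))
    · exact hdiff ((hρs.inv fun y => (hw.2 y).ne').mul (contDiff_partialD hp i))
  rw [key, map_add, map_sub, add_eq_left]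
  refine hZ.fderiv_symm A _ fun i j => ?_
  rw [partialD_comm hp]
  ring

/-- The rate of change of a vorticity density is, up to the divergence of `T u`, its Lagrangian. -/
lemma onShellDt_vortDensity {P : ℝ → ℝ → ℝ} (hP : SmoothState P) {Z : Grad n → Y}
    (hZ : IsCurlForm Z) {T : FluidVar n × Y → ℝ} (hT : IsVortFunction T)
    {w : Space n → FluidVar n} (hw : IsFluidState w) (t : ℝ) (x : Space n) :
    onShellDt P (vortDensity Z T) w t x +
      ∑ i, partialD i (fun y => vortDensity Z T (t, y, jet 1 w y) * (w y).2.2 i) x =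
      lag P Z T (firstJet w x) := by
  have hd : DifferentiableAt ℝ w x := hw.1.differentiable (by simp) x
  have hus : ∀ i, ContDiff ℝ ∞ fun y => (w y).2.2 i := fun i =>
    contDiff_euclidean.1 hw.1.snd.snd i
  set A := velGrad (firstJet w x).2 with hA
  have hgs : ContDiff ℝ ∞ fun y => velGrad (firstJet w y).2 :=
    contDiff_velGrad.comp (contDiff_firstJet hw.1).snd
  have hpt : fluidVar ((t, x, jet 1 w x) : JetPoint n 1) = w x := fluidVar_jet w t x
  have hptD : ∀ w : Space n → FluidVar n,
      fluidVarD ((t, x, jet 1 w x) : JetPoint n 1) = (firstJet w x).2 :=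
    fun w => funext fun i => fluidVarD_jet w t x i
  have h1 : onShellDt P (vortDensity Z T) w t x = fderiv ℝ T (w x, Z A)
      (eulerRHS P w x, fderiv ℝ Z A (velGrad (firstJet (eulerRHS P w) x).2)) := by
    unfold onShellDt
    rw [(hasFDerivAt_vortDensity hZ hT (q := (t, x, jet 1 w x)) (by rw [hpt]; exact hw.2 x)).fderiv]
    rw [hpt, hptD w]
    have e1 : fluidVarL n 1 (1, 0, jet 1 (eulerRHS P w) x) = eulerRHS P w x := by
      rw [fluidVarL_apply]
      exact iteratedFDeriv_zero_apply _
    have e2 : velGradL n (1, 0, jet 1 (eulerRHS P w) x) =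
        velGrad (firstJet (eulerRHS P w) x).2 := by
      rw [velGradL_apply]
      congr 1
      funext i
      exact iteratedFDeriv_one_apply _
    simp only [ContinuousLinearMap.comp_apply, ContinuousLinearMap.prod_apply, e1, e2, hA]
  have hτ : HasFDerivAt (fun y => vortDensity Z T (t, y, jet 1 w y))
      ((fderiv ℝ T (w x, Z A)).comp ((fderiv ℝ w x).prod ((fderiv ℝ Z A).comp
        (fderiv ℝ (fun y => velGrad (firstJet w y).2) x)))) x := by
    simp only [vortDensity_jet]
    exact (hT.hasFDerivAt (q := (w x, Z A)) (hw.2 x)).comp x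
      (hd.hasFDerivAt.prodMk ((hZ.differentiable A).hasFDerivAt.comp x
        (hgs.differentiable (by simp) x).hasFDerivAt))
  have h2 : ∑ i, partialD i (fun y => vortDensity Z T (t, y, jet 1 w y) * (w y).2.2 i) x =
      fderiv ℝ T (w x, Z A) (∑ i, (w x).2.2 i • fderiv ℝ w x (basisVec i),
        fderiv ℝ Z A (∑ k, (w x).2.2 k •
          fderiv ℝ (fun y => velGrad (firstJet w y).2) x (basisVec k))) +
        T (w x, Z A) * velDiv (firstJet w x).2 := by
    have e : ((∑ i, (w x).2.2 i • fderiv ℝ w x (basisVec i),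
        fderiv ℝ Z A (∑ k, (w x).2.2 k •
          fderiv ℝ (fun y => velGrad (firstJet w y).2) x (basisVec k))) : FluidVar n × Y) =
        ∑ i, (w x).2.2 i • ((fderiv ℝ w x (basisVec i), fderiv ℝ Z A
          (fderiv ℝ (fun y => velGrad (firstJet w y).2) x (basisVec i))) : FluidVar n × Y) := by
      refine Prod.ext ?_ ?_
      · simp [Prod.fst_sum]
      · simp [Prod.snd_sum, map_sum]
    rw [e, map_sum, velDiv, Finset.mul_sum, ← Finset.sum_add_distrib]
    refine Finset.sum_congr rfl fun i _ => ?_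
    rw [partialD_mul hτ.differentiableAt ((hus i).differentiable (by simp) x), partialD_vel hd,
      vortDensity_jet, map_smul]
    have : partialD i (fun y => vortDensity Z T (t, y, jet 1 w y)) x = fderiv ℝ T (w x, Z A)
        (fderiv ℝ w x (basisVec i), fderiv ℝ Z A
          (fderiv ℝ (fun y => velGrad (firstJet w y).2) x (basisVec i))) := by
      unfold partialD
      rw [hτ.fderiv]; rfl
    rw [this, smul_eq_mul, mul_comm]
    rfl
  rw [h1, h2, fderiv_curl_rate hP hZ hw, ← add_assoc, ← map_add, lag, add_comm]
  congr 2
  rw [Prod.mk_add_mk, eulerRHS_add_transport hP hw, sub_add_cancel]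
  rfl

end FluidFlow

end

noncomputable section

namespace FluidFlow

variable {n : ℕ} {Y : Type*} [NormedAddCommGroup Y] [NormedSpace ℝ Y]

/-! ### Truncation of jets -/

/-- The `k`-jet underlying a `K`-jet, `k ≤ K`. -/
def truncJet {k K : ℕ} (h : k ≤ K) : JetPoint n K →L[ℝ] JetPoint n k :=
  (ContinuousLinearMap.fst ℝ _ _).prod
    (((ContinuousLinearMap.fst ℝ _ _).comp (ContinuousLinearMap.snd ℝ _ _)).prod
      ((ContinuousLinearMap.pi fun j : Fin (k + 1) => ContinuousLinearMap.proj (R := ℝ)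
        (φ := fun j : Fin (K + 1) => (Space n) [×(j : ℕ)]→L[ℝ] (FluidVar n))
        (Fin.castLE (Nat.succ_le_succ h) j)).comp
        ((ContinuousLinearMap.snd ℝ _ _).comp (ContinuousLinearMap.snd ℝ _ _))))

lemma truncJet_jet {k K : ℕ} (h : k ≤ K) (t : ℝ) (x : Space n) (w : Space n → FluidVar n) :
    truncJet h (t, x, jet K w x) = (t, x, jet k w x) := rfl

lemma fluidVar_truncJet {k K : ℕ} (h : k ≤ K) (q : JetPoint n K) :
    fluidVar (truncJet h q) = fluidVar q := rfl

lemma IsLocalFunction.truncJet {k K : ℕ} (h : k ≤ K) {F : JetPoint n k → Y}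
    (hF : IsLocalFunction F) : IsLocalFunction fun q => F (truncJet h q) :=
  ContDiffOn.comp (g := F) hF (f := FluidFlow.truncJet h)
    (FluidFlow.truncJet h).contDiff.contDiffOn fun q hq => by
      simpa only [Set.mem_ofPred_eq, fluidVar_truncJet] using hq

/-- The potential is `T u - X`. From here on conservation is used only through this condition on a
function of first-order jets. -/
lemma isDivergence_lag {P : ℝ → ℝ → ℝ} (hP : SmoothState P) {Z : Grad n → Y}
    (hZ : IsCurlForm Z) {T : FluidVar n × Y → ℝ} (hT : IsVortFunction T)
    (hc : IsConservedDensity P (vortDensity Z T)) : IsDivergence (lag P Z T) := by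
  obtain ⟨k, X, hX, h⟩ := hc
  have h1 : 1 ≤ max 1 k := le_max_left _ _
  have h2 : k ≤ max 1 k := le_max_right _ _
  have hTl := isLocalFunction_vortDensity hZ hT
  refine ⟨max 1 k, fun q => vortDensity Z T (truncJet h1 q) • (fluidVar q).2.2 - X (truncJet h2 q),
    ?_, fun w hw x => ?_⟩
  · exact ContDiffOn.sub (ContDiffOn.smul (hTl.truncJet h1) contDiff_fluidVar.snd.snd.contDiffOn)
      (hX.truncJet h2)
  · rw [← onShellDt_vortDensity hP hZ hT hw 0 x, eq_neg_of_add_eq_zero_left (h w hw 0 x)]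
    simp only [totalDiv, truncJet_jet, fluidVar_jet, PiLp.sub_apply, PiLp.smul_apply, smul_eq_mul]
    rw [neg_add_eq_sub, ← Finset.sum_sub_distrib]
    refine Finset.sum_congr rfl fun i _ => ?_
    have hu : ContDiff ℝ ∞ fun y => (w y).2.2 i := contDiff_euclidean.1 hw.1.snd.snd i
    rw [partialD_sub]
    · exact ((hTl.contDiff_comp_jet hw 0).mul hu).differentiable (by simp) x
    · exact (contDiff_euclidean.1 (hX.contDiff_comp_jet hw 0) i).differentiable (by simp) x

/-! ### Jets with given gradients -/

/-- First derivatives with `∇ρ = r`, `∇S = s`, `∇u = A`. -/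
def gradJet (r s : Fin n → ℝ) (A : Grad n) : Fin n → FluidVar n :=
  fun j => (r j, s j, WithLp.toLp 2 fun i => A i j)

@[simp] lemma velGrad_gradJet (r s : Fin n → ℝ) (A : Grad n) : velGrad (gradJet r s A) = A := rfl

@[simp] lemma velDiv_gradJet (r s : Fin n → ℝ) (A : Grad n) :
    velDiv (gradJet r s A) = ∑ i, A i i := rfl

lemma gradJet_add (r s : Fin n → ℝ) (A : Grad n) (σ : ℝ) (a b : Fin n → ℝ) :
    (fun i => gradJet r s A i + b i • ((0, σ, WithLp.toLp 2 a) : FluidVar n)) =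
      gradJet r (s + σ • b) (A + outer a b) := by
  funext i
  refine Prod.ext ?_ (Prod.ext ?_ ?_)
  · simp [gradJet]
  · simp [gradJet, mul_comm]
  · ext k; simp [gradJet, outer, mul_comm]

lemma gradJet_sub (r s : Fin n → ℝ) (A : Grad n) (σ : ℝ) (a b : Fin n → ℝ) :
    (fun i => gradJet r s A i - b i • ((0, σ, WithLp.toLp 2 a) : FluidVar n)) =
      gradJet r (s - σ • b) (A - outer a b) := by
  funext i
  refine Prod.ext ?_ (Prod.ext ?_ ?_)
  · simp [gradJet]
  · simp [gradJet, mul_comm]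
  · ext k; simp [gradJet, outer, mul_comm]

/-- The coefficient of `∇S` in the Lagrangian, divided by `∂P/∂S`. -/
def lagS (Z : Grad n → Y) (T : FluidVar n × Y → ℝ) (v : FluidVar n) (r s : Fin n → ℝ)
    (A : Grad n) : ℝ :=
  fderiv ℝ T (v, Z A) ((0, 0, -v.1⁻¹ • WithLp.toLp 2 s), (v.1 ^ 2)⁻¹ • fderiv ℝ Z A (outer s r))

/-- Entropy is transported, so its gradient acts only through the pressure force and the baroclinic
term. Both are linear in `∇S` and carry the factor `∂P/∂S`. -/
lemma lag_gradJet (P : ℝ → ℝ → ℝ) (Z : Grad n → Y) (T : FluidVar n × Y → ℝ) (v : FluidVar n)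
    (r s : Fin n → ℝ) (A : Grad n) :
    lag P Z T (v, gradJet r s A) =
      lag P Z T (v, gradJet r 0 A) + presS P (v.1, v.2.1) * lagS Z T v r s A := by
  have h1 : materialVar P v (gradJet r s A) = materialVar P v (gradJet r 0 A) +
      presS P (v.1, v.2.1) • ((0, 0, -v.1⁻¹ • WithLp.toLp 2 s) : FluidVar n) := by
    refine Prod.ext ?_ (Prod.ext ?_ ?_)
    · simp [materialVar]
    · simp [materialVar]
    · ext i; simp [materialVar, gradJet]; ring
  have h2 : materialGrad P v (gradJet r s A) = materialGrad P v (gradJet r 0 A) +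
      presS P (v.1, v.2.1) • ((v.1 ^ 2)⁻¹ • outer s r) := by
    ext i j; simp [materialGrad, gradJet]; ring
  simp only [lag, lagS, velGrad_gradJet, velDiv_gradJet, h1, h2, map_add, map_smul]
  rw [add_assoc, ← smul_eq_mul (presS P (v.1, v.2.1)),
    ← map_smul (fderiv ℝ T (v, Z A)), ← map_add (fderiv ℝ T (v, Z A))]
  rfl

lemma lagS_neg (Z : Grad n → Y) (T : FluidVar n × Y → ℝ) (v : FluidVar n) (r s : Fin n → ℝ)
    (A : Grad n) : lagS Z T v r (-s) A = - lagS Z T v r s A := by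
  unfold lagS
  rw [← map_neg]
  congr 1
  have : outer (-s) r = - outer s r := by ext i j; simp [outer]
  rw [this, map_neg]
  refine Prod.ext (Prod.ext ?_ (Prod.ext ?_ ?_)) ?_ <;> simp

/-! ### Consequences of conservation -/

lemma IsNonIsentropic.smoothState {P : ℝ → ℝ → ℝ} (hP : IsNonIsentropic P) : SmoothState P := hP.1

/-- A continuous function that vanishes where `∂P/∂S ≠ 0` vanishes identically. -/
lemma IsNonIsentropic.eq_zero {P : ℝ → ℝ → ℝ} (hP : IsNonIsentropic P) {F : FluidVar n → ℝ}
    (hF : ContinuousOn F {v | 0 < v.1})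
    (h0 : ∀ v : FluidVar n, 0 < v.1 → presS P (v.1, v.2.1) ≠ 0 → F v = 0)
    (v : FluidVar n) (hv : 0 < v.1) : F v = 0 := by
  by_contra hne
  have hc : ContinuousOn (fun q : ℝ × ℝ => F (q.1, q.2, v.2.2)) posState :=
    hF.comp (by fun_prop) fun q hq => hq
  have hopen : IsOpen (posState ∩ (fun q : ℝ × ℝ => F (q.1, q.2, v.2.2)) ⁻¹' {0}ᶜ) :=
    hc.isOpen_inter_preimage isOpen_posState isOpen_compl_singleton
  obtain ⟨q, hq, hd⟩ := hP.2 _ hopen ⟨(v.1, v.2.1), hv, hne⟩ fun q hq => hq.1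
  rw [(hP.smoothState.deriv_entropy hq.1).deriv] at hd
  exact hq.2 (h0 (q.1, q.2, v.2.2) hq.1 hd)

section Conserved

variable {P : ℝ → ℝ → ℝ} {Z : Grad n → Y} {T : FluidVar n × Y → ℝ}

/-- Subtract two instances of rank-one affinity at the same base jet, one with and one without an
entropy component in the perturbation. Only the terms with the factor `∂P/∂S` remain, and it is
nonzero here. -/
lemma lagS_eq (hP : SmoothState P) (hZ : IsCurlForm Z) (hT : IsVortFunction T)
    (hL : IsDivergence (lag P Z T)) {v : FluidVar n} (hv : 0 < v.1)
    (hS : presS P (v.1, v.2.1) ≠ 0) (r a b : Fin n → ℝ) (A : Grad n) :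
    lagS Z T v r b (A + outer a b) = lagS Z T v r b (A - outer a b) := by
  have hs := contDiffOn_lag hP hZ hT
  have h1 := hL.rankOne hs v hv (gradJet r 0 A) b (a := (0, 1, WithLp.toLp 2 a)) rfl
  have h0 := hL.rankOne hs v hv (gradJet r 0 A) b (a := (0, 0, WithLp.toLp 2 a)) rfl
  rw [gradJet_add, gradJet_sub] at h1 h0
  simp only [one_smul, zero_smul, zero_add, add_zero, zero_sub, sub_zero] at h1 h0
  rw [lag_gradJet P Z T v r b, lag_gradJet P Z T v r (-b), lagS_neg] at h1
  have : presS P (v.1, v.2.1) *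
      (lagS Z T v r b (A + outer a b) - lagS Z T v r b (A - outer a b)) = 0 := by
    linarith
  exact sub_eq_zero.1 ((mul_eq_zero.1 this).resolve_left hS)

/-- The preceding symmetry recentred by half a step. -/
lemma lagS_eq_base (hP : SmoothState P) (hZ : IsCurlForm Z) (hT : IsVortFunction T)
    (hL : IsDivergence (lag P Z T)) {v : FluidVar n} (hv : 0 < v.1)
    (hS : presS P (v.1, v.2.1) ≠ 0) (r a b : Fin n → ℝ) (A : Grad n) :
    lagS Z T v r b (A + outer a b) = lagS Z T v r b A := by
  have h := lagS_eq hP hZ hT hL hv hS r ((1 / 2 : ℝ) • a) b (A + outer ((1 / 2 : ℝ) • a) b)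
  have e1 : A + outer ((1 / 2 : ℝ) • a) b + outer ((1 / 2 : ℝ) • a) b = A + outer a b := by
    ext i j; simp [outer]; ring
  have e2 : A + outer ((1 / 2 : ℝ) • a) b - outer ((1 / 2 : ℝ) • a) b = A := by abel
  rwa [e1, e2] at h

/-- The dependence on velocity does not change along decomposable directions. -/
lemma fderiv_vel_eq (hP : IsNonIsentropic P) (hZ : IsCurlForm Z) (hT : IsVortFunction T)
    (hL : IsDivergence (lag P Z T)) {v : FluidVar n} (hv : 0 < v.1) (a b : Fin n → ℝ)
    (A : Grad n) :
    fderiv ℝ T (v, Z A + fderiv ℝ Z A (outer a b)) ((0, 0, WithLp.toLp 2 b), 0) =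
      fderiv ℝ T (v, Z A) ((0, 0, WithLp.toLp 2 b), 0) := by
  rw [← sub_eq_zero]
  refine hP.eq_zero (F := fun v => fderiv ℝ T (v, Z A + fderiv ℝ Z A (outer a b))
    ((0, 0, WithLp.toLp 2 b), 0) - fderiv ℝ T (v, Z A) ((0, 0, WithLp.toLp 2 b), 0))
    ?_ (fun v hv hS => ?_) v hv
  · have hc := hT.contDiffOn_fderiv.continuousOn
    have h : ∀ y : Y, ContinuousOn (fun v : FluidVar n => fderiv ℝ T (v, y)) {v | 0 < v.1} :=
      fun y => hc.comp (f := fun v : FluidVar n => (v, y)) (by fun_prop) fun v hv => hv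
    exact ((h _).clm_apply continuousOn_const).sub ((h _).clm_apply continuousOn_const)
  -- With `∇ρ = 0` there is no baroclinic term, and `lagS` reduces to a multiple of the velocity
  -- derivative along `b`.
  · have h := lagS_eq_base hP.smoothState hZ hT hL hv hS 0 a b A
    have e : outer b (0 : Fin n → ℝ) = 0 := by ext i j; simp [outer]
    simp only [lagS, hZ.add_outer, e, map_zero, smul_zero] at h
    have e2 : (((0, 0, -v.1⁻¹ • WithLp.toLp 2 b), 0) : FluidVar n × Y) =
        (-v.1⁻¹) • ((0, 0, WithLp.toLp 2 b), 0) := by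
      refine Prod.ext (Prod.ext ?_ (Prod.ext ?_ ?_)) ?_ <;> simp
    rw [e2, map_smul, map_smul, smul_eq_mul, smul_eq_mul] at h
    rw [sub_eq_zero]
    exact mul_left_cancel₀ (neg_ne_zero.2 (inv_ne_zero hv.ne')) h

/-- Conserved densities are affine along decomposable directions. -/
lemma affine_vort (hP : IsNonIsentropic P) (hZ : IsCurlForm Z) (hT : IsVortFunction T)
    (hL : IsDivergence (lag P Z T)) {v : FluidVar n} (hv : 0 < v.1) (a b : Fin n → ℝ)
    (A : Grad n) :
    T (v, Z A + fderiv ℝ Z A (outer a b)) =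
      T (v, Z A) + fderiv ℝ T (v, Z A) (0, fderiv ℝ Z A (outer a b)) := by
  rw [← sub_eq_zero]
  refine hP.eq_zero (F := fun v => T (v, Z A + fderiv ℝ Z A (outer a b)) -
    (T (v, Z A) + fderiv ℝ T (v, Z A) (0, fderiv ℝ Z A (outer a b))))
    ?_ (fun v hv hS => ?_) v hv
  · have hc := hT.contDiffOn_fderiv.continuousOn
    have h : ∀ y : Y, ContinuousOn (fun v : FluidVar n => fderiv ℝ T (v, y)) {v | 0 < v.1} :=
      fun y => hc.comp (f := fun v : FluidVar n => (v, y)) (by fun_prop) fun v hv => hv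
    have h' : ∀ y : Y, ContinuousOn (fun v : FluidVar n => T (v, y)) {v | 0 < v.1} :=
      fun y => hT.contDiffOn.continuousOn.comp (f := fun v : FluidVar n => (v, y)) (by fun_prop)
        fun v hv => hv
    exact (h' _).sub ((h' _).add ((h _).clm_apply continuousOn_const))
  · set z := fderiv ℝ Z A (outer a b) with hz
    have key : ∀ t : ℝ, fderiv ℝ T (v, Z A + t • z) (0, z) = fderiv ℝ T (v, Z A) (0, z) := by
      intro t
      by_cases ht : t = 0
      · simp [ht]
      -- Here `∇ρ = t a` is aligned with the velocity perturbation, so the baroclinic form `b ⊗ t a`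
      -- produces the vorticity direction `-t z`. The velocity terms agree by `fderiv_vel_eq`,
      -- leaving the derivative along `z`.
      have h := lagS_eq_base hP.smoothState hZ hT hL hv hS (t • a) (t • a) b A
      have hzt : fderiv ℝ Z A (outer (t • a) b) = t • z := by rw [outer_smul_left, map_smul]
      have e1 : fderiv ℝ Z (A + outer (t • a) b) (outer b (t • a)) = -(t • z) := by
        rw [hZ.fderiv_swap, hZ.outer, hzt]
      have e2 : fderiv ℝ Z A (outer b (t • a)) = -(t • z) := by
        rw [hZ.fderiv_swap, hzt]
      have hvel := fderiv_vel_eq hP hZ hT hL hv (t • a) b A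
      simp only [lagS, hZ.add_outer, hzt, e1, e2] at h hvel
      have e3 : (((0, 0, -v.1⁻¹ • WithLp.toLp 2 b), (v.1 ^ 2)⁻¹ • -(t • z)) : FluidVar n × Y) =
          (-v.1⁻¹) • ((0, 0, WithLp.toLp 2 b), 0) + (-((v.1 ^ 2)⁻¹ * t)) • (0, z) := by
        refine Prod.ext (Prod.ext ?_ (Prod.ext ?_ ?_)) ?_ <;> simp [smul_smul]
      rw [e3, map_add, map_add, map_smul, map_smul, map_smul, map_smul, hvel,
        add_right_inj, smul_eq_mul, smul_eq_mul] at h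
      exact mul_left_cancel₀ (neg_ne_zero.2 (mul_ne_zero (inv_ne_zero (pow_ne_zero 2 hv.ne')) ht)) h
    have hd : ∀ t : ℝ, HasDerivAt (fun t : ℝ => T (v, Z A + t • z) -
        t * fderiv ℝ T (v, Z A) (0, z)) 0 t := by
      intro t
      have h1 : HasDerivAt (fun t : ℝ => ((v, Z A + t • z) : FluidVar n × Y)) (0, z) t := by
        refine (hasDerivAt_const t v).prodMk ?_
        simpa using ((hasDerivAt_id t).smul_const z).const_add (Z A)
      have h2 := ((hT.hasFDerivAt (q := (v, Z A + t • z)) hv).comp_hasDerivAt t h1).fun_sub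
        ((hasDerivAt_id t).mul_const (fderiv ℝ T (v, Z A) (0, z)))
      rw [key] at h2
      simpa using h2
    have := is_const_of_deriv_eq_zero (fun t => (hd t).differentiableAt) (fun t => (hd t).deriv) 1 0
    simp only [one_smul, one_mul, zero_smul, zero_mul, add_zero, sub_zero] at this
    linarith

end Conserved

/-! ### Densities affine in the vorticity -/

/-- The density `K(ρ, S, u) + c(ρ, S, u) ϖ`. -/
def affDens (K : FluidVar n → ℝ) (c : FluidVar n → Y →L[ℝ] ℝ) (p : FluidVar n × Y) : ℝ :=
  K p.1 + c p.1 p.2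

section AffDens

variable {K : FluidVar n → ℝ} {c : FluidVar n → Y →L[ℝ] ℝ}

lemma isOpen_posVar : IsOpen {v : FluidVar n | 0 < v.1} :=
  isOpen_lt continuous_const continuous_fst

lemma isVortFunction_affDens (hK : IsKinematic K) (hc : ContDiffOn ℝ ∞ c {v | 0 < v.1}) :
    IsVortFunction (affDens K c) := by
  have h1 : Set.MapsTo (Prod.fst : FluidVar n × Y → FluidVar n) {v | 0 < v.1.1} {v | 0 < v.1} :=
    fun p hp => hp
  exact (ContDiffOn.comp hK contDiff_fst.contDiffOn h1).add
    ((hc.comp contDiff_fst.contDiffOn h1).clm_apply contDiff_snd.contDiffOn)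

lemma fderiv_affDens (hK : IsKinematic K) (hc : ContDiffOn ℝ ∞ c {v | 0 < v.1})
    {v : FluidVar n} (hv : 0 < v.1) (y : Y) (v' : FluidVar n) (y' : Y) :
    fderiv ℝ (affDens K c) (v, y) (v', y') =
      fderiv ℝ K v v' + fderiv ℝ c v v' y + c v y' := by
  have hK' : HasFDerivAt K (fderiv ℝ K v) v :=
    ((ContDiffOn.differentiableOn hK (by simp)).differentiableAt
      (isOpen_posVar.mem_nhds hv)).hasFDerivAt
  have hc' : HasFDerivAt c (fderiv ℝ c v) v :=
    ((hc.differentiableOn (by simp)).differentiableAt (isOpen_posVar.mem_nhds hv)).hasFDerivAt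
  have h1 : HasFDerivAt (fun p : FluidVar n × Y => K p.1) _ (v, y) :=
    hK'.comp (v, y) hasFDerivAt_fst
  have h2 : HasFDerivAt (fun p : FluidVar n × Y => c p.1) _ (v, y) :=
    hc'.comp (v, y) hasFDerivAt_fst
  have h3 := h1.add (h2.clm_apply hasFDerivAt_snd)
  have h4 : fderiv ℝ (affDens K c) (v, y) = _ := h3.fderiv
  rw [h4]
  simp
  ring

lemma lag_affDens (P : ℝ → ℝ → ℝ) (Z : Grad n → Y) (hK : IsKinematic K)
    (hc : ContDiffOn ℝ ∞ c {v | 0 < v.1}) {v : FluidVar n} (hv : 0 < v.1)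
    (G : Fin n → FluidVar n) :
    lag P Z (affDens K c) (v, G) = (K v + c v (Z (velGrad G))) * velDiv G +
      (fderiv ℝ K v (materialVar P v G) + fderiv ℝ c v (materialVar P v G) (Z (velGrad G)) +
        c v (fderiv ℝ Z (velGrad G) (materialGrad P v G))) := by
  simp only [lag]
  rw [fderiv_affDens hK hc hv]
  rfl

variable {P : ℝ → ℝ → ℝ} {Z : Grad n → Y}

lemma fderiv_coeff_vel (hP : IsNonIsentropic P) (hZ : IsCurlForm Z) (hK : IsKinematic K)
    (hc : ContDiffOn ℝ ∞ c {v | 0 < v.1}) (hL : IsDivergence (lag P Z (affDens K c)))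
    {v : FluidVar n} (hv : 0 < v.1) (a b : Fin n → ℝ) (A : Grad n) :
    fderiv ℝ c v (0, 0, WithLp.toLp 2 b) (fderiv ℝ Z A (outer a b)) = 0 := by
  have h := fderiv_vel_eq hP hZ (isVortFunction_affDens hK hc) hL hv a b A
  rw [fderiv_affDens hK hc hv, fderiv_affDens hK hc hv, map_add] at h
  linarith

/-- At `∇ρ = ∇S = 0` the second difference of `lag` under `A ± a ⊗ b` must vanish. The dilation term
contributes `2(a·b) c(z)`, cancelled by the `(a·b) a ⊗ b` part of `(A ± a ⊗ b)²`; the rest of the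
square drops out by the properties of `IsCurlForm`. What remains is `-2ρ (a·b) ∂_ρ c(z)`. -/
lemma fderiv_coeff_rho (hP : IsNonIsentropic P) (hZ : IsCurlForm Z) (hK : IsKinematic K)
    (hc : ContDiffOn ℝ ∞ c {v | 0 < v.1}) (hL : IsDivergence (lag P Z (affDens K c)))
    {v : FluidVar n} (hv : 0 < v.1) (a b : Fin n → ℝ) (A : Grad n) :
    fderiv ℝ c v (1, 0, 0) (fderiv ℝ Z A (outer a b)) = 0 := by
  have main : ∀ a : Fin n → ℝ, ∑ i, a i * b i ≠ 0 →
      fderiv ℝ c v (1, 0, 0) (fderiv ℝ Z A (outer a b)) = 0 := by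
    intro a hab
    set z := fderiv ℝ Z A (outer a b) with hz
    have hs := contDiffOn_lag hP.smoothState hZ (isVortFunction_affDens hK hc)
    have h := hL.rankOne hs v hv (gradJet 0 0 A) b (a := (0, 0, WithLp.toLp 2 a)) rfl
    rw [gradJet_add, gradJet_sub] at h
    simp only [zero_smul, add_zero, sub_zero] at h
    have hmv : ∀ B : Grad n, materialVar P v (gradJet 0 0 B) =
        (-(v.1 * ∑ i, B i i)) • ((1, 0, 0) : FluidVar n) := by
      intro B
      refine Prod.ext ?_ (Prod.ext ?_ ?_)
      · simp [materialVar]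
      · simp [materialVar]
      · ext i; simp [materialVar, gradJet]
    have hmg : ∀ B : Grad n, materialGrad P v (gradJet 0 0 B) =
        - fun i j => ∑ p, B i p * B p j := by
      intro B; ext i j; simp [materialGrad, gradJet]
    have hlag : ∀ B : Grad n, lag P Z (affDens K c) (v, gradJet 0 0 B) =
        (K v + c v (Z B)) * (∑ i, B i i) -
          (v.1 * ∑ i, B i i) * (fderiv ℝ K v (1, 0, 0) + fderiv ℝ c v (1, 0, 0) (Z B)) -
          c v (fderiv ℝ Z B fun i j => ∑ p, B i p * B p j) := by
      intro B
      rw [lag_affDens P Z hK hc hv, hmv, hmg]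
      simp only [velGrad_gradJet, velDiv_gradJet, map_smul, map_neg, smul_apply, smul_eq_mul]
      ring
    have hsub : A - outer a b = A + outer (-a) b := by ext i j; simp [outer]; ring
    have hneg : outer (-a) b = - outer a b := by ext i j; simp [outer]
    have hZp : Z (A + outer a b) = Z A + z := hZ.add_outer A a b
    have hZm : Z (A - outer a b) = Z A - z := by
      rw [hsub, hZ.add_outer, hneg, map_neg, sub_eq_add_neg]
    have htp : ∑ i, (A + outer a b) i i = ∑ i, A i i + ∑ i, a i * b i := by
      simp [Finset.sum_add_distrib]
    have htm : ∑ i, (A - outer a b) i i = ∑ i, A i i - ∑ i, a i * b i := by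
      simp [Finset.sum_sub_distrib]
    have hsqp : (fun i j => ∑ p, (A + outer a b) i p * (A + outer a b) p j : Grad n) =
        (fun i j => ∑ p, A i p * A p j) + (outer (fun i => ∑ p, A i p * a p) b +
          outer a (fun j => ∑ p, A p j * b p)) + (∑ i, a i * b i) • outer a b := by
      ext i j
      simp only [Pi.add_apply, Pi.smul_apply, outer_apply, smul_eq_mul, Finset.sum_mul,
        Finset.mul_sum, ← Finset.sum_add_distrib]
      exact Finset.sum_congr rfl fun p _ => by ring
    have hsqm : (fun i j => ∑ p, (A - outer a b) i p * (A - outer a b) p j : Grad n) =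
        (fun i j => ∑ p, A i p * A p j) - (outer (fun i => ∑ p, A i p * a p) b +
          outer a (fun j => ∑ p, A p j * b p)) + (∑ i, a i * b i) • outer a b := by
      ext i j
      simp only [Pi.add_apply, Pi.sub_apply, Pi.smul_apply, outer_apply, smul_eq_mul,
        Finset.sum_mul, Finset.mul_sum, ← Finset.sum_add_distrib, ← Finset.sum_sub_distrib]
      exact Finset.sum_congr rfl fun p _ => by ring
    have hr : ∀ d, fderiv ℝ Z (A - outer a b) (outer d b) = fderiv ℝ Z A (outer d b) := by
      intro d; rw [hsub, hZ.outer]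
    have hl : ∀ d, fderiv ℝ Z (A - outer a b) (outer a d) = fderiv ℝ Z A (outer a d) := by
      intro d
      have : A - outer a b = A + outer a (-b) := by ext i j; simp [outer]; ring
      rw [this, hZ.outer_left]
    have haff := congrArg (c v) (hZ.fderiv_add_outer_affine A (fun i j => ∑ p, A i p * A p j) a b)
    rw [hlag, hlag, hlag, hsqp, hsqm, htp, htm, hZp, hZm] at h
    simp only [map_add, map_sub, map_smul, hZ.outer, hZ.outer_left, hr, hl, smul_eq_mul, ← hz]
      at h haff
    have h2 : 2 * v.1 * (∑ i, a i * b i) * fderiv ℝ c v (1, 0, 0) z = 0 := by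
      linear_combination -h - haff
    exact (mul_eq_zero.1 h2).resolve_left (mul_ne_zero (mul_ne_zero two_ne_zero hv.ne') hab)
  by_cases hab : ∑ i, a i * b i = 0
  · by_cases hb : ∑ i, b i * b i = 0
    · have hb0 : b = 0 := by
        funext i
        have := (Finset.sum_eq_zero_iff_of_nonneg fun i _ => mul_self_nonneg (b i)).1 hb i
          (Finset.mem_univ i)
        simpa using this
      have : outer a b = 0 := by ext i j; simp [hb0]
      rw [this, map_zero, map_zero]
    -- When `a·b = 0`, replace `a` by `a + b`: the form `b ⊗ b` is symmetric, so the vorticity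
    -- direction is unchanged, while `(a + b)·b = |b|² ≠ 0`.
    · have h1 := main (a + b) (by simpa [add_mul, Finset.sum_add_distrib, hab] using hb)
      rwa [outer_add_left, map_add, hZ.fderiv_symm A (outer b b) fun i j => by simp [mul_comm],
        add_zero] at h1
  · exact main a hab

end AffDens

end FluidFlow

end

noncomputable section

namespace FluidFlow

variable {n : ℕ}

/-! ### The vorticity of a first-order jet -/

/-- Fixing the leading indices amounts to inserting coordinate covectors, and the gradient may
replace the curl because their difference is symmetric. -/
lemma starCurlPow_eq {r k : ℕ} (h : r + 2 * k = n) (q : JetPoint n 1) (c : Fin r → Fin n) :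
    starCurlPow r k h q c = curlPow h (fun a => Pi.single (c a) 1) (velGrad (fluidVarD q)) := by
  set A := velGrad (fluidVarD q) with hA
  have hsplit : A = (fun i j => curl q i j) + fun i j => (A i j + A j i) / 2 := by
    ext i j; simp [hA, velGrad, curl]; ring
  rw [hsplit, (isCurlForm_curlPow h _).add_symm _ _ fun i j => by ring]
  unfold starCurlPow curlPow
  rw [altForm_apply]
  refine Finset.sum_congr rfl fun σ _ => ?_
  have h1 : ∏ a, (Pi.single (c a) 1 : Fin n → ℝ) (σ (slotC h a)) =
      if ∀ a, σ (slotC h a) = c a then 1 else 0 := by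
    simp only [Pi.single_apply]
    rw [Finset.prod_ite_zero]
    simp
  unfold altTerm
  rw [h1]
  by_cases hc : ∀ a, σ (slotC h a) = c a
  · rw [if_pos hc, if_pos (show ∀ a : Fin r, σ ⟨a, _⟩ = c a from hc), one_mul]
    rfl
  · rw [if_neg hc, if_neg (show ¬ ∀ a : Fin r, σ ⟨a, _⟩ = c a from hc)]
    simp

/-- The vorticity scalar as a function of the velocity gradient. -/
def vortEven (m : ℕ) : Grad (2 * m) → ℝ :=
  curlPow (r := 0) (k := m) (by omega) fun a => a.elim0

/-- The vorticity vector as a function of the velocity gradient. -/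
def vortOdd (m : ℕ) (A : Grad (2 * m + 1)) : Space (2 * m + 1) :=
  WithLp.toLp 2 fun i => curlPow (r := 1) (k := m) (by omega) (fun _ => Pi.single i 1) A

lemma isCurlForm_vortEven (m : ℕ) : IsCurlForm (vortEven m) := isCurlForm_curlPow _ _

lemma isCurlForm_vortOdd (m : ℕ) : IsCurlForm (vortOdd m) :=
  IsCurlForm.of_components fun _ => isCurlForm_curlPow _ _

lemma vortScalar_eq {m : ℕ} (q : JetPoint (2 * m) 1) :
    vortScalar q = vortEven m (velGrad (fluidVarD q)) := by
  rw [vortScalar, starCurlPow_eq, vortEven]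
  congr 1
  funext a
  exact a.elim0

lemma vortVector_eq {m : ℕ} (q : JetPoint (2 * m + 1) 1) :
    vortVector q = vortOdd m (velGrad (fluidVarD q)) := by
  simp only [vortVector, starCurlPow_eq, vortOdd]

lemma evenVortDensity_eq {m : ℕ} (T : FluidVar (2 * m) × ℝ → ℝ) :
    evenVortDensity T = vortDensity (vortEven m) T := by
  funext q
  simp only [evenVortDensity, vortDensity, vortScalar_eq]

lemma oddVortDensity_eq {m : ℕ} (T : FluidVar (2 * m + 1) × Space (2 * m + 1) → ℝ) :
    oddVortDensity T = vortDensity (vortOdd m) T := by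
  funext q
  simp only [oddVortDensity, vortDensity, vortVector_eq]

/-! ### Reduction to densities affine in the vorticity -/

section Affine

lemma eventually_posVort {Y : Type*} [NormedAddCommGroup Y] {q : FluidVar n × Y} (hq : 0 < q.1.1) :
    ∀ᶠ p in nhds q, p ∈ posVort n Y := isOpen_posVort.mem_nhds hq

variable {Y : Type*} [NormedAddCommGroup Y] [NormedSpace ℝ Y]

lemma lag_congr (P : ℝ → ℝ → ℝ) (Z : Grad n → Y) {T T' : FluidVar n × Y → ℝ}
    (h : ∀ v y, 0 < v.1 → T (v, y) = T' (v, y)) {j : Jet1 n} (hj : j ∈ posJet n) :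
    lag P Z T j = lag P Z T' j := by
  have h1 : T =ᶠ[nhds (j.1, Z (velGrad j.2))] T' := by
    filter_upwards [eventually_posVort (q := (j.1, Z (velGrad j.2))) hj] with p hp
    exact h p.1 p.2 hp
  simp only [lag, h1.fderiv_eq, h1.eq_of_nhds]

lemma IsDivergence.lag_congr {P : ℝ → ℝ → ℝ} {Z : Grad n → Y} {T T' : FluidVar n × Y → ℝ}
    (hL : IsDivergence (lag P Z T)) (h : ∀ v y, 0 < v.1 → T (v, y) = T' (v, y)) :
    IsDivergence (lag P Z T') := by
  obtain ⟨k, Θ, hΘ, hd⟩ := hL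
  exact ⟨k, Θ, hΘ, fun w hw x => by
    rw [← FluidFlow.lag_congr P Z h (firstJet_mem_posJet hw x), hd w hw x]⟩

/-- The value at zero vorticity. -/
def affConst (T : FluidVar n × Y → ℝ) (v : FluidVar n) : ℝ := T (v, 0)

/-- The derivative in the vorticity at zero vorticity. -/
def affCoeff (T : FluidVar n × Y → ℝ) (v : FluidVar n) : Y →L[ℝ] ℝ :=
  (fderiv ℝ T (v, 0)).comp (ContinuousLinearMap.inr ℝ (FluidVar n) Y)

lemma isKinematic_affConst {T : FluidVar n × Y → ℝ} (hT : IsVortFunction T) :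
    IsKinematic (affConst T) :=
  ContDiffOn.comp (g := T) hT.contDiffOn (f := fun v : FluidVar n => (v, (0 : Y)))
    (contDiff_id.prodMk contDiff_const).contDiffOn fun _ hv => hv

lemma contDiffOn_affCoeff {T : FluidVar n × Y → ℝ} (hT : IsVortFunction T) :
    ContDiffOn ℝ ∞ (affCoeff T) {v | 0 < v.1} :=
  (hT.contDiffOn_fderiv.comp (f := fun v : FluidVar n => (v, (0 : Y)))
    (contDiff_id.prodMk contDiff_const).contDiffOn fun _ hv => hv).clm_comp contDiffOn_const

/-- The region `ρ > 0` is convex, so one may integrate along the segment from `v` to `v'`. -/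
lemma coeff_eq_of_fderiv {c : FluidVar n → Y →L[ℝ] ℝ} (hc : ContDiffOn ℝ ∞ c {v | 0 < v.1})
    {v v' : FluidVar n} (hv : 0 < v.1) (hv' : 0 < v'.1) (y : Y)
    (h : ∀ p : FluidVar n, 0 < p.1 → fderiv ℝ c p (v' - v) y = 0) : c v' y = c v y := by
  have hpos : ∀ t ∈ Set.Icc (0 : ℝ) 1, 0 < (v + t • (v' - v)).1 := by
    intro t ht
    have e : (v + t • (v' - v)).1 = (1 - t) * v.1 + t * v'.1 := by simp; ring
    rw [e]
    rcases eq_or_lt_of_le ht.1 with h0 | h0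
    · simp [← h0, hv]
    · have := mul_pos h0 hv'
      nlinarith [mul_nonneg (sub_nonneg.2 ht.2) hv.le]
  have hd : ∀ t ∈ Set.Icc (0 : ℝ) 1, HasDerivAt (fun t : ℝ => c (v + t • (v' - v)) y) 0 t := by
    intro t ht
    have h1 : HasDerivAt (fun t : ℝ => v + t • (v' - v)) (v' - v) t := by
      simpa using ((hasDerivAt_id t).smul_const (v' - v)).const_add v
    have h2 : HasFDerivAt c (fderiv ℝ c (v + t • (v' - v))) (v + t • (v' - v)) :=
      ((hc.differentiableOn (by simp)).differentiableAt
        (isOpen_posVar.mem_nhds (hpos t ht))).hasFDerivAt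
    have h3 : HasFDerivAt (fun p => c p y) ((ContinuousLinearMap.apply ℝ ℝ y).comp
        (fderiv ℝ c (v + t • (v' - v)))) (v + t • (v' - v)) :=
      (ContinuousLinearMap.apply ℝ ℝ y).hasFDerivAt.comp _ h2
    have h4 := h3.comp_hasDerivAt t h1
    rw [ContinuousLinearMap.comp_apply, ContinuousLinearMap.apply_apply, h _ (hpos t ht)] at h4
    exact h4
  have := constant_of_has_deriv_right_zero
    (fun t ht => (hd t ht).continuousAt.continuousWithinAt)
    (fun t ht => (hd t ⟨ht.1, ht.2.le⟩).hasDerivWithinAt) 1 (by simp)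
  simpa using this

end Affine

/-! ### Even dimension -/

section Even

variable {m : ℕ}

lemma vortEven_partialSum (M : Matrix (Fin (2 * m)) (Fin (2 * m)) ℝ) (l : Fin m) :
    vortEven m (partialSum (r := 0) (by omega) M l) = 0 := curlPow_partialSum _ _ _ _

lemma fderiv_vortEven_partialSum (M : Matrix (Fin (2 * m)) (Fin (2 * m)) ℝ) (l : Fin m) :
    fderiv ℝ (vortEven m) (partialSum (r := 0) (by omega) M l)
      (outer (M (slotL (r := 0) (by omega) l)) (M (slotR (r := 0) (by omega) l))) =
      (m.factorial : ℝ) * M.det :=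
  fderiv_curlPow_partialSum _ _ M (fun a => a.elim0) l

/-- Conserved densities in even dimension. -/
lemma even_classification (hm : 1 ≤ m) {P : ℝ → ℝ → ℝ} (hP : IsNonIsentropic P)
    {T : FluidVar (2 * m) × ℝ → ℝ} (hT : IsVortFunction T)
    (hcons : IsConservedDensity P (evenVortDensity T)) :
    ∃ (K : FluidVar (2 * m) → ℝ) (f : ℝ → ℝ), IsKinematic K ∧ ContDiff ℝ ∞ f ∧
      ∀ (v : FluidVar (2 * m)) (y : ℝ), 0 < v.1 → T (v, y) = K v + f v.2.1 * y := by
  rw [evenVortDensity_eq] at hcons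
  have hZ := isCurlForm_vortEven m
  have hL := isDivergence_lag hP.smoothState hZ hT hcons
  set l₀ : Fin m := ⟨0, by omega⟩ with hl₀
  have hfac : (m.factorial : ℝ) ≠ 0 := by exact_mod_cast m.factorial_ne_zero
  set K := affConst T with hKd
  set c := affCoeff T with hcd
  have hK : IsKinematic K := isKinematic_affConst hT
  have hc : ContDiffOn ℝ ∞ c {v | 0 < v.1} := contDiffOn_affCoeff hT
  have haff : ∀ v y, 0 < v.1 → T (v, y) = affDens K c (v, y) := by
    -- For the identity matrix the last pair creates the vorticity `m!` from a gradient with none;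
    -- scaling by `y / m!` reaches any prescribed `y`.
    intro v y hv
    set M : Matrix (Fin (2 * m)) (Fin (2 * m)) ℝ := 1 with hM
    have h := affine_vort hP hZ hT hL hv
      ((y / m.factorial) • M (slotL (r := 0) (by omega) l₀)) (M (slotR (r := 0) (by omega) l₀))
      (partialSum (r := 0) (by omega) M l₀)
    rw [outer_smul_left, map_smul, fderiv_vortEven_partialSum, vortEven_partialSum] at h
    have e : (y / m.factorial) • ((m.factorial : ℝ) * M.det) = y := by
      simp [hM]; field_simp
    rw [e, zero_add] at h
    rw [h]; rfl
  have hL' := hL.lag_congr haff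
  have hdet : ∀ (v : FluidVar (2 * m)) (d : FluidVar (2 * m)),
      ∀ M : Matrix (Fin (2 * m)) (Fin (2 * m)) ℝ, M.det ≠ 0 →
      fderiv ℝ c v d (fderiv ℝ (vortEven m) (partialSum (r := 0) (by omega) M l₀)
        (outer (M (slotL (r := 0) (by omega) l₀)) (M (slotR (r := 0) (by omega) l₀)))) = 0 →
      fderiv ℝ c v d 1 = 0 := by
    intro v d M hM h
    rw [fderiv_vortEven_partialSum] at h
    have e : (m.factorial : ℝ) * M.det = ((m.factorial : ℝ) * M.det) • (1 : ℝ) := by simp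
    rw [e, map_smul, smul_eq_mul] at h
    exact (mul_eq_zero.1 h).resolve_left (mul_ne_zero hfac hM)
  have hρ : ∀ v : FluidVar (2 * m), 0 < v.1 → fderiv ℝ c v (1, 0, 0) 1 = 0 := fun v hv =>
    hdet v _ 1 (by simp) (fderiv_coeff_rho hP hZ hK hc hL' hv _ _ _)
  have hu : ∀ v : FluidVar (2 * m), 0 < v.1 → ∀ i : Fin (2 * m),
      fderiv ℝ c v (0, 0, basisVec i) 1 = 0 := by
    intro v hv i
    -- The right factor `b` of the direction is also the velocity direction in `fderiv_coeff_vel`;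
    -- the permutation makes it `eᵢ` and keeps the determinant `±1`.
    set σ : Equiv.Perm (Fin (2 * m)) := Equiv.swap (slotR (r := 0) (by omega) l₀) i with hσ
    set M : Matrix (Fin (2 * m)) (Fin (2 * m)) ℝ := σ.permMatrix ℝ with hM
    have hrow : WithLp.toLp 2 (M (slotR (r := 0) (by omega) l₀)) = basisVec i := by
      ext j
      simp [hM, hσ, Equiv.Perm.permMatrix, PEquiv.toMatrix_apply, eq_comm]
    have hMd : M.det ≠ 0 := by
      rw [hM, Matrix.det_permutation]
      rcases Int.units_eq_one_or (Equiv.Perm.sign σ) with h | h <;> simp [h]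
    refine hdet v _ M hMd ?_
    rw [← hrow]
    exact fderiv_coeff_vel hP hZ hK hc hL' hv _ _ _
  have hconst : ∀ v : FluidVar (2 * m), 0 < v.1 → c v 1 = c (1, v.2.1, 0) 1 := by
    intro v hv
    refine coeff_eq_of_fderiv hc (v := (1, v.2.1, 0)) (by simp) hv 1 fun p hp => ?_
    have e : v - (1, v.2.1, 0) = (v.1 - 1) • ((1, 0, 0) : FluidVar (2 * m)) +
        ∑ i, v.2.2 i • ((0, 0, basisVec i) : FluidVar (2 * m)) := by
      refine Prod.ext ?_ (Prod.ext ?_ ?_)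
      · simp [Prod.fst_sum]
      · simp [Prod.fst_sum, Prod.snd_sum]
      · ext j
        simp [Prod.snd_sum, WithLp.ofLp_sum, Finset.sum_apply, Pi.single_apply]
    rw [e, map_add, map_smul, map_sum]
    simp only [map_smul, add_apply, smul_apply, sum_apply, hρ p hp, hu p hp,
      smul_zero, Finset.sum_const_zero, add_zero]
  refine ⟨K, fun s => c (1, s, 0) 1, hK, ?_, fun v y hv => ?_⟩
  · have h1 : ContDiff ℝ ∞ fun s : ℝ => c (1, s, 0) := by
      rw [← contDiffOn_univ]
      exact hc.comp (f := fun s : ℝ => ((1, s, 0) : FluidVar (2 * m)))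
        (by fun_prop) fun s _ => by simp
    exact h1.clm_apply contDiff_const
  · have e : c v y = y * c v 1 := by
      rw [← smul_eq_mul, ← map_smul, smul_eq_mul, mul_one]
    simp only [haff v y hv, affDens, e, hconst v hv, mul_comm]

end Even

end FluidFlow

end

noncomputable section

namespace FluidFlow

/-! ### The vorticity vector on decomposable gradients -/

section VortOdd

variable {m : ℕ}

lemma odd_dim (m : ℕ) : 1 + 2 * m = 2 * m + 1 := by omega

lemma fderiv_vortOdd_apply (A X : Grad (2 * m + 1)) (i : Fin (2 * m + 1)) :
    (fderiv ℝ (vortOdd m) A X) i =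
      fderiv ℝ (curlPow (odd_dim m) fun _ => Pi.single i 1) A X := by
  have h1 : HasFDerivAt (vortOdd m) (fderiv ℝ (vortOdd m) A) A :=
    ((isCurlForm_vortOdd m).differentiable A).hasFDerivAt
  have h2 := ((EuclideanSpace.proj i : Space (2 * m + 1) →L[ℝ] ℝ).hasFDerivAt
    (x := vortOdd m A)).comp A h1
  exact (congrArg (fun L : Grad (2 * m + 1) →L[ℝ] ℝ => L X) h2.fderiv).symm

lemma vortOdd_partialSum (M : Matrix (Fin (2 * m + 1)) (Fin (2 * m + 1)) ℝ) (l : Fin m) :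
    vortOdd m (partialSum (odd_dim m) M l) = 0 := by
  ext i
  exact curlPow_partialSum (odd_dim m) _ M l

lemma partialSum_congr {n r k : ℕ} (h : r + 2 * k = n) {M N : Matrix (Fin n) (Fin n) ℝ} (l : Fin k)
    (hL : ∀ l', l' ≠ l → M (slotL h l') = N (slotL h l'))
    (hR : ∀ l', l' ≠ l → M (slotR h l') = N (slotR h l')) :
    partialSum h M l = partialSum h N l := by
  refine Finset.sum_congr rfl fun l' hl' => ?_
  rw [hL l' (Finset.ne_of_mem_erase hl'), hR l' (Finset.ne_of_mem_erase hl')]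

/-- Component `i` is a determinant whose covector row has been replaced by `eᵢ`, which is an entry
of the adjugate. -/
lemma fderiv_vortOdd_partialSum (M : Matrix (Fin (2 * m + 1)) (Fin (2 * m + 1)) ℝ) (l : Fin m)
    (i : Fin (2 * m + 1)) :
    (fderiv ℝ (vortOdd m) (partialSum (odd_dim m) M l)
      (outer (M (slotL (odd_dim m) l)) (M (slotR (odd_dim m) l)))) i =
      (m.factorial : ℝ) * M.adjugate i (slotC (odd_dim m) 0) := by
  rw [fderiv_vortOdd_apply, Matrix.adjugate_apply]
  have hL : ∀ l, M.updateRow (slotC (odd_dim m) 0) (Pi.single i 1) (slotL (odd_dim m) l) =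
      M (slotL (odd_dim m) l) := fun l => Matrix.updateRow_ne (slotC_ne_slotL _ _ _).symm
  have hR : ∀ l, M.updateRow (slotC (odd_dim m) 0) (Pi.single i 1) (slotR (odd_dim m) l) =
      M (slotR (odd_dim m) l) := fun l => Matrix.updateRow_ne (slotC_ne_slotR _ _ _).symm
  have h := fderiv_curlPow_partialSum (odd_dim m) (fun _ => Pi.single i 1)
    (M.updateRow (slotC (odd_dim m) 0) (Pi.single i 1)) (fun a => by
      rw [Subsingleton.elim a 0]; exact Matrix.updateRow_self) l
  rw [hL, hR, partialSum_congr (odd_dim m) (N := M) l (fun l' _ => hL l') fun l' _ => hR l'] at h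
  exact h

/-- The vorticity created is thus, up to a nonzero factor, a column of the inverse matrix. Choosing
that column prescribes its direction. -/
lemma fderiv_vortOdd_of_mul_eq_one {M N : Matrix (Fin (2 * m + 1)) (Fin (2 * m + 1)) ℝ}
    (h : M * N = 1) (l : Fin m) :
    fderiv ℝ (vortOdd m) (partialSum (odd_dim m) M l)
      (outer (M (slotL (odd_dim m) l)) (M (slotR (odd_dim m) l))) =
      ((m.factorial : ℝ) * M.det) • WithLp.toLp 2 fun i => N i (slotC (odd_dim m) 0) := by
  ext i
  rw [fderiv_vortOdd_partialSum]
  have : M.adjugate = M.det • N := by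
    calc M.adjugate = M.adjugate * (M * N) := by rw [h, mul_one]
      _ = M.det • N := by rw [← mul_assoc, Matrix.adjugate_mul, Matrix.smul_mul, one_mul]
  rw [this]
  simp [mul_assoc]

lemma vortOdd_sum_outer :
    vortOdd m (∑ l, outer (Pi.single (slotL (odd_dim m) l) 1) (Pi.single (slotR (odd_dim m) l) 1)) =
      (m.factorial : ℝ) • basisVec (slotC (odd_dim m) 0) := by
  ext i
  set M : Matrix (Fin (2 * m + 1)) (Fin (2 * m + 1)) ℝ :=
    (1 : Matrix _ _ ℝ).updateRow (slotC (odd_dim m) 0) (Pi.single i 1) with hM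
  have h := curlPow_sum_outer (odd_dim m) (fun _ => Pi.single i 1) M (fun a => by
    rw [Subsingleton.elim a 0]; exact Matrix.updateRow_self)
  have h1 : ∀ p : Fin (2 * m + 1), (1 : Matrix (Fin (2 * m + 1)) (Fin (2 * m + 1)) ℝ) p =
      Pi.single p 1 := fun p => by ext j; simp [Matrix.one_apply, Pi.single_apply, eq_comm]
  have hL : ∀ l, M (slotL (odd_dim m) l) = Pi.single (slotL (odd_dim m) l) 1 := fun l => by
    rw [hM, Matrix.updateRow_ne (slotC_ne_slotL _ _ _).symm, h1]
  have hR : ∀ l, M (slotR (odd_dim m) l) = Pi.single (slotR (odd_dim m) l) 1 := fun l => by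
    rw [hM, Matrix.updateRow_ne (slotC_ne_slotR _ _ _).symm, h1]
  simp only [hL, hR] at h
  refine h.trans ?_
  have hdet : M.det = (1 : Matrix (Fin (2 * m + 1)) (Fin (2 * m + 1)) ℝ) i (slotC (odd_dim m) 0) := by
    rw [hM, ← Matrix.adjugate_apply, Matrix.adjugate_one]
  simp [hdet, Matrix.one_apply, basisVec]

lemma permMatrix_row {n : ℕ} (σ : Equiv.Perm (Fin n)) (p : Fin n) :
    (σ.permMatrix ℝ) p = Pi.single (σ p) 1 := by
  ext j
  simp [Equiv.Perm.permMatrix, PEquiv.toMatrix_apply, Pi.single_apply, eq_comm]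

/-- The vorticity along coordinate planes. -/
lemma fderiv_vortOdd_perm (σ : Equiv.Perm (Fin (2 * m + 1))) (l : Fin m) :
    fderiv ℝ (vortOdd m) (partialSum (odd_dim m) (σ.permMatrix ℝ) l)
      (outer (Pi.single (σ (slotL (odd_dim m) l)) 1) (Pi.single (σ (slotR (odd_dim m) l)) 1)) =
      ((m.factorial : ℝ) * (Equiv.Perm.sign σ : ℤ)) • basisVec (σ (slotC (odd_dim m) 0)) := by
  have hmul : (σ.permMatrix ℝ) * (σ⁻¹.permMatrix ℝ) = 1 := by
    rw [← Matrix.permMatrix_mul]; simp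
  have h := fderiv_vortOdd_of_mul_eq_one hmul l
  rw [permMatrix_row, permMatrix_row, Matrix.det_permutation] at h
  rw [h]
  congr 1
  ext i
  simp [Equiv.Perm.permMatrix, PEquiv.toMatrix_apply, basisVec, Equiv.symm_apply_eq]


end VortOdd

/-! ### The coefficient of the vorticity vector -/

section OddCoeff

variable {m : ℕ} {P : ℝ → ℝ → ℝ}

/-- A single rank-one step from zero vorticity reaches every `y` with nonzero axial component, and
these `y` are dense. -/
lemma affine_vortOdd (hm : 1 ≤ m) (hP : IsNonIsentropic P)
    {T : FluidVar (2 * m + 1) × Space (2 * m + 1) → ℝ} (hT : IsVortFunction T)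
    (hL : IsDivergence (lag P (vortOdd m) T)) (v : FluidVar (2 * m + 1)) (hv : 0 < v.1)
    (y : Space (2 * m + 1)) : T (v, y) = affDens (affConst T) (affCoeff T) (v, y) := by
  have hZ := isCurlForm_vortOdd m
  have hfac : (m.factorial : ℝ) ≠ 0 := by exact_mod_cast m.factorial_ne_zero
  set l₀ : Fin m := ⟨0, by omega⟩
  set z := slotC (odd_dim m) 0 with hz
  have main : ∀ y : Space (2 * m + 1), y z ≠ 0 →
      T (v, y) = affDens (affConst T) (affCoeff T) (v, y) := by
    intro y hy
    -- The matrix with determinant `y z` whose column `z` is `y`; its inverse supplies the covectors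
    -- of the test gradient.
    set N : Matrix (Fin (2 * m + 1)) (Fin (2 * m + 1)) ℝ := (1 : Matrix _ _ ℝ).updateCol z y with hN
    have hNd : N.det = y z := by
      rw [hN, ← Matrix.cramer_apply, Matrix.cramer_one]; rfl
    have hu : IsUnit N.det := by rw [hNd]; exact hy.isUnit
    have hMN : N⁻¹ * N = 1 := Matrix.nonsing_inv_mul N hu
    have hMd : (N⁻¹).det ≠ 0 := by
      intro h0
      have := congrArg Matrix.det hMN
      rw [Matrix.det_mul, h0, zero_mul, Matrix.det_one] at this
      exact zero_ne_one this
    have hcol : (WithLp.toLp 2 fun i => N i z) = y := by ext i; simp [hN]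
    have h := affine_vort hP hZ hT hL hv
      (((m.factorial : ℝ) * (N⁻¹).det)⁻¹ • N⁻¹ (slotL (odd_dim m) l₀)) (N⁻¹ (slotR (odd_dim m) l₀))
      (partialSum (odd_dim m) N⁻¹ l₀)
    rw [outer_smul_left, map_smul, fderiv_vortOdd_of_mul_eq_one hMN, vortOdd_partialSum, hcol,
      smul_smul, inv_mul_cancel₀ (mul_ne_zero hfac hMd), one_smul, zero_add] at h
    rw [h]; rfl
  have hdense : Dense {y : Space (2 * m + 1) | y z ≠ 0} := by
    have hopen : IsOpenMap (EuclideanSpace.proj z : Space (2 * m + 1) →L[ℝ] ℝ) :=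
      ContinuousLinearMap.isOpenMap _ fun s => ⟨s • basisVec z, by simp⟩
    exact (dense_compl_singleton (0 : ℝ)).preimage hopen
  have hc1 : Continuous fun y => T (v, y) := by
    rw [← continuousOn_univ]
    exact hT.contDiffOn.continuousOn.comp (f := fun y => (v, y)) (by fun_prop) fun _ _ => hv
  have hc2 : Continuous fun y => affDens (affConst T) (affCoeff T) (v, y) := by
    exact Continuous.fun_add (f := fun _ => affConst T v) continuous_const (affCoeff T v).continuous
  exact congrFun (Continuous.ext_on hdense hc1 hc2 main) y

variable {K : FluidVar (2 * m + 1) → ℝ} {c : FluidVar (2 * m + 1) → Space (2 * m + 1) →L[ℝ] ℝ}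

lemma space_eq_sum {n : ℕ} (y : Space n) : y = ∑ i, y i • basisVec i := by
  ext j
  simp [WithLp.ofLp_sum, Finset.sum_apply, Pi.single_apply]

lemma smul_basisVec_cancel {L : Space (2 * m + 1) →L[ℝ] ℝ} {σ : Equiv.Perm (Fin (2 * m + 1))}
    {i : Fin (2 * m + 1)}
    (h : L (((m.factorial : ℝ) * (Equiv.Perm.sign σ : ℤ)) • basisVec i) = 0) :
    L (basisVec i) = 0 := by
  rw [map_smul, smul_eq_mul] at h
  refine (mul_eq_zero.1 h).resolve_left (mul_ne_zero ?_ ?_)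
  · exact_mod_cast m.factorial_ne_zero
  · rcases Int.units_eq_one_or (Equiv.Perm.sign σ) with h | h <;> simp [h]

lemma fderiv_oddCoeff_rho (hm : 1 ≤ m) (hP : IsNonIsentropic P) (hK : IsKinematic K)
    (hc : ContDiffOn ℝ ∞ c {v | 0 < v.1}) (hL : IsDivergence (lag P (vortOdd m) (affDens K c)))
    {v : FluidVar (2 * m + 1)} (hv : 0 < v.1) (y : Space (2 * m + 1)) :
    fderiv ℝ c v (1, 0, 0) y = 0 := by
  have key : ∀ i, fderiv ℝ c v (1, 0, 0) (basisVec i) = 0 := by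
    intro i
    set σ := Equiv.swap (slotC (odd_dim m) 0) i with hσ
    have h := fderiv_coeff_rho hP (isCurlForm_vortOdd m) hK hc hL hv
      (Pi.single (σ (slotL (odd_dim m) ⟨0, by omega⟩)) 1)
      (Pi.single (σ (slotR (odd_dim m) ⟨0, by omega⟩)) 1)
      (partialSum (odd_dim m) (σ.permMatrix ℝ) ⟨0, by omega⟩)
    rw [fderiv_vortOdd_perm] at h
    have := smul_basisVec_cancel h
    rwa [hσ, Equiv.swap_apply_left] at this
  rw [space_eq_sum y, map_sum]
  simp only [map_smul, key, smul_zero, Finset.sum_const_zero]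

lemma exists_perm_of_ne {α : Type*} [DecidableEq α] {a b : α} (hab : a ≠ b) {i j : α} (hij : i ≠ j) :
    ∃ σ : Equiv.Perm α, σ a = i ∧ σ b = j := by
  refine ⟨Equiv.swap (Equiv.swap a i b) j * Equiv.swap a i, ?_, by simp⟩
  rw [Equiv.Perm.mul_apply, Equiv.swap_apply_left, Equiv.swap_apply_of_ne_of_ne _ hij]
  intro h
  have := congrArg (Equiv.swap a i) h
  simp at this
  exact hab this

/-- A permuted coordinate gradient creates vorticity along `e_j` by a direction with right factor
`e_i`, which is possible exactly for distinct axes because the rows are independent. Then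
`fderiv_coeff_vel` applies. -/
lemma fderiv_oddCoeff_vel_ne (hm : 1 ≤ m) (hP : IsNonIsentropic P) (hK : IsKinematic K)
    (hc : ContDiffOn ℝ ∞ c {v | 0 < v.1}) (hL : IsDivergence (lag P (vortOdd m) (affDens K c)))
    {v : FluidVar (2 * m + 1)} (hv : 0 < v.1) {i j : Fin (2 * m + 1)} (hij : i ≠ j) :
    fderiv ℝ c v (0, 0, basisVec i) (basisVec j) = 0 := by
  obtain ⟨σ, h1, h2⟩ := exists_perm_of_ne
    (slotC_ne_slotR (odd_dim m) 0 ⟨0, by omega⟩).symm hij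
  have h := fderiv_coeff_vel hP (isCurlForm_vortOdd m) hK hc hL hv
    (Pi.single (σ (slotL (odd_dim m) ⟨0, by omega⟩)) 1)
    (Pi.single (σ (slotR (odd_dim m) ⟨0, by omega⟩)) 1)
    (partialSum (odd_dim m) (σ.permMatrix ℝ) ⟨0, by omega⟩)
  rw [fderiv_vortOdd_perm, h1, h2] at h
  exact smul_basisVec_cancel h

lemma fderiv_oddCoeff_vel_eq (hm : 1 ≤ m) (hP : IsNonIsentropic P) (hK : IsKinematic K)
    (hc : ContDiffOn ℝ ∞ c {v | 0 < v.1}) (hL : IsDivergence (lag P (vortOdd m) (affDens K c)))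
    {v : FluidVar (2 * m + 1)} (hv : 0 < v.1) (i j : Fin (2 * m + 1)) :
    fderiv ℝ c v (0, 0, basisVec i) (basisVec i) =
      fderiv ℝ c v (0, 0, basisVec j) (basisVec j) := by
  by_cases hij : i = j
  · rw [hij]
  set l₀ : Fin m := ⟨0, by omega⟩
  obtain ⟨σ, h1, h2⟩ := exists_perm_of_ne
    (slotC_ne_slotR (odd_dim m) 0 l₀).symm hij
  -- `τ` exchanges the vorticity axis with the right factor. The base gradient omits the pair `l₀`
  -- and so is the same for `σ` and `τ`, while the signs are opposite.
  set τ := σ * Equiv.swap (slotC (odd_dim m) 0) (slotR (odd_dim m) l₀) with hτ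
  set A := partialSum (odd_dim m) (σ.permMatrix ℝ) l₀ with hA
  have hA' : A = partialSum (odd_dim m) (τ.permMatrix ℝ) l₀ := by
    refine partialSum_congr _ _ (fun l' hl' => ?_) fun l' hl' => ?_
    · rw [permMatrix_row, permMatrix_row, hτ, Equiv.Perm.mul_apply, Equiv.swap_apply_of_ne_of_ne] <;>
        simp [(slotC_ne_slotL (odd_dim m) 0 l').symm]
    · rw [permMatrix_row, permMatrix_row, hτ, Equiv.Perm.mul_apply, Equiv.swap_apply_of_ne_of_ne] <;>
        simp [(slotC_ne_slotR (odd_dim m) 0 l').symm, hl']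
  have t1 : τ (slotR (odd_dim m) l₀) = j := by simp [hτ, h2]
  have t2 : τ (slotC (odd_dim m) 0) = i := by simp [hτ, h1]
  have t3 : τ (slotL (odd_dim m) l₀) = σ (slotL (odd_dim m) l₀) := by
    rw [hτ, Equiv.Perm.mul_apply, Equiv.swap_apply_of_ne_of_ne] <;>
      simp [(slotC_ne_slotL (odd_dim m) 0 l₀).symm]
  have ht : (Equiv.Perm.sign τ : ℤ) = -(Equiv.Perm.sign σ : ℤ) := by
    simp [hτ, Equiv.Perm.sign_swap (slotC_ne_slotR (odd_dim m) 0 l₀)]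
  have e1 := fderiv_vortOdd_perm σ l₀
  have e2 := fderiv_vortOdd_perm τ l₀
  rw [h1, h2, ← hA] at e1
  rw [t1, t2, t3, ← hA', ht] at e2
  set a : Fin (2 * m + 1) → ℝ := Pi.single (σ (slotL (odd_dim m) l₀)) 1
  -- Polarisation with `b = eᵢ + eⱼ`: the off-diagonal entries vanish, and the opposite signs leave
  -- the difference of the two diagonal entries.
  have h := fderiv_coeff_vel hP (isCurlForm_vortOdd m) hK hc hL hv a
    (Pi.single i 1 + Pi.single j 1) A
  have ho : outer a (Pi.single i 1 + Pi.single j 1) =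
      outer a (Pi.single i 1) + outer a (Pi.single j 1) := by
    ext p q; simp [mul_add]
  have hv' : ((0, 0, WithLp.toLp 2 (Pi.single i 1 + Pi.single j 1)) : FluidVar (2 * m + 1)) =
      (0, 0, basisVec i) + (0, 0, basisVec j) := by
    refine Prod.ext (by simp) (Prod.ext (by simp) ?_)
    ext p; simp [Pi.single_apply]
  rw [ho, hv', map_add, map_add, e1, e2, add_apply, map_add, map_add] at h
  have n1 := fderiv_oddCoeff_vel_ne hm hP hK hc hL hv hij
  have n2 := fderiv_oddCoeff_vel_ne hm hP hK hc hL hv (Ne.symm hij)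
  simp only [map_smul, n1, n2, smul_eq_mul] at h
  push_cast at h
  have hne : (m.factorial : ℝ) * (Equiv.Perm.sign σ : ℤ) ≠ 0 := by
    refine mul_ne_zero (by exact_mod_cast m.factorial_ne_zero) ?_
    rcases Int.units_eq_one_or (Equiv.Perm.sign σ) with h | h <;> simp [h]
  refine sub_eq_zero.1 ((mul_eq_zero.1 (?_ : ((m.factorial : ℝ) * (Equiv.Perm.sign σ : ℤ)) *
    (_ - _) = 0)).resolve_left hne)
  linear_combination -h

end OddCoeff

end FluidFlow

end

noncomputable section

namespace FluidFlow

/-! ### The form of the coefficient in odd dimension -/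

lemma hasFDerivAt_coeff_apply {n : ℕ} {Y : Type*} [NormedAddCommGroup Y] [NormedSpace ℝ Y]
    {c : FluidVar n → Y →L[ℝ] ℝ} (hc : ContDiffOn ℝ ∞ c {v | 0 < v.1}) {v : FluidVar n}
    (hv : 0 < v.1) (y : Y) :
    HasFDerivAt (fun p => c p y) ((ContinuousLinearMap.apply ℝ ℝ y).comp (fderiv ℝ c v)) v :=
  (ContinuousLinearMap.apply ℝ ℝ y).hasFDerivAt.comp v
    ((hc.differentiableOn (by simp)).differentiableAt (isOpen_posVar.mem_nhds hv)).hasFDerivAt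

/-- Derivatives of a coefficient are invariant under the translations that preserve it. -/
lemma fderiv_coeff_translate {n : ℕ} {Y : Type*} [NormedAddCommGroup Y] [NormedSpace ℝ Y]
    {c : FluidVar n → Y →L[ℝ] ℝ} (hc : ContDiffOn ℝ ∞ c {v | 0 < v.1}) {v d : FluidVar n}
    (hv : 0 < v.1) (hvd : 0 < (v + d).1) {y : Y}
    (h : ∀ p : FluidVar n, 0 < p.1 → fderiv ℝ c p d y = 0) (d' : FluidVar n) :
    fderiv ℝ c (v + d) d' y = fderiv ℝ c v d' y := by
  have h1 : HasFDerivAt (fun p => c (p + d) y)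
      ((ContinuousLinearMap.apply ℝ ℝ y).comp (fderiv ℝ c (v + d))) v :=
    (hasFDerivAt_comp_add_right d).2 (hasFDerivAt_coeff_apply hc hvd y)
  have h2 := hasFDerivAt_coeff_apply hc hv y
  have hev : (fun p => c (p + d) y) =ᶠ[nhds v] fun p => c p y := by
    have hcont : Continuous fun p : FluidVar n => p + d := by fun_prop
    filter_upwards [isOpen_posVar.mem_nhds hv,
      (isOpen_posVar.preimage hcont).mem_nhds hvd] with p hp hpd
    exact coeff_eq_of_fderiv hc hp hpd y fun q hq => by rw [add_sub_cancel_left]; exact h q hq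
  have := (h1.congr_of_eventuallyEq hev.symm).unique h2
  exact congrArg (fun L : FluidVar n →L[ℝ] ℝ => L d') this

/-- The coefficient `γ + λ u`. -/
def affineCoeff {n : ℕ} (γ : ℝ → Space n →L[ℝ] ℝ) (l : ℝ → ℝ) (v : FluidVar n) : Space n →L[ℝ] ℝ :=
  γ v.2.1 + l v.2.1 • innerSL ℝ v.2.2

lemma affineCoeff_apply {n : ℕ} (γ : ℝ → Space n →L[ℝ] ℝ) (l : ℝ → ℝ) (v : FluidVar n)
    (y : Space n) : affineCoeff γ l v y = γ v.2.1 y + l v.2.1 * inner ℝ v.2.2 y := rfl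

lemma contDiff_affineCoeff {n : ℕ} {γ : ℝ → Space n →L[ℝ] ℝ} {l : ℝ → ℝ}
    (hγ : ContDiff ℝ ∞ γ) (hl : ContDiff ℝ ∞ l) : ContDiff ℝ ∞ (affineCoeff (n := n) γ l) :=
  (hγ.comp contDiff_snd.fst).add ((hl.comp contDiff_snd.fst).smul
    ((innerSL ℝ).contDiff.comp contDiff_snd.snd))

section OddCoeff

variable {m : ℕ} {P : ℝ → ℝ → ℝ} {K : FluidVar (2 * m + 1) → ℝ}
  {c : FluidVar (2 * m + 1) → Space (2 * m + 1) →L[ℝ] ℝ}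

/-- So far `∂c/∂u` is a multiple of the identity. The multiple depends on `S` alone: computed from
component `0` of `c` it does not change with `ρ` or with `u_i`, `i ≠ 0`, and computed from component
`1` it does not change with `u_0`. A second axis exists since `m ≥ 1`. -/
lemma fderiv_oddCoeff_vel (hm : 1 ≤ m) (hP : IsNonIsentropic P) (hK : IsKinematic K)
    (hc : ContDiffOn ℝ ∞ c {v | 0 < v.1}) (hL : IsDivergence (lag P (vortOdd m) (affDens K c)))
    {v : FluidVar (2 * m + 1)} (hv : 0 < v.1) (b y : Space (2 * m + 1)) :
    fderiv ℝ c v (0, 0, b) y =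
      fderiv ℝ c (1, v.2.1, 0) (0, 0, basisVec 0) (basisVec 0) * inner ℝ b y := by
  have hρ : ∀ p : FluidVar (2 * m + 1), 0 < p.1 → ∀ y, fderiv ℝ c p (1, 0, 0) y = 0 :=
    fun p hp y => fderiv_oddCoeff_rho hm hP hK hc hL hp y
  have hne : ∀ p : FluidVar (2 * m + 1), 0 < p.1 → ∀ i j, i ≠ j →
      fderiv ℝ c p (0, 0, basisVec i) (basisVec j) = 0 :=
    fun p hp i j hij => fderiv_oddCoeff_vel_ne hm hP hK hc hL hp hij
  have h01 : (1 : Fin (2 * m + 1)) ≠ 0 := by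
    intro h
    have := congrArg Fin.val h
    simp at this
    omega
  have hdecomp : ∀ u : Space (2 * m + 1), ((0, 0, u) : FluidVar (2 * m + 1)) =
      ∑ i, u i • ((0, 0, basisVec i) : FluidVar (2 * m + 1)) := by
    intro u
    refine Prod.ext ?_ (Prod.ext ?_ ?_)
    · simp [Prod.fst_sum]
    · simp [Prod.fst_sum, Prod.snd_sum]
    · ext j
      simp [Prod.snd_sum, WithLp.ofLp_sum, Finset.sum_apply, Pi.single_apply]
  have hdiag : fderiv ℝ c v (0, 0, basisVec 0) (basisVec 0) =
      fderiv ℝ c (1, v.2.1, 0) (0, 0, basisVec 0) (basisVec 0) := by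
    -- Moves the state to `ρ = 1` and removes all velocity components except the zeroth; component
    -- `0` of `c` is constant in these directions.
    set d : FluidVar (2 * m + 1) := (1 - v.1, 0, v.2.2 0 • basisVec 0 - v.2.2) with hd
    have e1 : v + d = (1, v.2.1, v.2.2 0 • basisVec 0) :=
      Prod.ext (by simp [hd]) (Prod.ext (by simp [hd]) (by simp [hd]))
    have s1 := fderiv_coeff_translate hc (d := d) (y := basisVec 0) hv (by rw [e1]; simp)
      (fun p hp => by
        have e : d = (1 - v.1) • ((1, 0, 0) : FluidVar (2 * m + 1)) +
            (0, 0, v.2.2 0 • basisVec 0 - v.2.2) :=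
          Prod.ext (by simp [hd]) (Prod.ext (by simp [hd]) (by simp [hd]))
        rw [e, map_add, map_smul, add_apply, smul_apply, hρ p hp, smul_zero, zero_add,
          hdecomp, map_sum, sum_apply]
        refine Finset.sum_eq_zero fun i _ => ?_
        rw [map_smul, smul_apply]
        by_cases hi : i = 0
        · subst hi; simp
        · rw [hne p hp i 0 hi, smul_zero]) (0, 0, basisVec 0)
    -- The remaining velocity component is reached from rest along `e_0`, in which direction
    -- component `1` of `c` is constant.
    set d' : FluidVar (2 * m + 1) := (0, 0, v.2.2 0 • basisVec 0) with hd'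
    have e2 : (1, v.2.1, 0) + d' = (1, v.2.1, v.2.2 0 • basisVec 0) :=
      Prod.ext (by simp [hd']) (Prod.ext (by simp [hd']) (by simp [hd']))
    have s2 := fderiv_coeff_translate hc (v := (1, v.2.1, 0)) (d := d') (y := basisVec 1)
      (by simp) (by rw [e2]; simp)
      (fun p hp => by
        have e : d' = v.2.2 0 • ((0, 0, basisVec 0) : FluidVar (2 * m + 1)) :=
          Prod.ext (by simp [hd']) (Prod.ext (by simp [hd']) (by simp [hd']))
        rw [e, map_smul, smul_apply, hne p hp 0 1 h01.symm, smul_zero]) (0, 0, basisVec 1)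
    rw [e1] at s1
    rw [e2] at s2
    rw [← s1, fderiv_oddCoeff_vel_eq hm hP hK hc hL (by simp) 0 1, s2,
      fderiv_oddCoeff_vel_eq hm hP hK hc hL (by simp) 0 1]
  rw [hdecomp b, map_sum, sum_apply]
  have hin : (inner ℝ b y : ℝ) = ∑ i, b i * y i := by
    simp [PiLp.inner_apply, mul_comm]
  rw [hin, Finset.mul_sum]
  refine Finset.sum_congr rfl fun i _ => ?_
  rw [map_smul, smul_apply]
  conv_lhs => rw [space_eq_sum y, map_sum]
  rw [Finset.sum_eq_single i, map_smul, fderiv_oddCoeff_vel_eq hm hP hK hc hL hv i 0, hdiag]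
  · simp only [smul_eq_mul]; ring
  · intro j _ hj
    rw [map_smul, hne v hv i j hj.symm, smul_zero]
  · simp

/-- `γ` is the coefficient at rest and unit density, `l` the diagonal entry of `∂c/∂u` there;
integrating the constant `u`-derivative along the ray `t u` gives the affine form. -/
lemma exists_affineCoeff (hm : 1 ≤ m) (hP : IsNonIsentropic P) (hK : IsKinematic K)
    (hc : ContDiffOn ℝ ∞ c {v | 0 < v.1}) (hL : IsDivergence (lag P (vortOdd m) (affDens K c))) :
    ∃ (γ : ℝ → Space (2 * m + 1) →L[ℝ] ℝ) (l : ℝ → ℝ), ContDiff ℝ ∞ γ ∧ ContDiff ℝ ∞ l ∧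
      ∀ v : FluidVar (2 * m + 1), 0 < v.1 → ∀ y, c v y = affineCoeff γ l v y := by
  have hline : ContDiff ℝ ∞ fun s : ℝ => ((1, s, 0) : FluidVar (2 * m + 1)) := by fun_prop
  refine ⟨fun s => c (1, s, 0), fun s => fderiv ℝ c (1, s, 0) (0, 0, basisVec 0) (basisVec 0),
    ?_, ?_, fun v hv y => ?_⟩
  · rw [← contDiffOn_univ]
    exact hc.comp hline.contDiffOn fun s _ => by simp
  · have h1 : ContDiffOn ℝ ∞ (fderiv ℝ c) {v | 0 < v.1} :=
      hc.fderiv_of_isOpen isOpen_posVar (by simp)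
    have h2 : ContDiff ℝ ∞ fun s : ℝ => fderiv ℝ c (1, s, 0) := by
      rw [← contDiffOn_univ]
      exact h1.comp hline.contDiffOn fun s _ => by simp
    exact (h2.clm_apply contDiff_const).clm_apply contDiff_const
  · rw [affineCoeff_apply]
    set μ := fderiv ℝ c (1, v.2.1, 0) (0, 0, basisVec 0) (basisVec 0) with hμ
    have h1 : c v y = c (1, v.2.1, v.2.2) y := by
      refine coeff_eq_of_fderiv hc (v := (1, v.2.1, v.2.2)) (by simp) hv y fun p hp => ?_
      have e : v - (1, v.2.1, v.2.2) = (v.1 - 1) • ((1, 0, 0) : FluidVar (2 * m + 1)) :=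
        Prod.ext (by simp) (Prod.ext (by simp) (by simp))
      rw [e, map_smul, smul_apply, fderiv_oddCoeff_rho hm hP hK hc hL hp, smul_zero]
    have hd : ∀ t : ℝ, HasDerivAt (fun t : ℝ => c (1, v.2.1, t • v.2.2) y -
        t * (μ * inner ℝ v.2.2 y)) 0 t := by
      intro t
      have e1 : HasDerivAt (fun t : ℝ => ((1, v.2.1, t • v.2.2) : FluidVar (2 * m + 1)))
          (0, 0, v.2.2) t := by
        refine (hasDerivAt_const t _).prodMk ((hasDerivAt_const t _).prodMk ?_)
        simpa using (hasDerivAt_id t).smul_const v.2.2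
      have e2 := ((hasFDerivAt_coeff_apply hc (v := (1, v.2.1, t • v.2.2)) (by simp)
        y).comp_hasDerivAt t e1).fun_sub ((hasDerivAt_id t).mul_const (μ * inner ℝ v.2.2 y))
      rw [ContinuousLinearMap.comp_apply, ContinuousLinearMap.apply_apply,
        fderiv_oddCoeff_vel hm hP hK hc hL (by simp)] at e2
      simpa [← hμ] using e2
    have := is_const_of_deriv_eq_zero (fun t => (hd t).differentiableAt) (fun t => (hd t).deriv) 1 0
    simp only [one_smul, one_mul, zero_smul, zero_mul, sub_zero] at this
    rw [h1]
    linarith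

end OddCoeff

end FluidFlow

end

noncomputable section

namespace FluidFlow

/-! ### The Euler-Lagrange equation for the entropy -/

section EntropyEL

variable {n : ℕ} {Y : Type*} [NormedAddCommGroup Y] [NormedSpace ℝ Y]
  {P : ℝ → ℝ → ℝ} {Z : Grad n → Y} {T : FluidVar n × Y → ℝ}

/-- The Euler-Lagrange expression of `lag` for variations of the entropy, at points where
`∇ρ = r`, `∇S = 0`, `∇u = A` and all second derivatives vanish. -/
def entropyEL (P : ℝ → ℝ → ℝ) (Z : Grad n → Y) (T : FluidVar n × Y → ℝ) (v : FluidVar n)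
    (r : Fin n → ℝ) (A : Grad n) : ℝ :=
  fderiv ℝ (fun v' => lag P Z T (v', gradJet r 0 A)) v (0, 1, 0) -
    ∑ i, fderiv ℝ (fun v' => presS P (v'.1, v'.2.1) * lagS Z T v' r (Pi.single i 1) A) v
      (r i, 0, WithLp.toLp 2 fun p => A p i)

lemma lagS_smul (Z : Grad n → Y) (T : FluidVar n × Y → ℝ) (v : FluidVar n) (r s : Fin n → ℝ)
    (A : Grad n) (t : ℝ) : lagS Z T v r (t • s) A = t * lagS Z T v r s A := by
  have h : (((0, 0, -v.1⁻¹ • WithLp.toLp 2 (t • s)),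
      (v.1 ^ 2)⁻¹ • fderiv ℝ Z A (outer (t • s) r)) : FluidVar n × Y) =
      t • ((0, 0, -v.1⁻¹ • WithLp.toLp 2 s), (v.1 ^ 2)⁻¹ • fderiv ℝ Z A (outer s r)) := by
    refine Prod.ext (Prod.ext ?_ (Prod.ext ?_ ?_)) ?_
    · simp
    · simp
    · ext i; simp; ring
    · rw [outer_smul_left, map_smul, smul_comm]; rfl
  rw [lagS, h, map_smul]
  rfl

lemma contDiffOn_lag_state (hP : SmoothState P) (hZ : IsCurlForm Z) (hT : IsVortFunction T)
    (G : Fin n → FluidVar n) :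
    ContDiffOn ℝ ∞ (fun v => lag P Z T (v, G)) {v | 0 < v.1} :=
  (contDiffOn_lag hP hZ hT).comp (f := fun v : FluidVar n => (v, G)) (by fun_prop) fun _ hv => hv

lemma contDiffOn_presS_state (hP : SmoothState P) :
    ContDiffOn ℝ ∞ (fun v : FluidVar n => presS P (v.1, v.2.1)) {v | 0 < v.1} :=
  hP.contDiffOn_presS.comp (f := fun v : FluidVar n => (v.1, v.2.1)) (by fun_prop) fun _ hv => hv

lemma contDiffOn_lagS (Z : Grad n → Y) (hT : IsVortFunction T) (r s : Fin n → ℝ) (A : Grad n) :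
    ContDiffOn ℝ ∞ (fun v => lagS Z T v r s A) {v | 0 < v.1} := by
  have h1 : ContDiffOn ℝ ∞ (fun v : FluidVar n => v.1⁻¹) {v | 0 < v.1} :=
    contDiff_fst.contDiffOn.inv fun v hv => (show 0 < v.1 from hv).ne'
  have h2 : ContDiffOn ℝ ∞ (fun v : FluidVar n => (v.1 ^ 2)⁻¹) {v | 0 < v.1} :=
    (contDiff_fst.pow 2).contDiffOn.inv fun v hv =>
      pow_ne_zero 2 (show 0 < v.1 from hv).ne'
  unfold lagS
  refine (hT.contDiffOn_fderiv.comp (f := fun v : FluidVar n => (v, Z A)) (by fun_prop)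
    fun _ hv => hv).clm_apply ?_
  exact (contDiffOn_const.prodMk (contDiffOn_const.prodMk (h1.neg.smul contDiffOn_const))).prodMk
    (h2.smul contDiffOn_const)

lemma ContDiffOn.differentiableAt_state {F : FluidVar n → ℝ} (hF : ContDiffOn ℝ ∞ F {v | 0 < v.1})
    {v : FluidVar n} (hv : 0 < v.1) : DifferentiableAt ℝ F v :=
  (hF.differentiableOn (by simp)).differentiableAt (isOpen_posVar.mem_nhds hv)

/-- This is `lowerOrder` for entropy variations at `∇S = 0`. As `lag` is affine in `∇S`, its
derivative in `∂ᵢS` is the slope `P_S lagS(eᵢ)`, and with vanishing second derivatives the total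
derivative `∂ᵢ` acts only on the state, along `(rᵢ, 0, ∂ᵢu)`. -/
lemma entropyEL_eq_zero (hP : SmoothState P) (hZ : IsCurlForm Z) (hT : IsVortFunction T)
    (hL : IsDivergence (lag P Z T)) {v : FluidVar n} (hv : 0 < v.1) (r : Fin n → ℝ) (A : Grad n) :
    entropyEL P Z T v r A = 0 := by
  have hs := contDiffOn_lag hP hZ hT
  set G := gradJet r 0 A with hG
  have h := hL.lowerOrder hs v hv G (a := (0, 1, 0)) rfl
  have hdL : ∀ q : Jet1 n, 0 < q.1.1 → HasFDerivAt (lag P Z T) (fderiv ℝ (lag P Z T) q) q :=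
    fun q hq => ((hs.differentiableOn (by simp)).differentiableAt
      (isOpen_posJet.mem_nhds hq)).hasFDerivAt
  have h1 : fderiv ℝ (fun v' => lag P Z T (v', G)) v (0, 1, 0) =
      fderiv ℝ (lag P Z T) (v, G) ((0, 1, 0), 0) := by
    have : HasFDerivAt (fun v' => lag P Z T (v', G)) _ v :=
      HasFDerivAt.comp (g := lag P Z T) v (hdL (v, G) hv) (hasFDerivAt_prodMk_left (𝕜 := ℝ) v G)
    rw [this.fderiv]; rfl
  have h2 : ∀ i, fderiv ℝ (fun q => fderiv ℝ (lag P Z T) q (0, Pi.single i (0, 1, 0))) (v, G)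
      (G i, 0) = fderiv ℝ (fun v' => presS P (v'.1, v'.2.1) * lagS Z T v' r (Pi.single i 1) A) v
      (r i, 0, WithLp.toLp 2 fun p => A p i) := by
    intro i
    have hsm : ContDiffOn ℝ ∞ (fun q => fderiv ℝ (lag P Z T) q (0, Pi.single i (0, 1, 0)))
        (posJet n) :=
      (hs.fderiv_of_isOpen isOpen_posJet (by simp)).clm_apply contDiffOn_const
    have hd := ((hsm.differentiableOn (by simp)).differentiableAt
      (isOpen_posJet.mem_nhds (x := (v, G)) hv)).hasFDerivAt
    have hcomp := hd.comp v (hasFDerivAt_prodMk_left (𝕜 := ℝ) v G)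
    have hev : (fun v' => presS P (v'.1, v'.2.1) * lagS Z T v' r (Pi.single i 1) A) =ᶠ[nhds v]
        ((fun q => fderiv ℝ (lag P Z T) q (0, Pi.single i (0, 1, 0))) ∘ fun v' => (v', G)) := by
      filter_upwards [isOpen_posVar.mem_nhds hv] with v' hv'
      have e1 : HasDerivAt (fun t : ℝ => ((v', G) : Jet1 n) + t • (0, Pi.single i (0, 1, 0)))
          (0, Pi.single i (0, 1, 0)) 0 := by
        simpa using ((hasDerivAt_id (0 : ℝ)).smul_const
          ((0, Pi.single i (0, 1, 0)) : Jet1 n)).const_add (v', G)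
      have e2 := HasFDerivAt.comp_hasDerivAt (l := lag P Z T) (0 : ℝ)
        (by simpa using hdL (v', G) hv') e1
      have e3 : (lag P Z T ∘ fun t : ℝ => ((v', G) : Jet1 n) + t • (0, Pi.single i (0, 1, 0))) =
          fun t => lag P Z T (v', gradJet r 0 A) +
            t * (presS P (v'.1, v'.2.1) * lagS Z T v' r (Pi.single i 1) A) := by
        funext t
        have : ((v', G) : Jet1 n) + t • (0, Pi.single i (0, 1, 0)) =
            (v', gradJet r (t • Pi.single i 1) A) := by
          refine Prod.ext (by simp) ?_
          funext j
          by_cases hj : j = i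
          · subst hj
            refine Prod.ext ?_ (Prod.ext ?_ ?_) <;> simp [hG, gradJet]
          · refine Prod.ext ?_ (Prod.ext ?_ ?_) <;> simp [hG, gradJet, hj]
        rw [Function.comp_apply, this, lag_gradJet, lagS_smul]
        ring
      rw [e3] at e2
      have e4 : HasDerivAt (fun t : ℝ => lag P Z T (v', gradJet r 0 A) +
            t * (presS P (v'.1, v'.2.1) * lagS Z T v' r (Pi.single i 1) A))
          (presS P (v'.1, v'.2.1) * lagS Z T v' r (Pi.single i 1) A) 0 := by
        simpa using ((hasDerivAt_id (0 : ℝ)).mul_const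
          (presS P (v'.1, v'.2.1) * lagS Z T v' r (Pi.single i 1) A)).const_add
          (lag P Z T (v', gradJet r 0 A))
      exact e4.unique e2
    rw [hev.fderiv_eq, hcomp.fderiv]
    rfl
  rw [entropyEL, h1, h, sub_eq_zero]
  exact Finset.sum_congr rfl fun i _ => h2 i

/-- The two terms scale alike: in the divergence term the missing factor `s` comes from the state
increment `(rᵢ, 0, ∂ᵢu)`, which is linear in the gradients. -/
lemma entropyEL_smul (hP : SmoothState P) (hZ : IsCurlForm Z) (hT : IsVortFunction T)
    {v : FluidVar n} (hv : 0 < v.1) {r : Fin n → ℝ} {A : Grad n} {s μ : ℝ}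
    (h1 : ∀ v' : FluidVar n, 0 < v'.1 →
      lag P Z T (v', gradJet (s • r) 0 (s • A)) = s * μ * lag P Z T (v', gradJet r 0 A))
    (h2 : ∀ v' : FluidVar n, 0 < v'.1 → ∀ i,
      lagS Z T v' (s • r) (Pi.single i 1) (s • A) = μ * lagS Z T v' r (Pi.single i 1) A) :
    entropyEL P Z T v (s • r) (s • A) = s * μ * entropyEL P Z T v r A := by
  have e1 : (fun v' => lag P Z T (v', gradJet (s • r) 0 (s • A))) =ᶠ[nhds v]
      fun v' => (s * μ) * lag P Z T (v', gradJet r 0 A) := by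
    filter_upwards [isOpen_posVar.mem_nhds hv] with v' hv'
    exact h1 v' hv'
  have e2 : ∀ i, (fun v' => presS P (v'.1, v'.2.1) *
      lagS Z T v' (s • r) (Pi.single i 1) (s • A)) =ᶠ[nhds v]
      fun v' => μ * (presS P (v'.1, v'.2.1) * lagS Z T v' r (Pi.single i 1) A) := by
    intro i
    filter_upwards [isOpen_posVar.mem_nhds hv] with v' hv'
    rw [h2 v' hv' i]; ring
  have d1 := (contDiffOn_lag_state hP hZ hT (gradJet r 0 A)).differentiableAt_state hv
  have d2 := fun i => ((contDiffOn_presS_state hP).mul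
    (contDiffOn_lagS Z hT r (Pi.single i 1) A)).differentiableAt_state hv
  unfold entropyEL
  rw [e1.fderiv_eq, fderiv_const_mul d1, mul_sub, Finset.mul_sum]
  congr 1
  refine Finset.sum_congr rfl fun i _ => ?_
  rw [(e2 i).fderiv_eq, fderiv_const_mul (d2 i), smul_apply, smul_eq_mul, mul_comm s μ, mul_assoc,
    ← smul_eq_mul s, ← map_smul]
  congr 2
  refine Prod.ext ?_ (Prod.ext ?_ ?_)
  · simp
  · simp
  · ext p; simp

lemma lagS_affDens {K : FluidVar n → ℝ} {c : FluidVar n → Y →L[ℝ] ℝ} (hK : IsKinematic K)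
    (hc : ContDiffOn ℝ ∞ c {v | 0 < v.1}) {v : FluidVar n} (hv : 0 < v.1) (r s : Fin n → ℝ)
    (A : Grad n) :
    lagS Z (affDens K c) v r s A = fderiv ℝ K v (0, 0, -v.1⁻¹ • WithLp.toLp 2 s) +
      fderiv ℝ c v (0, 0, -v.1⁻¹ • WithLp.toLp 2 s) (Z A) +
      (v.1 ^ 2)⁻¹ * c v (fderiv ℝ Z A (outer s r)) := by
  rw [lagS, fderiv_affDens hK hc hv, map_smul, smul_eq_mul]

lemma entropyEL_affDens (hP : SmoothState P) (hZ : IsCurlForm Z) {K : FluidVar n → ℝ}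
    {c : FluidVar n → Y →L[ℝ] ℝ} (hK : IsKinematic K)
    (hc : ContDiffOn ℝ ∞ c {v | 0 < v.1}) {v : FluidVar n} (hv : 0 < v.1) (r : Fin n → ℝ)
    (A : Grad n) :
    entropyEL P Z (affDens K c) v r A =
      entropyEL P Z (affDens K 0) v r A + entropyEL P Z (affDens 0 c) v r A := by
  have hK0 : IsKinematic (0 : FluidVar n → ℝ) := contDiffOn_const
  have hc0 : ContDiffOn ℝ ∞ (0 : FluidVar n → Y →L[ℝ] ℝ) {v | 0 < v.1} := contDiffOn_const
  have e1 : (fun v' => lag P Z (affDens K c) (v', gradJet r 0 A)) =ᶠ[nhds v]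
      fun v' => lag P Z (affDens K 0) (v', gradJet r 0 A) +
        lag P Z (affDens 0 c) (v', gradJet r 0 A) := by
    filter_upwards [isOpen_posVar.mem_nhds hv] with v' hv'
    rw [lag_affDens P Z hK hc hv', lag_affDens P Z hK hc0 hv', lag_affDens P Z hK0 hc hv']
    simp only [fderiv_zero, Pi.zero_apply, zero_apply]
    ring
  have e2 : ∀ i, (fun v' => presS P (v'.1, v'.2.1) *
      lagS Z (affDens K c) v' r (Pi.single i 1) A) =ᶠ[nhds v]
      fun v' => presS P (v'.1, v'.2.1) * lagS Z (affDens K 0) v' r (Pi.single i 1) A +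
        presS P (v'.1, v'.2.1) * lagS Z (affDens 0 c) v' r (Pi.single i 1) A := by
    intro i
    filter_upwards [isOpen_posVar.mem_nhds hv] with v' hv'
    rw [lagS_affDens hK hc hv', lagS_affDens hK hc0 hv', lagS_affDens hK0 hc hv']
    simp only [fderiv_zero, Pi.zero_apply, zero_apply]
    ring
  have hT1 := isVortFunction_affDens hK hc0
  have hT2 := isVortFunction_affDens hK0 hc
  have d1 := fun {T : FluidVar n × Y → ℝ} (hT : IsVortFunction T) =>
    (contDiffOn_lag_state hP hZ hT (gradJet r 0 A)).differentiableAt_state hv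
  have d2 := fun {T : FluidVar n × Y → ℝ} (hT : IsVortFunction T) i =>
    ((contDiffOn_presS_state hP).mul
    (contDiffOn_lagS Z hT r (Pi.single i 1) A)).differentiableAt_state hv
  unfold entropyEL
  rw [e1.fderiv_eq, fderiv_fun_add (d1 hT1) (d1 hT2), add_apply, sub_add_sub_comm,
    ← Finset.sum_add_distrib]
  congr 1
  refine Finset.sum_congr rfl fun i _ => ?_
  rw [(e2 i).fderiv_eq, fderiv_fun_add (d2 hT1 i) (d2 hT2 i), add_apply]

end EntropyEL

end FluidFlow

end

noncomputable section

namespace FluidFlow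

/-! ### Homogeneity -/

section Homogeneity

variable {n r k m : ℕ}

lemma curlPow_smul (h : r + 2 * k = n) (c : Fin r → Fin n → ℝ) (s : ℝ) (A : Grad n) :
    curlPow h c (s • A) = s ^ k * curlPow h c A := by
  unfold curlPow
  have := (altForm h c).map_smul_univ (fun _ => s) (fun _ => A)
  simpa using this

lemma curlPow_eq_sum (h : 1 + 2 * k = n) (x : Fin n → ℝ) (A : Grad n) :
    curlPow h (fun _ => x) A = ∑ j, x j * curlPow h (fun _ => Pi.single j 1) A := by
  simp only [curlPow, altForm_apply, Finset.mul_sum]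
  rw [Finset.sum_comm]
  refine Finset.sum_congr rfl fun σ _ => ?_
  simp only [altTerm, Finset.univ_unique, Finset.prod_singleton, Fin.default_eq_zero]
  rw [Finset.sum_eq_single (σ (slotC h 0))]
  · simp; ring
  · intro j _ hj
    simp [hj.symm]
  · simp

lemma vortOdd_smul (s : ℝ) (A : Grad (2 * m + 1)) : vortOdd m (s • A) = s ^ m • vortOdd m A := by
  ext i
  exact curlPow_smul _ _ s A

/-- Homogeneity of degree `m - 1` of the derivative, with a factor `s` moved to the left so that no
subtraction of exponents occurs. -/
lemma fderiv_vortOdd_smul (s : ℝ) (A X : Grad (2 * m + 1)) :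
    s • fderiv ℝ (vortOdd m) (s • A) X = s ^ m • fderiv ℝ (vortOdd m) A X := by
  have hd := (isCurlForm_vortOdd m).differentiable
  have h1 : HasFDerivAt (fun B => vortOdd m (s • B))
      ((fderiv ℝ (vortOdd m) (s • A)).comp (s • ContinuousLinearMap.id ℝ _)) A :=
    HasFDerivAt.comp (g := vortOdd m) A (hd (s • A)).hasFDerivAt
      ((hasFDerivAt_id A).fun_const_smul s)
  have h2 : HasFDerivAt (fun B => vortOdd m (s • B)) (s ^ m • fderiv ℝ (vortOdd m) A) A := by
    simp only [vortOdd_smul]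
    exact (hd A).hasFDerivAt.fun_const_smul (s ^ m)
  have h3 := congrArg (fun L : Grad (2 * m + 1) →L[ℝ] Space (2 * m + 1) => L X) (h1.unique h2)
  simpa using h3

/-- The transport of the vorticity vector by the velocity gradient. -/
lemma trace_smul_vortOdd_sub (A : Grad (2 * m + 1)) :
    (∑ i, A i i) • vortOdd m A - fderiv ℝ (vortOdd m) A (fun i j => ∑ p, A i p * A p j) =
      WithLp.toLp 2 fun i => ∑ j, A i j * vortOdd m A j := by
  ext i
  rw [PiLp.sub_apply, fderiv_vortOdd_apply, fderiv_curlPow_sq]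
  have h1 : Function.update (fun _ : Fin 1 => (Pi.single i 1 : Fin (2 * m + 1) → ℝ)) 0
      (fun j => ∑ p, (Pi.single i 1 : Fin (2 * m + 1) → ℝ) p * A p j) = fun _ => A i := by
    funext a
    rw [Subsingleton.elim a 0, Function.update_self]
    funext j
    simp [Pi.single_apply]
  simp only [Finset.univ_unique, Finset.sum_singleton, Fin.default_eq_zero, h1]
  rw [curlPow_eq_sum _ (A i)]
  simp [vortOdd]

end Homogeneity

/-! ### The coefficient is constant in odd dimension -/

section OddFinal

variable {m : ℕ} {P : ℝ → ℝ → ℝ}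

/-- Doubling all gradients multiplies the kinematic part by `2` and the vorticity part by `2^(m+1)`.
Their sum vanishes at both scales, and the factors differ since `m ≥ 1`, so the vorticity part
vanishes by itself. -/
lemma entropyEL_oddCoeff_eq_zero (hm : 1 ≤ m) (hP : SmoothState P)
    {K : FluidVar (2 * m + 1) → ℝ} {c : FluidVar (2 * m + 1) → Space (2 * m + 1) →L[ℝ] ℝ}
    (hK : IsKinematic K) (hc : ContDiffOn ℝ ∞ c {v | 0 < v.1})
    (hL : IsDivergence (lag P (vortOdd m) (affDens K c)))
    {v : FluidVar (2 * m + 1)} (hv : 0 < v.1) (r : Fin (2 * m + 1) → ℝ) (A : Grad (2 * m + 1)) :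
    entropyEL P (vortOdd m) (affDens 0 c) v r A = 0 := by
  have hZ := isCurlForm_vortOdd m
  have hK0 : IsKinematic (0 : FluidVar (2 * m + 1) → ℝ) := contDiffOn_const
  have hc0 : ContDiffOn ℝ ∞ (0 : FluidVar (2 * m + 1) → Space (2 * m + 1) →L[ℝ] ℝ) {v | 0 < v.1} :=
    contDiffOn_const
  have h0 : ∀ r A, entropyEL P (vortOdd m) (affDens K 0) v r A +
      entropyEL P (vortOdd m) (affDens 0 c) v r A = 0 := fun r A => by
    rw [← entropyEL_affDens hP hZ hK hc hv,
      entropyEL_eq_zero hP hZ (isVortFunction_affDens hK hc) hL hv]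
  have hmv : ∀ v' : FluidVar (2 * m + 1), materialVar P v' (gradJet ((2 : ℝ) • r) 0 ((2 : ℝ) • A)) =
      (2 : ℝ) • materialVar P v' (gradJet r 0 A) := by
    intro v'
    refine Prod.ext ?_ (Prod.ext ?_ ?_)
    · simp [materialVar, ← Finset.mul_sum]; ring
    · simp [materialVar]
    · ext i; simp [materialVar, gradJet]; ring
  have hdiv : velDiv (gradJet ((2 : ℝ) • r) 0 ((2 : ℝ) • A)) = 2 * velDiv (gradJet r 0 A) := by
    simp [← Finset.mul_sum]
  have hmg : ∀ v' : FluidVar (2 * m + 1), materialGrad P v' (gradJet ((2 : ℝ) • r) 0 ((2 : ℝ) • A)) =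
      (2 : ℝ) • (2 : ℝ) • materialGrad P v' (gradJet r 0 A) := by
    intro v'
    ext i j
    simp [materialGrad, gradJet, Finset.mul_sum]
    exact Finset.sum_congr rfl fun p _ => by ring
  have hKs : entropyEL P (vortOdd m) (affDens K 0) v ((2 : ℝ) • r) ((2 : ℝ) • A) =
      2 * 1 * entropyEL P (vortOdd m) (affDens K 0) v r A := by
    refine entropyEL_smul hP hZ (isVortFunction_affDens hK hc0) hv (fun v' hv' => ?_)
      fun v' hv' i => ?_
    · rw [lag_affDens P _ hK hc0 hv', lag_affDens P _ hK hc0 hv', hmv, hdiv]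
      simp only [Pi.zero_apply, zero_apply, fderiv_zero, map_smul, smul_zero, smul_eq_mul]
      ring
    · rw [lagS_affDens hK hc0 hv', lagS_affDens hK hc0 hv']
      simp only [Pi.zero_apply, zero_apply, fderiv_zero]
      ring
  have hcs : entropyEL P (vortOdd m) (affDens 0 c) v ((2 : ℝ) • r) ((2 : ℝ) • A) =
      2 * 2 ^ m * entropyEL P (vortOdd m) (affDens 0 c) v r A := by
    have hd : ∀ X, fderiv ℝ (vortOdd m) ((2 : ℝ) • A) ((2 : ℝ) • X) =
        (2 : ℝ) ^ m • fderiv ℝ (vortOdd m) A X := fun X => by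
      rw [map_smul, fderiv_vortOdd_smul]
    refine entropyEL_smul hP hZ (isVortFunction_affDens hK0 hc) hv (fun v' hv' => ?_)
      fun v' hv' i => ?_
    · rw [lag_affDens P _ hK0 hc hv', lag_affDens P _ hK0 hc hv', hmv, hdiv, hmg]
      simp only [velGrad_gradJet, vortOdd_smul, hd, map_smul, smul_apply, smul_eq_mul,
        Pi.zero_apply, zero_apply, fderiv_zero]
      ring
    · rw [lagS_affDens hK0 hc hv', lagS_affDens hK0 hc hv', outer_smul_right, hd, vortOdd_smul]
      simp only [map_smul, smul_eq_mul, fderiv_zero, zero_apply, Pi.zero_apply]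
      ring
  have e1 := h0 r A
  have e2 := h0 ((2 : ℝ) • r) ((2 : ℝ) • A)
  rw [hKs, hcs] at e2
  have h2 : (2 : ℝ) ≤ 2 ^ m := by
    calc (2 : ℝ) = 2 ^ 1 := (pow_one 2).symm
      _ ≤ 2 ^ m := pow_le_pow_right₀ (by norm_num) hm
  have e3 : (2 * 2 ^ m - 2) * entropyEL P (vortOdd m) (affDens 0 c) v r A = 0 := by
    linear_combination e2 - 2 * e1
  exact (mul_eq_zero.1 e3).resolve_left (by linarith)

lemma fderiv_eq_of_line {E : Type*} [NormedAddCommGroup E] [NormedSpace ℝ E] {F : E → ℝ} {v d : E}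
    {x : ℝ} (hF : DifferentiableAt ℝ F v) (h : HasDerivAt (fun t : ℝ => F (v + t • d)) x 0) :
    fderiv ℝ F v d = x := by
  have h1 : HasDerivAt (fun t : ℝ => v + t • d) d 0 := by
    simpa using ((hasDerivAt_id (0 : ℝ)).smul_const d).const_add v
  have h2 := HasFDerivAt.comp_hasDerivAt (l := F) (0 : ℝ) (by simpa using hF.hasFDerivAt) h1
  exact h2.unique h

lemma SmoothState.presRho_presS_comm (hP : SmoothState P) {q : ℝ × ℝ} (hq : 0 < q.1) :
    fderiv ℝ (presRho P) q (0, 1) = fderiv ℝ (presS P) q (1, 0) := by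
  have hs : IsSymmSndFDerivAt ℝ (fun q : ℝ × ℝ => P q.1 q.2) q :=
    (hP.contDiffAt (isOpen_posState.mem_nhds hq)).isSymmSndFDerivAt
      (by rw [minSmoothness_of_isRCLikeNormedField]; exact ENat.LEInfty.out)
  have hd : DifferentiableAt ℝ (fderiv ℝ fun q : ℝ × ℝ => P q.1 q.2) q :=
    ((hP.fderiv_of_isOpen (m := ∞) isOpen_posState (by simp)).differentiableOn
      (by simp)).differentiableAt (isOpen_posState.mem_nhds hq)
  have e : ∀ d d' : ℝ × ℝ, fderiv ℝ (fun q' => fderiv ℝ (fun q : ℝ × ℝ => P q.1 q.2) q' d) q d' =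
      fderiv ℝ (fderiv ℝ fun q : ℝ × ℝ => P q.1 q.2) q d' d := by
    intro d d'
    rw [fderiv_clm_apply hd (differentiableAt_const d)]
    simp
  have e1 := e (1, 0) (0, 1)
  have e2 := e (0, 1) (1, 0)
  exact e1.trans ((hs.eq _ _).trans e2.symm)

lemma fderiv_affineCoeff {n : ℕ} {γ : ℝ → Space n →L[ℝ] ℝ} {l : ℝ → ℝ}
    (hγ : ContDiff ℝ ∞ γ) (hl : ContDiff ℝ ∞ l) (v : FluidVar n) (a : ℝ) (b y : Space n) :
    fderiv ℝ (affineCoeff γ l) v (a, 0, b) y = l v.2.1 * inner ℝ b y := by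
  have hc := contDiff_affineCoeff (n := n) hγ hl
  have hd : DifferentiableAt ℝ (fun p => affineCoeff γ l p y) v :=
    ((hc.clm_apply contDiff_const).differentiable (by simp)) v
  have h1 : fderiv ℝ (fun p => affineCoeff γ l p y) v (a, 0, b) = l v.2.1 * inner ℝ b y := by
    refine fderiv_eq_of_line hd ?_
    have e : (fun t : ℝ => affineCoeff γ l (v + t • (a, 0, b)) y) = fun t =>
        (γ v.2.1 y + l v.2.1 * inner ℝ v.2.2 y) + t * (l v.2.1 * inner ℝ b y) := by
      funext t
      rw [affineCoeff_apply]
      simp only [Prod.snd_add, Prod.fst_add, Prod.smul_snd, Prod.smul_fst, smul_zero, add_zero,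
        inner_add_left, real_inner_smul_left]
      ring
    rw [e]
    simpa using ((hasDerivAt_id (0 : ℝ)).mul_const (l v.2.1 * inner ℝ b y)).const_add
      (γ v.2.1 y + l v.2.1 * inner ℝ v.2.2 y)
  rw [← h1, fderiv_clm_apply (hc.differentiable (by simp) v) (differentiableAt_const y)]
  simp

/-- Explicit enough to be evaluated on test gradients: the choice `r = 0` isolates `γ'` and `l'`,
and once these vanish only the terms with `P_S l` are left. By `trace_smul_vortOdd_sub`, dilation
and stretching combine into `A ϖ`. -/
lemma entropyEL_affineCoeff (hP : SmoothState P) {γ : ℝ → Space (2 * m + 1) →L[ℝ] ℝ} {l : ℝ → ℝ}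
    (hγ : ContDiff ℝ ∞ γ) (hl : ContDiff ℝ ∞ l) {v : FluidVar (2 * m + 1)} (hv : 0 < v.1)
    (r : Fin (2 * m + 1) → ℝ) (A : Grad (2 * m + 1)) :
    entropyEL P (vortOdd m) (affDens 0 (affineCoeff γ l)) v r A =
      (deriv γ v.2.1 (WithLp.toLp 2 fun i => ∑ j, A i j * vortOdd m A j) + deriv l v.2.1 *
        inner ℝ v.2.2 (WithLp.toLp 2 fun i => ∑ j, A i j * vortOdd m A j)) -
      deriv l v.2.1 * presRho P (v.1, v.2.1) * v.1⁻¹ * inner ℝ (WithLp.toLp 2 r) (vortOdd m A) -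
      (v.1 ^ 2)⁻¹ * presS P (v.1, v.2.1) * l v.2.1 * (inner ℝ (WithLp.toLp 2 r) (vortOdd m A) +
        ∑ i, inner ℝ (WithLp.toLp 2 fun p => A p i)
          (fderiv ℝ (vortOdd m) A (outer (Pi.single i 1) r))) := by
  have hZ := isCurlForm_vortOdd m
  have hK0 : IsKinematic (0 : FluidVar (2 * m + 1) → ℝ) := contDiffOn_const
  have hc := (contDiff_affineCoeff (n := 2 * m + 1) hγ hl).contDiffOn (s := {v | 0 < v.1})
  have hT := isVortFunction_affDens hK0 hc
  set Q : Space (2 * m + 1) := WithLp.toLp 2 fun i => ∑ j, A i j * vortOdd m A j with hQ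
  set z := vortOdd m A with hz
  set R : Space (2 * m + 1) := WithLp.toLp 2 r with hR
  have hq : (0 : ℝ) < (v.1, v.2.1).1 := hv
  have dρ : DifferentiableAt ℝ (presRho P) (v.1, v.2.1) :=
    (hP.contDiffOn_presRho.differentiableOn (by simp)).differentiableAt
      (isOpen_posState.mem_nhds hq)
  have dS : DifferentiableAt ℝ (presS P) (v.1, v.2.1) :=
    (hP.contDiffOn_presS.differentiableOn (by simp)).differentiableAt
      (isOpen_posState.mem_nhds hq)
  -- The mixed derivative `P_{ρS}` appears in the entropy derivative of `lag` and in the divergence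
  -- term, and cancels between them.
  set κ := fderiv ℝ (presS P) (v.1, v.2.1) (1, 0) with hκ
  have hlag : ∀ v' : FluidVar (2 * m + 1), 0 < v'.1 →
      lag P (vortOdd m) (affDens 0 (affineCoeff γ l)) (v', gradJet r 0 A) =
        (γ v'.2.1 Q + l v'.2.1 * inner ℝ v'.2.2 Q) -
          l v'.2.1 * presRho P (v'.1, v'.2.1) * v'.1⁻¹ * inner ℝ R z := by
    intro v' hv'
    have hmv : materialVar P v' (gradJet r 0 A) = (-(v'.1 * ∑ i, A i i), 0,
        (-(v'.1⁻¹ * presRho P (v'.1, v'.2.1))) • R) := by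
      refine Prod.ext rfl (Prod.ext rfl ?_)
      ext i; simp [materialVar, gradJet, hR, mul_assoc]
    have hmg : materialGrad P v' (gradJet r 0 A) = - fun i j => ∑ p, A i p * A p j := by
      ext i j; simp [materialGrad, gradJet]
    rw [lag_affDens P _ hK0 hc hv', hmv, hmg, fderiv_affineCoeff hγ hl, hQ,
      ← trace_smul_vortOdd_sub, ← affineCoeff_apply]
    simp only [velGrad_gradJet, velDiv_gradJet, Pi.zero_apply, zero_apply, fderiv_zero, map_sub,
      map_smul, map_neg, smul_eq_mul, real_inner_smul_left, ← hz]
    ring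
  have hlagS : ∀ v' : FluidVar (2 * m + 1), 0 < v'.1 → ∀ i,
      lagS (vortOdd m) (affDens 0 (affineCoeff γ l)) v' r (Pi.single i 1) A =
        -(v'.1⁻¹ * l v'.2.1 * z i) + (v'.1 ^ 2)⁻¹ *
          (γ v'.2.1 (fderiv ℝ (vortOdd m) A (outer (Pi.single i 1) r)) + l v'.2.1 * inner ℝ v'.2.2
            (fderiv ℝ (vortOdd m) A (outer (Pi.single i 1) r))) := by
    intro v' hv' i
    rw [lagS_affDens hK0 hc hv', fderiv_affineCoeff hγ hl, affineCoeff_apply]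
    have : (inner ℝ (WithLp.toLp 2 (Pi.single i 1)) (vortOdd m A) : ℝ) = z i := by
      simp [PiLp.inner_apply, hz]
    simp only [real_inner_smul_left, this, fderiv_zero, zero_apply, Pi.zero_apply]
    ring
  have hγd : HasDerivAt (fun t : ℝ => γ (v.2.1 + t)) (deriv γ v.2.1) 0 := by
    have := (hγ.differentiable (by simp) (v.2.1 + 0)).hasDerivAt.comp_const_add v.2.1 (0 : ℝ)
    simpa using this
  have hld : HasDerivAt (fun t : ℝ => l (v.2.1 + t)) (deriv l v.2.1) 0 := by
    have := (hl.differentiable (by simp) (v.2.1 + 0)).hasDerivAt.comp_const_add v.2.1 (0 : ℝ)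
    simpa using this
  have h1 : fderiv ℝ (fun v' => lag P (vortOdd m) (affDens 0 (affineCoeff γ l))
      (v', gradJet r 0 A)) v (0, 1, 0) = (deriv γ v.2.1 Q + deriv l v.2.1 * inner ℝ v.2.2 Q) -
        (deriv l v.2.1 * presRho P (v.1, v.2.1) + l v.2.1 * κ) * v.1⁻¹ * inner ℝ R z := by
    refine fderiv_eq_of_line ((contDiffOn_lag_state hP hZ hT _).differentiableAt_state hv) ?_
    have e : (fun t : ℝ => lag P (vortOdd m) (affDens 0 (affineCoeff γ l))
        (v + t • (0, 1, 0), gradJet r 0 A)) = fun t =>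
        (γ (v.2.1 + t) Q + l (v.2.1 + t) * inner ℝ v.2.2 Q) -
          l (v.2.1 + t) * presRho P (v.1, v.2.1 + t) * v.1⁻¹ * inner ℝ R z := by
      funext t
      rw [hlag _ (by simpa using hv)]
      simp
    rw [e]
    have hpd : HasDerivAt (fun t : ℝ => presRho P (v.1, v.2.1 + t)) κ 0 := by
      have e1 : HasDerivAt (fun t : ℝ => (v.1, v.2.1 + t)) ((0, 1) : ℝ × ℝ) 0 :=
        (hasDerivAt_const _ _).prodMk (by simpa using (hasDerivAt_id (0 : ℝ)).const_add v.2.1)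
      have := HasFDerivAt.comp_hasDerivAt (l := presRho P) (0 : ℝ)
        (by simpa using dρ.hasFDerivAt) e1
      rwa [hP.presRho_presS_comm hq] at this
    have hγQ : HasDerivAt (fun t : ℝ => γ (v.2.1 + t) Q) (deriv γ v.2.1 Q) 0 :=
      (ContinuousLinearMap.apply ℝ ℝ Q).hasFDerivAt.comp_hasDerivAt (0 : ℝ) hγd
    have := (hγQ.fun_add (hld.mul_const (inner ℝ v.2.2 Q))).fun_sub
      (((hld.fun_mul hpd).mul_const v.1⁻¹).mul_const (inner ℝ R z))
    simpa using this
  have h2 : ∀ i, fderiv ℝ (fun v' => presS P (v'.1, v'.2.1) *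
      lagS (vortOdd m) (affDens 0 (affineCoeff γ l)) v' r (Pi.single i 1) A) v
      (r i, 0, WithLp.toLp 2 fun p => A p i) =
      -(κ * l v.2.1 * v.1⁻¹) * (r i * z i) + presS P (v.1, v.2.1) * l v.2.1 * (v.1 ^ 2)⁻¹ *
        (r i * z i) + (κ * (v.1 ^ 2)⁻¹ - presS P (v.1, v.2.1) * (2 * (v.1 ^ 3)⁻¹)) *
        (r i * affineCoeff γ l v (fderiv ℝ (vortOdd m) A (outer (Pi.single i 1) r))) +
      presS P (v.1, v.2.1) * (v.1 ^ 2)⁻¹ * l v.2.1 * inner ℝ (WithLp.toLp 2 fun p => A p i)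
          (fderiv ℝ (vortOdd m) A (outer (Pi.single i 1) r)) := by
    intro i
    set W := fderiv ℝ (vortOdd m) A (outer (Pi.single i 1) r)
    set Ai : Space (2 * m + 1) := WithLp.toLp 2 fun p => A p i
    refine fderiv_eq_of_line (((contDiffOn_presS_state hP).mul
      (contDiffOn_lagS _ hT r (Pi.single i 1) A)).differentiableAt_state hv) ?_
    have e : (fun t : ℝ => presS P ((v + t • (r i, 0, Ai)).1, (v + t • (r i, 0, Ai)).2.1) *
        lagS (vortOdd m) (affDens 0 (affineCoeff γ l)) (v + t • (r i, 0, Ai)) r (Pi.single i 1) A)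
        =ᶠ[nhds 0] fun t => presS P (v.1 + t * r i, v.2.1) *
          (-((v.1 + t * r i)⁻¹ * l v.2.1 * z i) + ((v.1 + t * r i) ^ 2)⁻¹ *
            (affineCoeff γ l v W + t * (l v.2.1 * inner ℝ Ai W))) := by
      have hcont : Continuous fun t : ℝ => v.1 + t * r i := by fun_prop
      have : ∀ᶠ t : ℝ in nhds 0, 0 < v.1 + t * r i :=
        hcont.continuousAt.eventually (isOpen_Ioi.mem_nhds (by simpa using hv))
      filter_upwards [this] with t ht
      rw [hlagS _ (by simpa using ht), affineCoeff_apply]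
      simp only [Prod.fst_add, Prod.smul_fst, Prod.snd_add, Prod.smul_snd, smul_eq_mul, mul_zero,
        add_zero, inner_add_left, real_inner_smul_left]
      ring
    refine HasDerivAt.congr_of_eventuallyEq ?_ e
    have hx : HasDerivAt (fun t : ℝ => v.1 + t * r i) (r i) 0 := by
      simpa using ((hasDerivAt_id (0 : ℝ)).mul_const (r i)).const_add v.1
    have hpd : HasDerivAt (fun t : ℝ => presS P (v.1 + t * r i, v.2.1)) (r i * κ) 0 := by
      have e1 : HasDerivAt (fun t : ℝ => (v.1 + t * r i, v.2.1)) ((r i, 0) : ℝ × ℝ) 0 :=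
        hx.prodMk (hasDerivAt_const _ _)
      have := HasFDerivAt.comp_hasDerivAt (l := presS P) (0 : ℝ)
        (by simpa using dS.hasFDerivAt) e1
      have e2 : ((r i, 0) : ℝ × ℝ) = r i • (1, 0) := by simp
      rwa [e2, map_smul, smul_eq_mul] at this
    have hne : v.1 ≠ 0 := hv.ne'
    have hi := hx.fun_inv (by simpa using hne)
    have hi2 := (hx.fun_pow 2).fun_inv (by simpa using hne)
    have hlin : HasDerivAt (fun t : ℝ => affineCoeff γ l v W + t * (l v.2.1 * inner ℝ Ai W))
        (l v.2.1 * inner ℝ Ai W) 0 := by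
      simpa using ((hasDerivAt_id (0 : ℝ)).mul_const (l v.2.1 * inner ℝ Ai W)).const_add
        (affineCoeff γ l v W)
    have := hpd.fun_mul ((((hi.mul_const (l v.2.1)).mul_const (z i)).fun_neg).fun_add
      (hi2.fun_mul hlin))
    refine this.congr_deriv ?_
    simp only [zero_mul, add_zero]
    field_simp
    ring
  -- The sum assembles the symmetric form `r ⊗ r`, on which the derivative of a curl form vanishes.
  have hsum : ∑ i, r i * affineCoeff γ l v (fderiv ℝ (vortOdd m) A (outer (Pi.single i 1) r)) = 0 := by
    have : outer r r = ∑ i, r i • outer (Pi.single i 1) r := by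
      ext p q
      simp [Finset.sum_apply, Pi.single_apply]
    have h3 := hZ.fderiv_symm A (outer r r) fun i j => by simp [mul_comm]
    rw [this, map_sum] at h3
    have h4 := congrArg (affineCoeff γ l v) h3
    simpa only [map_sum, map_smul, smul_eq_mul, map_zero] using h4
  have hin : (inner ℝ R z : ℝ) = ∑ i, r i * z i := by
    simp [PiLp.inner_apply, hR, mul_comm]
  unfold entropyEL
  rw [h1, Finset.sum_congr rfl fun i _ => h2 i]
  simp only [Finset.sum_add_distrib, ← Finset.mul_sum, hsum, ← hin]
  ring

/-- The gradient of a flow with vorticity along a coordinate axis. -/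
def axialGrad (m : ℕ) : Grad (2 * m + 1) :=
  ∑ l, outer (Pi.single (slotL (odd_dim m) l) 1) (Pi.single (slotR (odd_dim m) l) 1)

lemma axialGrad_axis (i : Fin (2 * m + 1)) : axialGrad m i (slotC (odd_dim m) 0) = 0 := by
  simp only [axialGrad, Finset.sum_apply, outer_apply]
  refine Finset.sum_eq_zero fun l _ => ?_
  rw [Pi.single_eq_of_ne (slotC_ne_slotR _ _ _), mul_zero]

/-- Needed for the last sum in `entropyEL_affineCoeff` with `r` along the axis. Transposing the
direction gives one sign and the permutation exchanging the axis with `slotL` the other, so the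
total is positive and the contributions of the `m` planes cannot cancel. -/
lemma fderiv_vortOdd_axialGrad (l : Fin m) :
    fderiv ℝ (vortOdd m) (axialGrad m) (outer (Pi.single (slotR (odd_dim m) l) 1)
      (Pi.single (slotC (odd_dim m) 0) 1)) =
      (m.factorial : ℝ) • basisVec (slotL (odd_dim m) l) := by
  have hZ := isCurlForm_vortOdd m
  set σ := Equiv.swap (slotC (odd_dim m) 0) (slotL (odd_dim m) l) with hσ
  have hA : axialGrad m = partialSum (odd_dim m) (σ.permMatrix ℝ) l +
      outer (Pi.single (slotL (odd_dim m) l) 1) (Pi.single (slotR (odd_dim m) l) 1) := by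
    rw [axialGrad, partialSum, ← Finset.sum_erase_add _ _ (Finset.mem_univ l)]
    congr 1
    refine Finset.sum_congr rfl fun l' hl' => ?_
    have hl := Finset.ne_of_mem_erase hl'
    rw [permMatrix_row, permMatrix_row, hσ,
      Equiv.swap_apply_of_ne_of_ne (slotC_ne_slotL _ _ _).symm (by simpa using hl),
      Equiv.swap_apply_of_ne_of_ne (slotC_ne_slotR _ _ _).symm (by simp)]
  have h := fderiv_vortOdd_perm σ l
  rw [hσ, Equiv.swap_apply_right, Equiv.swap_apply_left,
    Equiv.swap_apply_of_ne_of_ne (slotC_ne_slotR _ _ _).symm (by simp),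
    Equiv.Perm.sign_swap (slotC_ne_slotL _ _ _), ← hσ] at h
  rw [hZ.fderiv_swap, hA, hZ.outer, h]
  simp

/-- Conserved densities in odd dimension. -/
lemma odd_classification (hm : 1 ≤ m) (hP : IsNonIsentropic P)
    {T : FluidVar (2 * m + 1) × Space (2 * m + 1) → ℝ} (hT : IsVortFunction T)
    (hcons : IsConservedDensity P (oddVortDensity T)) :
    ∃ (K : FluidVar (2 * m + 1) → ℝ) (c : Space (2 * m + 1) →L[ℝ] ℝ), IsKinematic K ∧
      ∀ (v : FluidVar (2 * m + 1)) (y : Space (2 * m + 1)), 0 < v.1 → T (v, y) = K v + c y := by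
  rw [oddVortDensity_eq] at hcons
  have hZ := isCurlForm_vortOdd m
  have hPs := hP.smoothState
  have hfac : (m.factorial : ℝ) ≠ 0 := by exact_mod_cast m.factorial_ne_zero
  have hL := isDivergence_lag hPs hZ hT hcons
  have hK := isKinematic_affConst hT
  have haff := fun v y (hv : 0 < v.1) => affine_vortOdd hm hP hT hL v hv y
  obtain ⟨γ, l, hγ, hl, hcoef⟩ := exists_affineCoeff hm hP hK (contDiffOn_affCoeff hT)
    (hL.lag_congr haff)
  have hform : ∀ v y, 0 < v.1 → T (v, y) = affDens (affConst T) (affineCoeff γ l) (v, y) :=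
    fun v y hv => by rw [haff v y hv]; simp only [affDens, hcoef v hv]
  have hc := (contDiff_affineCoeff (n := 2 * m + 1) hγ hl).contDiffOn (s := {v | 0 < v.1})
  have hEL : ∀ {v : FluidVar (2 * m + 1)}, 0 < v.1 → ∀ r A,
      entropyEL P (vortOdd m) (affDens 0 (affineCoeff γ l)) v r A = 0 := fun hv r A =>
    entropyEL_oddCoeff_eq_zero hm hPs hK hc (hL.lag_congr hform) hv r A
  set z := slotC (odd_dim m) 0 with hz
  have hax : ∀ p, axialGrad m p z = 0 := axialGrad_axis
  have hS : ∀ (s : ℝ) (u : Space (2 * m + 1)) (i : Fin (2 * m + 1)),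
      deriv γ s (basisVec i) + deriv l s * u i = 0 := by
    intro s u i
    -- Being symmetric, `X` leaves the vorticity on the axis `z`, but it makes the velocity gradient
    -- map the axis to `eᵢ`.
    set X : Grad (2 * m + 1) :=
      outer (Pi.single z 1) (Pi.single i 1) + outer (Pi.single i 1) (Pi.single z 1) with hX
    have hZX : vortOdd m (axialGrad m + X) = (m.factorial : ℝ) • basisVec z := by
      rw [hZ.add_symm _ _ fun p q => by simp [hX]; ring]
      exact vortOdd_sum_outer
    have h := hEL (v := (1, s, u)) (by simp) 0 (axialGrad m + X)
    rw [entropyEL_affineCoeff hPs hγ hl (by simp)] at h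
    have e0 : ∀ p : Fin (2 * m + 1), outer (Pi.single p 1) (0 : Fin (2 * m + 1) → ℝ) = 0 := by
      intro p; ext a b; simp
    -- For `i = z` the two summands of `X` coincide, which accounts for the factor `2`.
    have eQ : (WithLp.toLp 2 fun p => ∑ j, (axialGrad m + X) p j * vortOdd m (axialGrad m + X) j) =
        ((m.factorial : ℝ) * (if i = z then 2 else 1)) • basisVec i := by
      ext p
      simp only [hZX]
      rw [Finset.sum_eq_single z]
      · by_cases hi : i = z
        · by_cases hp : p = z
          · simp [hax, hX, hi, hp]; ring
          · simp [hax, hX, hi, hp]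
        · by_cases hp : p = i
          · simp [hax, hX, hi, hp, Ne.symm hi]
          · simp [hax, hX, hi, hp, Ne.symm hi]
      · intro j _ hj
        simp [hj]
      · simp
    rw [eQ] at h
    have hcoe : (m.factorial : ℝ) * (if i = z then 2 else 1) ≠ 0 := by
      refine mul_ne_zero hfac ?_
      split_ifs <;> norm_num
    simp only [e0, map_zero, inner_zero_right, Finset.sum_const_zero, map_smul, smul_eq_mul,
      inner_smul_right, WithLp.toLp_zero, inner_zero_left, mul_zero, add_zero, sub_zero] at h
    have hu : (inner ℝ u (basisVec i) : ℝ) = u i := by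
      rw [EuclideanSpace.inner_single_right]; simp
    rw [hu] at h
    refine (mul_eq_zero.1 (?_ : ((m.factorial : ℝ) * (if i = z then 2 else 1)) * _ = 0)).resolve_left
      hcoe
    linear_combination h
  have hγ0 : ∀ s, deriv γ s = 0 := by
    intro s
    ext y
    rw [space_eq_sum y, map_sum, zero_apply]
    refine Finset.sum_eq_zero fun i _ => ?_
    have := hS s 0 i
    simp at this
    rw [map_smul, this, smul_zero]
  have hl0 : ∀ s, deriv l s = 0 := by
    intro s
    have := hS s (basisVec z) z
    simpa [hγ0] using this
  have hlz : ∀ s, l s = 0 := by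
    intro s
    refine hP.eq_zero (n := 2 * m + 1) (F := fun v => l v.2.1) ?_ (fun v hv hPS => ?_) (1, s, 0)
      (by simp)
    · exact (hl.continuous.comp (by fun_prop)).continuousOn
    -- With `γ' = l' = 0` and `∇ρ` along the axis the identity becomes `ρ⁻² P_S l (m! + m·m!) = 0`,
    -- where the second term collects one `m!` from each coordinate plane.
    · have h := hEL hv (Pi.single z 1) (axialGrad m)
      rw [entropyEL_affineCoeff hPs hγ hl hv, hγ0, hl0] at h
      have hZ0 : vortOdd m (axialGrad m) = (m.factorial : ℝ) • basisVec z := vortOdd_sum_outer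
      have e1 : (inner ℝ (WithLp.toLp 2 (Pi.single z 1)) (vortOdd m (axialGrad m)) : ℝ) =
          m.factorial := by
        rw [hZ0]; simp [PiLp.inner_apply]
      have e2 : ∑ i, (inner ℝ (WithLp.toLp 2 fun p => axialGrad m p i)
          (fderiv ℝ (vortOdd m) (axialGrad m) (outer (Pi.single i 1) (Pi.single z 1))) : ℝ) =
          m * m.factorial := by
        have hAi : ∀ i, (WithLp.toLp 2 fun p => axialGrad m p i : Space (2 * m + 1)) =
            ∑ l, (if i = slotR (odd_dim m) l then (1 : ℝ) else 0) •
              basisVec (slotL (odd_dim m) l) := by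
          intro i
          ext p
          simp only [axialGrad, WithLp.ofLp_sum, Finset.sum_apply, outer_apply]
          refine Finset.sum_congr rfl fun l' _ => ?_
          by_cases hi : i = slotR (odd_dim m) l' <;> simp [hi, Pi.single_apply]
        simp only [hAi, sum_inner]
        rw [Finset.sum_comm]
        have hl' : ∀ l' : Fin m, ∑ i, (inner ℝ ((if i = slotR (odd_dim m) l' then (1 : ℝ) else 0) •
            basisVec (slotL (odd_dim m) l')) (fderiv ℝ (vortOdd m) (axialGrad m)
              (outer (Pi.single i 1) (Pi.single z 1))) : ℝ) = m.factorial := by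
          intro l'
          rw [Finset.sum_eq_single (slotR (odd_dim m) l'), if_pos rfl, one_smul,
            fderiv_vortOdd_axialGrad, inner_smul_right, EuclideanSpace.inner_single_left]
          · simp
          · intro j _ hj
            rw [if_neg hj, zero_smul, inner_zero_left]
          · simp
        rw [Finset.sum_congr rfl fun l' _ => hl' l']
        simp
      rw [e1, e2] at h
      simp only [zero_apply, zero_mul, add_zero, sub_zero, zero_sub] at h
      have hne : (v.1 ^ 2)⁻¹ * presS P (v.1, v.2.1) * ((1 + m) * (m.factorial : ℝ)) ≠ 0 :=
        mul_ne_zero (mul_ne_zero (inv_ne_zero (pow_ne_zero 2 hv.ne')) hPS)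
          (mul_ne_zero (by positivity) hfac)
      refine (mul_eq_zero.1 (?_ : ((v.1 ^ 2)⁻¹ * presS P (v.1, v.2.1) *
        ((1 + m) * (m.factorial : ℝ))) * l v.2.1 = 0)).resolve_left hne
      linear_combination -h
  refine ⟨affConst T, γ 0, hK, fun v y hv => ?_⟩
  have hγc : γ v.2.1 = γ 0 := is_const_of_deriv_eq_zero (hγ.differentiable (by simp)) hγ0 _ _
  rw [hform v y hv, affDens, affineCoeff_apply, hlz, hγc, zero_mul, add_zero]

end OddFinal

end FluidFlow

end

noncomputable section

namespace FluidFlow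

/-! ### The components of powers of the curl with two free indices -/

section CoTensor

variable {n r k : ℕ}

/-- The components of `curlPow` with two additional coordinate covectors. -/
def coTensor (h : r + 2 + 2 * k = n) (c : Fin r → Fin n → ℝ) (a b : Fin n) (A : Grad n) : ℝ :=
  curlPow h (Fin.append c ![Pi.single a 1, Pi.single b 1]) A

lemma prod_append (c : Fin r → Fin n → ℝ) (x y : Fin n → ℝ) (g : Fin (r + 2) → Fin n) :
    ∏ i, Fin.append c ![x, y] i (g i) =
      (∏ i, c i (g (Fin.castAdd 2 i))) * (x (g (Fin.natAdd r 0)) * y (g (Fin.natAdd r 1))) := by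
  rw [Fin.prod_univ_add, Fin.prod_univ_two]
  simp only [Fin.append_left, Fin.append_right]
  rfl

/-- Expand the first bilinear form in coordinates: its two slots turn into slots of two coordinate
covectors. -/
lemma altForm_cons (h : r + 2 * (k + 1) = n) (h' : r + 2 + 2 * k = n) (c : Fin r → Fin n → ℝ)
    (X : Grad n) (W : Fin k → Grad n) :
    altForm h c (Fin.cons X W : Fin (k + 1) → Grad n) = ∑ a, ∑ b, X a b *
      altForm h' (Fin.append c ![Pi.single a 1, Pi.single b 1]) W := by
  have hC : ∀ i, slotC h' (Fin.castAdd 2 i) = slotC h i := fun i => by ext; simp [slotC]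
  have hL : slotC h' (Fin.natAdd r 0) = slotL h 0 := by ext; simp [slotC, slotL]
  have hR : slotC h' (Fin.natAdd r 1) = slotR h 0 := by ext; simp [slotC, slotR]
  have hL' : ∀ l, slotL h (Fin.succ l) = slotL h' l := fun l => by ext; simp [slotL]; ring
  have hR' : ∀ l, slotR h (Fin.succ l) = slotR h' l := fun l => by ext; simp [slotR]; ring
  have key : ∀ σ : Equiv.Perm (Fin n), altTerm h c (Fin.cons X W : Fin (k + 1) → Grad n) σ =
      ∑ a, ∑ b, X a b * altTerm h' (Fin.append c ![Pi.single a 1, Pi.single b 1]) W σ := by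
    intro σ
    unfold altTerm
    rw [Fin.prod_univ_succ]
    simp only [Fin.cons_zero, Fin.cons_succ, hL', hR']
    have hp : ∀ a b : Fin n, ∏ i, Fin.append c ![Pi.single a 1, Pi.single b 1] i
        (σ (slotC h' i)) = (∏ i, c i (σ (slotC h i))) *
          ((Pi.single a 1 : Fin n → ℝ) (σ (slotL h 0)) *
            (Pi.single b 1 : Fin n → ℝ) (σ (slotR h 0))) := fun a b => by
      rw [prod_append c _ _ fun i => σ (slotC h' i)]
      simp only [hC, hL, hR]
    simp only [hp]
    rw [Finset.sum_eq_single (σ (slotL h 0)), Finset.sum_eq_single (σ (slotR h 0))]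
    · simp; ring
    · intro b _ hb
      simp [hb.symm]
    · simp
    · intro a _ ha
      simp [ha.symm]
    · simp
  simp only [altForm_apply, key, Finset.mul_sum]
  rw [Finset.sum_comm]
  refine Finset.sum_congr rfl fun a _ => ?_
  rw [Finset.sum_comm]
  exact Finset.sum_congr rfl fun b _ => Finset.sum_congr rfl fun σ _ => by ring

lemma curlPow_eq_coTensor (h : r + 2 * (k + 1) = n) (h' : r + 2 + 2 * k = n)
    (c : Fin r → Fin n → ℝ) (A : Grad n) :
    curlPow h c A = ∑ a, ∑ b, A a b * coTensor h' c a b A := by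
  have e : (fun _ => A : Fin (k + 1) → Grad n) = Fin.cons A fun _ => A := by
    funext l; refine Fin.cases rfl (fun _ => rfl) l
  rw [curlPow, e, altForm_cons h h']
  rfl

lemma fderiv_curlPow_eq_coTensor (h : r + 2 * (k + 1) = n) (h' : r + 2 + 2 * k = n)
    (c : Fin r → Fin n → ℝ) (A X : Grad n) :
    fderiv ℝ (curlPow h c) A X = (k + 1) * ∑ a, ∑ b, X a b * coTensor h' c a b A := by
  have e : (fun _ => A : Fin (k + 1) → Grad n) = Fin.cons A fun _ => A := by
    funext l; refine Fin.cases rfl (fun _ => rfl) l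
  rw [fderiv_curlPow_eq_mul h c A X 0, e, Fin.update_cons_zero, altForm_cons h h']
  push_cast
  rfl

lemma sum_mul_coTensor_symm (h : r + 2 * (k + 1) = n) (h' : r + 2 + 2 * k = n)
    (c : Fin r → Fin n → ℝ) (A X : Grad n) (hX : ∀ i j, X i j = X j i) :
    ∑ a, ∑ b, X a b * coTensor h' c a b A = 0 := by
  have h1 := (isCurlForm_curlPow h c).fderiv_symm A X hX
  rw [fderiv_curlPow_eq_coTensor h h'] at h1
  exact (mul_eq_zero.1 h1).resolve_left (by positivity)

lemma contDiff_coTensor (h' : r + 2 + 2 * k = n) (c : Fin r → Fin n → ℝ) (a b : Fin n) :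
    ContDiff ℝ ∞ (coTensor h' c a b) := (isCurlForm_curlPow h' _).contDiff

/-- The algebraic form of the vanishing divergence of the components. -/
lemma sum_fderiv_coTensor (h' : r + 2 + 2 * k = n) (c : Fin r → Fin n → ℝ) (a : Fin n) (A : Grad n)
    (H : Fin n → Grad n) (hH : ∀ b p j, H b p j = H j p b) :
    ∑ b, fderiv ℝ (coTensor h' c a b) A (H b) = 0 := by
  have h1 : ∀ b, fderiv ℝ (coTensor h' c a b) A (H b) =
      ∑ l, altForm h' (Fin.append c ![Pi.single a 1, Pi.single b 1])
        (Function.update (fun _ => A) l (H b)) := fun b => fderiv_curlPow h' _ A (H b)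
  simp only [h1]
  rw [Finset.sum_comm]
  refine Finset.sum_eq_zero fun l _ => ?_
  simp only [altForm_apply]
  rw [Finset.sum_comm]
  simp only [← Finset.mul_sum]
  set p := slotC h' (Fin.natAdd r 1) with hp
  set q := slotR h' l with hq
  have hpq : p ≠ q := slotC_ne_slotR _ _ _
  have key : ∀ σ : Equiv.Perm (Fin n), ∑ b, altTerm h'
      (Fin.append c ![Pi.single a 1, Pi.single b 1]) (Function.update (fun _ => A) l (H b)) σ =
      (∏ i, c i (σ (slotC h' (Fin.castAdd 2 i)))) *
        (Pi.single a 1 : Fin n → ℝ) (σ (slotC h' (Fin.natAdd r 0))) *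
        H (σ p) (σ (slotL h' l)) (σ q) *
        ∏ l' ∈ Finset.univ.erase l, A (σ (slotL h' l')) (σ (slotR h' l')) := by
    intro σ
    simp only [altTerm_update]
    rw [Finset.sum_eq_single (σ p)]
    · rw [prod_append c _ _ fun i => σ (slotC h' i)]
      simp only [← hp, ← hq, Pi.single_eq_same, mul_one]
      ring
    · intro b _ hb
      rw [prod_append c _ _ fun i => σ (slotC h' i), ← hp,
        Pi.single_eq_of_ne (M := fun _ => ℝ) hb.symm]
      simp
    · simp
  simp only [key]
  -- The differentiation index sits in the slot `p` of the second free covector and the other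
  -- derivative index of `H` in the slot `q`. Second derivatives commute, so each summand is
  -- invariant under exchanging the two slots.
  refine sum_sign_eq_zero hpq (fun σ => (∏ i, c i (σ (slotC h' (Fin.castAdd 2 i)))) *
        (Pi.single a 1 : Fin n → ℝ) (σ (slotC h' (Fin.natAdd r 0))) *
        H (σ p) (σ (slotL h' l)) (σ q) *
        ∏ l' ∈ Finset.univ.erase l, A (σ (slotL h' l')) (σ (slotR h' l'))) fun σ => ?_
  have hne : ∀ s : Fin n, s ≠ p → s ≠ q → (σ * Equiv.swap p q) s = σ s := fun s h1 h2 => by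
    rw [Equiv.Perm.mul_apply, Equiv.swap_apply_of_ne_of_ne h1 h2]
  have e1 : ∀ i : Fin r, (σ * Equiv.swap p q) (slotC h' (Fin.castAdd 2 i)) =
      σ (slotC h' (Fin.castAdd 2 i)) := fun i => hne _
    (by rw [hp, Ne, slotC_inj, Fin.ext_iff]; simp; omega) (slotC_ne_slotR _ _ _)
  have e2 : (σ * Equiv.swap p q) (slotC h' (Fin.natAdd r 0)) = σ (slotC h' (Fin.natAdd r 0)) :=
    hne _ (by rw [hp, Ne, slotC_inj, Fin.ext_iff]; simp) (slotC_ne_slotR _ _ _)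
  have e3 : ∀ l', (σ * Equiv.swap p q) (slotL h' l') = σ (slotL h' l') := fun l' =>
    hne _ (slotC_ne_slotL _ _ _).symm (slotL_ne_slotR _ _ _)
  have e4 : ∀ l' ∈ Finset.univ.erase l, A ((σ * Equiv.swap p q) (slotL h' l'))
      ((σ * Equiv.swap p q) (slotR h' l')) = A (σ (slotL h' l')) (σ (slotR h' l')) :=
    fun l' hl' => by
      rw [e3, hne (slotR h' l') (slotC_ne_slotR _ _ _).symm
        (by rw [hq, Ne, slotR_inj]; exact Finset.ne_of_mem_erase hl')]
  have e5 : (σ * Equiv.swap p q) p = σ q := by simp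
  have e6 : (σ * Equiv.swap p q) q = σ p := by simp
  rw [Finset.prod_congr rfl e4, Finset.prod_congr rfl fun i _ => congrArg (c i) (e1 i), e2, e3, e5,
    e6, hH]

end CoTensor

/-! ### Fields of a fluid state -/

section Fields

variable {n r k : ℕ} {w : Space n → FluidVar n}

/-- The velocity gradient of a state. -/
def gradField (w : Space n → FluidVar n) (x : Space n) : Grad n := velGrad (firstJet w x).2

lemma gradField_apply (hw : IsFluidState w) (x : Space n) (i j : Fin n) :
    gradField w x i j = partialD j (fun y => (w y).2.2 i) x :=
  (partialD_vel (hw.1.differentiable (by simp) x) j i).symm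

lemma contDiff_gradField (hw : IsFluidState w) : ContDiff ℝ ∞ (gradField w) :=
  contDiff_velGrad.comp (contDiff_firstJet hw.1).snd

lemma velGrad_fluidVarD_jet (w : Space n → FluidVar n) (t : ℝ) (x : Space n) :
    velGrad (fluidVarD ((t, x, jet 1 w x) : JetPoint n 1)) = gradField w x := by
  have : fluidVarD ((t, x, jet 1 w x) : JetPoint n 1) = (firstJet w x).2 :=
    funext fun i => fluidVarD_jet w t x i
  rw [this]; rfl

lemma contDiff_vel (hw : IsFluidState w) (i : Fin n) : ContDiff ℝ ∞ fun y => (w y).2.2 i :=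
  contDiff_euclidean.1 hw.1.snd.snd i

lemma partialD_comp_gradField (hw : IsFluidState w) {F : Grad n → ℝ} (hF : ContDiff ℝ ∞ F)
    (x : Space n) (b : Fin n) :
    partialD b (fun y => F (gradField w y)) x = fderiv ℝ F (gradField w x)
      (fun i j => partialD b (partialD j fun y => (w y).2.2 i) x) := by
  have hd := (contDiff_gradField hw).differentiable (by simp) x
  have h1 : HasFDerivAt (fun y => F (gradField w y)) _ x :=
    HasFDerivAt.comp x (hF.differentiable (by simp) (gradField w x)).hasFDerivAt hd.hasFDerivAt
  rw [partialD, h1.fderiv, ContinuousLinearMap.comp_apply]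
  congr 1
  ext i j
  have e : (fun y => gradField w y i j) = partialD j fun y => (w y).2.2 i :=
    funext fun y => gradField_apply hw y i j
  rw [← e, partialD]
  have h2 : HasFDerivAt (fun y => gradField w y i j) _ x :=
    ((ContinuousLinearMap.proj (R := ℝ) (φ := fun _ : Fin n => ℝ) j).comp
      (ContinuousLinearMap.proj (R := ℝ) (φ := fun _ : Fin n => Fin n → ℝ) i)).hasFDerivAt.comp x
      hd.hasFDerivAt
  rw [h2.fderiv]
  rfl

lemma contDiff_coTensor_gradField (hw : IsFluidState w) (h' : r + 2 + 2 * k = n)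
    (c : Fin r → Fin n → ℝ) (a b : Fin n) :
    ContDiff ℝ ∞ fun y => coTensor h' c a b (gradField w y) :=
  (contDiff_coTensor h' c a b).comp (contDiff_gradField hw)

/-- The components are divergence-free along states. -/
lemma sum_partialD_coTensor (hw : IsFluidState w) (h' : r + 2 + 2 * k = n)
    (c : Fin r → Fin n → ℝ) (a : Fin n) (x : Space n) :
    ∑ b, partialD b (fun y => coTensor h' c a b (gradField w y)) x = 0 := by
  rw [Finset.sum_congr rfl fun b _ =>
    partialD_comp_gradField hw (contDiff_coTensor h' c a b) x b]
  exact sum_fderiv_coTensor h' c a (gradField w x)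
    (fun b i j => partialD b (partialD j fun y => (w y).2.2 i) x)
    fun b p j => partialD_comm (contDiff_vel hw p) b j

lemma contDiff_velGrad_fluidVarD :
    ContDiff ℝ ∞ fun q : JetPoint n 1 => velGrad (fluidVarD q) := (velGradL n).contDiff

/-- Powers of the curl contracted with constant covectors are trivial densities. -/
lemma isTrivialDensity_curlPow (h : r + 2 * k = n) (hk : 1 ≤ k) (c : Fin r → Fin n → ℝ) :
    IsTrivialDensity fun q : JetPoint n 1 => curlPow h c (velGrad (fluidVarD q)) := by
  obtain ⟨k, rfl⟩ : ∃ k', k = k' + 1 := ⟨k - 1, by omega⟩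
  have h' : r + 2 + 2 * k = n := by omega
  -- The potential is `u_a` times the tensor of the `(k-1)`-st power of the curl. The tensor is
  -- divergence-free, so the divergence is `∂_b u_a` contracted with it, which rebuilds the full
  -- power.
  refine ⟨1, fun q => WithLp.toLp 2 fun b => ∑ a, (fluidVar q).2.2 a *
    coTensor h' c a b (velGrad (fluidVarD q)), ?_, fun w hw t x => ?_⟩
  · refine ContDiff.contDiffOn ?_
    rw [contDiff_euclidean]
    intro b
    have hu : ∀ a, ContDiff ℝ ∞ fun q : JetPoint n 1 => (fluidVar q).2.2 a :=
      contDiff_euclidean.1 contDiff_fluidVar.snd.snd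
    have hs : ∀ a, ContDiff ℝ ∞ fun q : JetPoint n 1 =>
        (fluidVar q).2.2 a * coTensor h' c a b (velGrad (fluidVarD q)) := fun a =>
      (hu a).mul ((contDiff_coTensor h' c a b).comp contDiff_velGrad_fluidVarD)
    exact ContDiff.sum (s := Finset.univ) fun a _ => hs a
  · simp only [totalDiv, fluidVar_jet, velGrad_fluidVarD_jet]
    have hd : ∀ {f : Space n → ℝ}, ContDiff ℝ ∞ f → DifferentiableAt ℝ f x := fun hf =>
      hf.differentiable (by simp) x
    have hu := contDiff_vel hw
    have hco := contDiff_coTensor_gradField hw h' c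
    have e : ∀ b, partialD b (fun y => ∑ a, (w y).2.2 a * coTensor h' c a b (gradField w y)) x =
        ∑ a, (gradField w x a b * coTensor h' c a b (gradField w x) +
          (w x).2.2 a * partialD b (fun y => coTensor h' c a b (gradField w y)) x) := by
      intro b
      rw [partialD_sum _ fun a _ => (hd (hu a)).fun_mul (hd (hco a b))]
      refine Finset.sum_congr rfl fun a _ => ?_
      rw [partialD_mul (hd (hu a)) (hd (hco a b)), gradField_apply hw]
    simp only [e]
    rw [Finset.sum_comm]
    simp only [Finset.sum_add_distrib, ← Finset.mul_sum, sum_partialD_coTensor hw, mul_zero,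
      add_zero]
    exact curlPow_eq_coTensor h h' c _

end Fields

end FluidFlow

end

noncomputable section

namespace FluidFlow

/-! ### The circulatory flux -/

section Flux

variable {m : ℕ} {P e : ℝ → ℝ → ℝ} {F : ℝ → ℝ}

lemma IsInternalEnergy.smoothState (he : IsInternalEnergy P e) : SmoothState e := he.1

lemma SmoothState.smoothState_presS (he : SmoothState e) :
    SmoothState fun ρ s => presS e (ρ, s) := he.contDiffOn_presS

lemma IsInternalEnergy.presRho_eq (he : IsInternalEnergy P e) {q : ℝ × ℝ} (hq : 0 < q.1) :
    presRho e q = (q.1 ^ 2)⁻¹ * P q.1 q.2 := by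
  refine fderiv_eq_of_line (he.smoothState.differentiableAt hq) ?_
  have h := (he.2 (q.1 + 0) q.2 (by simpa using hq)).comp_const_add q.1 (0 : ℝ)
  simpa using h

/-- The Maxwell relation `∂²e/∂ρ∂S = ρ⁻² ∂P/∂S`. -/
lemma IsInternalEnergy.presRho_presS (he : IsInternalEnergy P e) (hP : SmoothState P) {q : ℝ × ℝ}
    (hq : 0 < q.1) : presRho (fun ρ s => presS e (ρ, s)) q = (q.1 ^ 2)⁻¹ * presS P q := by
  have h1 : presRho (fun ρ s => presS e (ρ, s)) q = fderiv ℝ (presS e) q (1, 0) := rfl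
  rw [h1, ← he.smoothState.presRho_presS_comm hq]
  refine fderiv_eq_of_line ((he.smoothState.contDiffOn_presRho.differentiableOn
    (by simp)).differentiableAt (isOpen_posState.mem_nhds hq)) ?_
  have h2 : (fun t : ℝ => presRho e (q + t • (0, 1))) = fun t => (q.1 ^ 2)⁻¹ * P q.1 (q.2 + t) := by
    funext t
    rw [he.presRho_eq (by simpa using hq)]
    simp
  rw [h2]
  have h3 := ((hP.deriv_entropy (q := (q.1, q.2 + 0)) hq).comp_const_add q.2 (0 : ℝ)).const_mul
    ((q.1 ^ 2)⁻¹)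
  simpa using h3

lemma isVortFunction_entropy_mul {n : ℕ} (hF : ContDiff ℝ ∞ F) :
    IsVortFunction fun v : FluidVar n × ℝ => F v.1.2.1 * v.2 := by
  refine ContDiff.contDiffOn (ContDiff.mul ?_ contDiff_snd)
  exact hF.comp (contDiff_fst.snd.fst)

/-- The factor `F(S)` is transported, and by the trace identity the dilation `ϖ ∇·u` cancels the
stretching by `(∇u)²`. Only the baroclinic source is left. -/
lemma lag_entropy_mul (hF : ContDiff ℝ ∞ F) (v : FluidVar (2 * m)) (G : Fin (2 * m) → FluidVar (2 * m))
    (hv : 0 < v.1) :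
    lag P (vortEven m) (fun v => F v.1.2.1 * v.2) (v, G) =
      F v.2.1 * ((v.1 ^ 2)⁻¹ * presS P (v.1, v.2.1) * fderiv ℝ (vortEven m) (velGrad G)
        (outer (fun i => (G i).2.1) fun i => (G i).1)) := by
  have hT := isVortFunction_entropy_mul (n := 2 * m) hF
  have h1 : ∀ (y : ℝ) (a : ℝ) (b : Space (2 * m)) (y' : ℝ),
      fderiv ℝ (fun v : FluidVar (2 * m) × ℝ => F v.1.2.1 * v.2) (v, y) ((a, 0, b), y') =
        F v.2.1 * y' := by
    intro y a b y'
    refine fderiv_eq_of_line (hT.hasFDerivAt hv).differentiableAt ?_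
    have h2 : HasDerivAt (fun t : ℝ => F v.2.1 * (y + t * y')) (F v.2.1 * y') 0 := by
      simpa using (((hasDerivAt_id (0 : ℝ)).mul_const y').const_add y).const_mul (F v.2.1)
    simpa using h2
  have hmg : materialGrad P v G = -(fun i j => ∑ p, velGrad G i p * velGrad G p j) +
      ((v.1 ^ 2)⁻¹ * presS P (v.1, v.2.1)) • outer (fun i => (G i).2.1) fun i => (G i).1 := by
    ext i j; simp [materialGrad]
  have hsq : fderiv ℝ (vortEven m) (velGrad G) (fun i j => ∑ p, velGrad G i p * velGrad G p j) =
      velDiv G * vortEven m (velGrad G) := by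
    have := fderiv_curlPow_sq (r := 0) (k := m) (n := 2 * m) (by omega) (fun a => a.elim0) (velGrad G)
    rw [Finset.univ_eq_empty (α := Fin 0), Finset.sum_empty, sub_zero] at this
    exact this
  have hmv : materialVar P v G = ((materialVar P v G).1, 0, (materialVar P v G).2.2) := rfl
  simp only [lag]
  rw [hmv, h1, hmg, map_add, map_neg, map_smul, hsq, smul_eq_mul]
  ring

lemma vortTensor_eq (hm : 1 ≤ m) (h' : 0 + 2 + 2 * (m - 1) = 2 * m) (q : JetPoint (2 * m) 1)
    (i j : Fin (2 * m)) :
    vortTensor hm q i j = coTensor h' (fun a => a.elim0) i j (velGrad (fluidVarD q)) := by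
  rw [vortTensor, starCurlPow_eq, coTensor]
  have : (fun a => Pi.single (![i, j] a) 1 : Fin 2 → Fin (2 * m) → ℝ) =
      Fin.append (fun a : Fin 0 => a.elim0) ![Pi.single i 1, Pi.single j 1] := by
    funext a
    fin_cases a <;> rfl
  rw [this]

lemma isLocalFunction_circulatoryFlux (hm : 1 ≤ m) (he : SmoothState e) (hF : ContDiff ℝ ∞ F) :
    IsLocalFunction (circulatoryFlux hm e F) := by
  have h' : 0 + 2 + 2 * (m - 1) = 2 * m := by omega
  have hF' : ContDiff ℝ ∞ (deriv F) := (contDiff_infty_iff_deriv.1 hF).2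
  have h1 : ContDiffOn ℝ ∞ (fun q : JetPoint (2 * m) 1 =>
      deriv (fun s => e (fluidVar q).1 s) (fluidVar q).2.1) {q | 0 < (fluidVar q).1} := by
    have h2 : ContDiffOn ℝ ∞ (fun q : JetPoint (2 * m) 1 =>
        presS e ((fluidVar q).1, (fluidVar q).2.1)) {q | 0 < (fluidVar q).1} :=
      he.contDiffOn_presS.comp (f := fun q : JetPoint (2 * m) 1 =>
        ((fluidVar q).1, (fluidVar q).2.1))
        (contDiff_fluidVar.fst.prodMk contDiff_fluidVar.snd.fst).contDiffOn fun q hq => hq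
    exact h2.congr fun q hq =>
      (he.deriv_entropy (q := ((fluidVar q).1, (fluidVar q).2.1)) hq).deriv
  have h3 : ∀ i j, ContDiff ℝ ∞ fun q : JetPoint (2 * m) 1 =>
      vortTensor hm q i j * (deriv F (fluidVar q).2.1 * (fluidVarD q i).2.1) := by
    intro i j
    simp only [vortTensor_eq hm h']
    refine ((contDiff_coTensor h' _ i j).comp contDiff_velGrad_fluidVarD).mul
      (ContDiff.mul (hF'.comp contDiff_fluidVar.snd.fst) ?_)
    exact ((fluidVarDL (2 * m) i).contDiff).snd.fst
  unfold IsLocalFunction circulatoryFlux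
  rw [contDiffOn_euclidean]
  intro j
  exact ((contDiffOn_const.mul h1).mul
    (ContDiff.sum (s := Finset.univ) fun i _ => h3 i j).contDiffOn).neg

/-- Three kinds of terms vanish: the divergence of the tensor, and the contractions of this
antisymmetric tensor with the Hessian of `S` and with `∇S ⊗ ∇S`. What survives is the `ρ`-derivative
of `e_S`, equal to `ρ⁻² P_S` by the Maxwell relation. -/
lemma totalDiv_circulatoryFlux (hm : 1 ≤ m) (hP : SmoothState P) (he : IsInternalEnergy P e)
    (hF : ContDiff ℝ ∞ F) {w : Space (2 * m) → FluidVar (2 * m)} (hw : IsFluidState w) (t : ℝ)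
    (x : Space (2 * m)) :
    totalDiv (circulatoryFlux hm e F) w t x =
      -lag P (vortEven m) (fun v => deriv F v.1.2.1 * v.2) (firstJet w x) := by
  obtain ⟨k, rfl⟩ : ∃ k, m = k + 1 := ⟨m - 1, by omega⟩
  have h : 0 + 2 * (k + 1) = 2 * (k + 1) := by omega
  have h' : 0 + 2 + 2 * k = 2 * (k + 1) := by omega
  have hes := he.smoothState
  have hF' : ContDiff ℝ ∞ (deriv F) := (contDiff_infty_iff_deriv.1 hF).2
  have hd : ∀ {f : Space (2 * (k + 1)) → ℝ}, ContDiff ℝ ∞ f → DifferentiableAt ℝ f x := fun hf =>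
    hf.differentiable (by simp) x
  set c : Fin 0 → Fin (2 * (k + 1)) → ℝ := fun a => a.elim0 with hc
  set S : Space (2 * (k + 1)) → ℝ := fun y => (w y).2.1 with hS
  have hSs : ContDiff ℝ ∞ S := hw.1.snd.fst
  set Φ : Space (2 * (k + 1)) → ℝ := fun y => presS e ((w y).1, (w y).2.1) * deriv F (S y) with hΦ
  have hes' : ContDiff ℝ ∞ fun y => presS e ((w y).1, (w y).2.1) :=
    hes.smoothState_presS.contDiff_comp hw
  have hΦs : ContDiff ℝ ∞ Φ := hes'.mul (hF'.comp hSs)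
  have hDS := contDiff_partialD hSs
  have hco := contDiff_coTensor_gradField hw h' c
  have hξ : ∀ (j : Fin (2 * (k + 1))) y, circulatoryFlux hm e F (t, y, jet 1 w y) j =
      ∑ i, -((k + 1 : ℝ)) * (Φ y * (partialD i S y * coTensor h' c i j (gradField w y))) := by
    intro j y
    simp only [circulatoryFlux, vortTensor_eq hm h', fluidVar_jet, velGrad_fluidVarD_jet,
      fluidVarD_jet]
    rw [(hes.deriv_entropy (q := ((w y).1, (w y).2.1)) (hw.2 y)).deriv, Finset.mul_sum,
      ← Finset.sum_neg_distrib]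
    refine Finset.sum_congr rfl fun i _ => ?_
    rw [hΦ, hS, partialD_entropy (hw.1.differentiable (by simp) y)]
    push_cast
    ring
  have hdiv : totalDiv (circulatoryFlux hm e F) w t x = -((k + 1 : ℝ)) *
      ((∑ i, ∑ j, (partialD i S x * partialD j Φ x) * coTensor h' c i j (gradField w x)) +
        Φ x * (∑ i, ∑ j, partialD j (partialD i S) x * coTensor h' c i j (gradField w x)) +
        Φ x * ∑ i, partialD i S x *
          ∑ j, partialD j (fun y => coTensor h' c i j (gradField w y)) x) := by
    have e1 : ∀ j, partialD j (fun y => circulatoryFlux hm e F (t, y, jet 1 w y) j) x =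
        ∑ i, -((k + 1 : ℝ)) * (partialD j Φ x * (partialD i S x * coTensor h' c i j (gradField w x)) +
          Φ x * (partialD j (partialD i S) x * coTensor h' c i j (gradField w x) +
            partialD i S x * partialD j (fun y => coTensor h' c i j (gradField w y)) x)) := by
      intro j
      simp only [hξ]
      have hterm := fun i => (hDS i).mul (hco i j)
      rw [partialD_sum _ fun i _ => (differentiableAt_const _).fun_mul
        (hd (hΦs.mul (hterm i)))]
      refine Finset.sum_congr rfl fun i _ => ?_
      rw [partialD_mul (differentiableAt_const _) (hd (hΦs.mul (hterm i))),
        partialD_mul (hd hΦs) (hd (hterm i)), partialD_mul (hd (hDS i)) (hd (hco i j))]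
      simp [partialD]
    simp only [totalDiv, e1]
    rw [Finset.sum_comm]
    simp only [Finset.mul_sum, ← Finset.sum_add_distrib]
    exact Finset.sum_congr rfl fun i _ => Finset.sum_congr rfl fun j _ => by ring
  rw [hdiv]
  simp only [sum_partialD_coTensor hw, mul_zero, Finset.sum_const_zero, add_zero]
  rw [sum_mul_coTensor_symm h h' c (gradField w x)
    (fun i j => partialD j (partialD i S) x) (fun i j => partialD_comm hSs j i), mul_zero, add_zero]
  set α := deriv F (S x) * (((w x).1 ^ 2)⁻¹ * presS P ((w x).1, (w x).2.1)) with hα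
  -- The value of `β` is irrelevant: it multiplies the symmetric form `∇S ⊗ ∇S`.
  obtain ⟨β, hβ⟩ : ∃ β, ∀ j, partialD j Φ x = α * partialD j (fun y => (w y).1) x +
      β * partialD j S x := by
    refine ⟨presS (fun ρ s => presS e (ρ, s)) ((w x).1, (w x).2.1) * deriv F (S x) +
      presS e ((w x).1, (w x).2.1) * deriv (deriv F) (S x), fun j => ?_⟩
    have hdF : partialD j (fun y => deriv F (S y)) x = deriv (deriv F) (S x) * partialD j S x := by
      have h1 : HasFDerivAt (fun y => deriv F (S y)) _ x :=
        ((hF'.differentiable (by simp)) (S x)).hasDerivAt.comp_hasFDerivAt x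
          (hd hSs).hasFDerivAt
      rw [partialD, h1.fderiv]
      simp [partialD]
    rw [hΦ, partialD_mul (g := fun y => deriv F (S y)) (hd hes') (hd (hF'.comp hSs)),
      hes.smoothState_presS.partialD_comp hw, he.presRho_presS hP (hw.2 x), hdF,
      partialD_rho (hw.1.differentiable (by simp) x), hS,
      partialD_entropy (hw.1.differentiable (by simp) x), hα]
    ring
  have hsplit : ∑ i, ∑ j, (partialD i S x * partialD j Φ x) * coTensor h' c i j (gradField w x) =
      α * (∑ i, ∑ j, (partialD i S x * partialD j (fun y => (w y).1) x) *
        coTensor h' c i j (gradField w x)) +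
      β * ∑ i, ∑ j, (partialD i S x * partialD j S x) * coTensor h' c i j (gradField w x) := by
    simp only [hβ, Finset.mul_sum, ← Finset.sum_add_distrib]
    exact Finset.sum_congr rfl fun i _ => Finset.sum_congr rfl fun j _ => by ring
  rw [hsplit, sum_mul_coTensor_symm h h' c (gradField w x)
    (fun i j => partialD i S x * partialD j S x) (fun i j => by ring), mul_zero, add_zero]
  have hlag := lag_entropy_mul (P := P) hF' (w x) (firstJet w x).2 (hw.2 x)
  rw [show firstJet w x = (w x, (firstJet w x).2) from rfl, hlag]
  have hfd : fderiv ℝ (vortEven (k + 1)) (velGrad (firstJet w x).2)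
      (outer (fun i => ((firstJet w x).2 i).2.1) fun i => ((firstJet w x).2 i).1) =
      (k + 1) * ∑ i, ∑ j, (partialD i S x * partialD j (fun y => (w y).1) x) *
        coTensor h' c i j (gradField w x) := by
    have := fderiv_curlPow_eq_coTensor h h' c (gradField w x)
      (outer (fun i => partialD i S x) fun i => partialD i (fun y => (w y).1) x)
    simp only [partialD_rho (hw.1.differentiable (by simp) x), hS,
      partialD_entropy (hw.1.differentiable (by simp) x)] at this ⊢
    exact this
  rw [hfd, hα]
  ring

/-- The density `f(S) ϖ` is conserved, with the circulatory flux. -/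
lemma isMovingFlux_circulatoryFlux (hm : 1 ≤ m) (hP : SmoothState P) (he : IsInternalEnergy P e)
    (hF : ContDiff ℝ ∞ F) :
    IsMovingFlux P (evenVortDensity (m := m) (fun v => deriv F v.1.2.1 * v.2))
      (circulatoryFlux hm e F) := by
  have hF' : ContDiff ℝ ∞ (deriv F) := (contDiff_infty_iff_deriv.1 hF).2
  have hT := isVortFunction_entropy_mul (n := 2 * m) hF'
  have hZ := isCurlForm_vortEven m
  have hloc := isLocalFunction_circulatoryFlux hm he.smoothState hF
  refine ⟨hloc, fun w hw t x => ?_⟩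
  rw [evenVortDensity_eq]
  have h1 := onShellDt_vortDensity hP hZ hT hw t x
  have h2 := totalDiv_circulatoryFlux hm hP he hF hw t x
  rw [← h1] at h2
  have h3 : totalDiv (fun q => vortDensity (vortEven m) (fun v => deriv F v.1.2.1 * v.2) q •
      (fluidVar q).2.2 + circulatoryFlux hm e F q) w t x =
      ∑ i, partialD i (fun y => vortDensity (vortEven m) (fun v => deriv F v.1.2.1 * v.2)
        (t, y, jet 1 w y) * (w y).2.2 i) x + totalDiv (circulatoryFlux hm e F) w t x := by
    simp only [totalDiv, fluidVar_jet, PiLp.add_apply, PiLp.smul_apply, smul_eq_mul]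
    rw [← Finset.sum_add_distrib]
    refine Finset.sum_congr rfl fun i _ => partialD_add ?_ ?_ i
    · exact (((isLocalFunction_vortDensity hZ hT).contDiff_comp_jet hw t).mul
        (contDiff_vel hw i)).differentiable (by simp) x
    · exact (contDiff_euclidean.1 (hloc.contDiff_comp_jet hw t) i).differentiable (by simp) x
  rw [h3, h2]
  ring

end Flux

end FluidFlow

end

noncomputable section

namespace FluidFlow

/-! ### Smooth parametric integrals and internal energies -/

section Energy

lemma hasFDerivAt_parametric_integral {E F : Type} [NormedAddCommGroup E] [NormedSpace ℝ E]
    [ProperSpace E] [NormedAddCommGroup F] [NormedSpace ℝ F] {g : E × ℝ → F}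
    (hg : ContDiff ℝ ∞ g) (x : E) :
    HasFDerivAt (fun x => ∫ τ in (0 : ℝ)..1, g (x, τ))
      (∫ τ in (0 : ℝ)..1, (fderiv ℝ g (x, τ)).comp (ContinuousLinearMap.inl ℝ E ℝ)) x := by
  have hf : ContDiff ℝ ∞ fun p : E × ℝ =>
      (fderiv ℝ g p).comp (ContinuousLinearMap.inl ℝ E ℝ) :=
    (hg.fderiv_right (by simp)).clm_comp contDiff_const
  obtain ⟨C, hC⟩ := ((isCompact_closedBall x 1).prod
    (isCompact_Icc (a := (0 : ℝ)) (b := 1))).exists_bound_of_continuousOn hf.continuous.continuousOn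
  have hline : ∀ y : E, Continuous fun τ : ℝ => (y, τ) := fun y => by fun_prop
  refine intervalIntegral.hasFDerivAt_integral_of_dominated_of_fderiv_le (s := Metric.closedBall x 1)
    (F := fun x τ => g (x, τ))
    (F' := fun x τ => (fderiv ℝ g (x, τ)).comp (ContinuousLinearMap.inl ℝ E ℝ))
    (bound := fun _ => C) (Metric.closedBall_mem_nhds x one_pos) ?_ ?_ ?_ ?_ ?_ ?_
  · exact Filter.Eventually.of_forall fun y =>
      (hg.continuous.comp (hline y)).aestronglyMeasurable
  · exact (hg.continuous.comp (hline x)).intervalIntegrable _ _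
  · exact (hf.continuous.comp (hline x)).aestronglyMeasurable
  · refine Filter.Eventually.of_forall fun τ hτ y hy => hC (y, τ) ⟨hy, ?_⟩
    rw [Set.uIoc_of_le zero_le_one] at hτ
    exact Set.Ioc_subset_Icc_self hτ
  · exact continuous_const.intervalIntegrable _ _
  · exact Filter.Eventually.of_forall fun τ _ y _ =>
      HasFDerivAt.comp (g := g) y (hg.differentiable (by simp) (y, τ)).hasFDerivAt
        (hasFDerivAt_prodMk_left (𝕜 := ℝ) y τ)

lemma contDiff_parametric_integral {E F : Type} [NormedAddCommGroup E] [NormedSpace ℝ E]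
    [ProperSpace E] [NormedAddCommGroup F] [NormedSpace ℝ F] {g : E × ℝ → F}
    (hg : ContDiff ℝ ∞ g) : ContDiff ℝ ∞ fun x => ∫ τ in (0 : ℝ)..1, g (x, τ) := by
  rw [contDiff_infty]
  intro N
  -- The derivative is a parametric integral of the same type with values in another space, so the
  -- target has to vary in the induction.
  induction N generalizing F with
  | zero =>
    rw [Nat.cast_zero, contDiff_zero]
    exact continuous_iff_continuousAt.2 fun x => (hasFDerivAt_parametric_integral hg x).continuousAt
  | succ N ih =>
    push_cast
    rw [contDiff_succ_iff_hasFDerivAt]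
    have hf : ContDiff ℝ ∞ fun p : E × ℝ =>
        (fderiv ℝ g p).comp (ContinuousLinearMap.inl ℝ E ℝ) :=
      (hg.fderiv_right (by simp)).clm_comp contDiff_const
    exact ⟨_, ih hf, hasFDerivAt_parametric_integral hg⟩

lemma hasDerivAt_integral_of_continuous {g : ℝ → ℝ} (hg : Continuous g) (s : ℝ) :
    HasDerivAt (fun s => ∫ τ in (0 : ℝ)..s, g τ) (g s) s :=
  intervalIntegral.integral_hasDerivAt_right (hg.intervalIntegrable _ _)
    (hg.stronglyMeasurableAtFilter _ _) hg.continuousAt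

lemma exists_antideriv {f : ℝ → ℝ} (hf : ContDiff ℝ ∞ f) :
    ∃ F : ℝ → ℝ, ContDiff ℝ ∞ F ∧ deriv F = f := by
  have h := hasDerivAt_integral_of_continuous hf.continuous
  have hd : deriv (fun s => ∫ τ in (0 : ℝ)..s, f τ) = f := funext fun s => (h s).deriv
  exact ⟨fun s => ∫ τ in (0 : ℝ)..s, f τ,
    contDiff_infty_iff_deriv.2 ⟨fun s => (h s).differentiableAt, by rwa [hd]⟩, hd⟩

/-- Internal energies exist: integrate `ρ⁻² P` in the variable `log ρ`. -/
lemma exists_internalEnergy {P : ℝ → ℝ → ℝ} (hP : SmoothState P) :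
    ∃ e : ℝ → ℝ → ℝ, IsInternalEnergy P e := by
  -- With `ρ = exp s` one has `∂e/∂s = ρ ∂e/∂ρ = ρ⁻¹ P`, a function smooth on the whole plane.
  set G : ℝ × ℝ → ℝ := fun p => (Real.exp p.1)⁻¹ * P (Real.exp p.1) p.2 with hG
  have hGs : ContDiff ℝ ∞ G := by
    refine ContDiff.mul ((Real.contDiff_exp.comp contDiff_fst).inv fun p => (Real.exp_pos _).ne') ?_
    rw [← contDiffOn_univ]
    exact ContDiffOn.comp (g := fun q : ℝ × ℝ => P q.1 q.2) hP
      (f := fun p : ℝ × ℝ => (Real.exp p.1, p.2))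
      ((Real.contDiff_exp.comp contDiff_fst).prodMk contDiff_snd).contDiffOn
      fun p _ => Real.exp_pos _
  -- The antiderivative from `0` to `s`, rescaled to fixed limits so that joint smoothness follows
  -- from `contDiff_parametric_integral`.
  set E : ℝ × ℝ → ℝ := fun p => p.1 * ∫ τ in (0 : ℝ)..1, G (τ * p.1, p.2) with hE
  have hEs : ContDiff ℝ ∞ E := by
    refine contDiff_fst.mul (contDiff_parametric_integral
      (g := fun z : (ℝ × ℝ) × ℝ => G (z.2 * z.1.1, z.1.2)) ?_)
    exact hGs.comp (by fun_prop)
  have hEd : ∀ s S : ℝ, HasDerivAt (fun s => E (s, S)) (G (s, S)) s := by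
    intro s S
    have e : (fun s => E (s, S)) = fun s => ∫ τ in (0 : ℝ)..s, G (τ, S) := by
      funext s
      have := intervalIntegral.mul_integral_comp_mul_right (a := 0) (b := 1)
        (f := fun τ => G (τ, S)) s
      simpa [hE] using this
    rw [e]
    exact hasDerivAt_integral_of_continuous (hGs.continuous.comp (by fun_prop)) s
  refine ⟨fun ρ S => E (Real.log ρ, S), ?_, fun ρ S hρ => ?_⟩
  · refine hEs.comp_contDiffOn (ContDiffOn.prodMk ?_ contDiff_snd.contDiffOn)
    exact contDiff_fst.contDiffOn.log fun q hq => (show 0 < q.1 from hq).ne'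
  · have h := (hEd (Real.log ρ) S).comp ρ (Real.hasDerivAt_log hρ.ne')
    refine h.congr_deriv ?_
    simp only [hG, Real.exp_log hρ]
    field_simp

end Energy

end FluidFlow

end

noncomputable section

namespace FluidFlow

/-! ### Linear combinations of conserved and of trivial densities -/

section Combinations

variable {n : ℕ} {P : ℝ → ℝ → ℝ}

lemma totalDiv_add_const_smul {k : ℕ} {X Y : JetPoint n k → Space n} (hX : IsLocalFunction X)
    (hY : IsLocalFunction Y) (a : ℝ) {w : Space n → FluidVar n} (hw : IsFluidState w) (t : ℝ)
    (x : Space n) :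
    totalDiv (fun q => X q + a • Y q) w t x = totalDiv X w t x + a * totalDiv Y w t x := by
  simp only [totalDiv, Finset.mul_sum, ← Finset.sum_add_distrib]
  refine Finset.sum_congr rfl fun i _ => ?_
  have hX' := (contDiff_euclidean.1 (hX.contDiff_comp_jet hw t) i).differentiable (by simp) x
  have hY' := (contDiff_euclidean.1 (hY.contDiff_comp_jet hw t) i).differentiable (by simp) x
  simp only [PiLp.add_apply, PiLp.smul_apply, smul_eq_mul]
  rw [partialD_add hX' (hY'.const_mul a), partialD_mul (differentiableAt_const a) hY']
  simp [partialD]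

lemma IsLocalFunction.differentiableAt {r : ℕ} {T : JetPoint n r → ℝ} (hT : IsLocalFunction T)
    {q : JetPoint n r} (hq : 0 < (fluidVar q).1) : DifferentiableAt ℝ T q :=
  (ContDiffOn.differentiableOn hT (by simp)).differentiableAt
    ((isOpen_lt continuous_const contDiff_fluidVar.continuous.fst).mem_nhds hq)

/-- Linear combinations of conserved densities are conserved. -/
lemma IsConservedDensity.add_const_mul {r : ℕ} {T T₁ T₂ : JetPoint n r → ℝ}
    (h₁ : IsConservedDensity P T₁) (h₂ : IsConservedDensity P T₂) (hT₁ : IsLocalFunction T₁)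
    (hT₂ : IsLocalFunction T₂) (a : ℝ)
    (hT : ∀ q, 0 < (fluidVar q).1 → T q = T₁ q + a * T₂ q) : IsConservedDensity P T := by
  obtain ⟨k₁, X₁, hX₁, hc₁⟩ := h₁
  obtain ⟨k₂, X₂, hX₂, hc₂⟩ := h₂
  have l₁ : k₁ ≤ max k₁ k₂ := le_max_left _ _
  have l₂ : k₂ ≤ max k₁ k₂ := le_max_right _ _
  refine ⟨max k₁ k₂, fun q => X₁ (truncJet l₁ q) + a • X₂ (truncJet l₂ q),
    ContDiffOn.add (hX₁.truncJet l₁) ((hX₂.truncJet l₂).const_smul a), fun w hw t x => ?_⟩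
  rw [totalDiv_add_const_smul (hX₁.truncJet l₁) (hX₂.truncJet l₂) a hw]
  have hpos : 0 < (fluidVar ((t, x, jet r w x) : JetPoint n r)).1 := by
    rw [fluidVar_jet]; exact hw.2 x
  have hev : T =ᶠ[nhds (t, x, jet r w x)] fun q => T₁ q + a * T₂ q := by
    filter_upwards [(isOpen_lt continuous_const
      (contDiff_fluidVar (n := n) (k := r)).continuous.fst).mem_nhds hpos] with q hq
    exact hT q hq
  have hd : onShellDt P T w t x = onShellDt P T₁ w t x + a * onShellDt P T₂ w t x := by
    unfold onShellDt
    rw [hev.fderiv_eq, fderiv_fun_add (hT₁.differentiableAt hpos)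
      ((hT₂.differentiableAt hpos).const_mul a), fderiv_const_mul (hT₂.differentiableAt hpos)]
    rfl
  have e₁ := hc₁ w hw t x
  have e₂ := hc₂ w hw t x
  rw [hd]
  simp only [totalDiv, truncJet_jet] at e₁ e₂ ⊢
  linear_combination e₁ + a * e₂

lemma IsTrivialDensity.const_mul {r : ℕ} {T T' : JetPoint n r → ℝ} (h : IsTrivialDensity T) (a : ℝ)
    (hT : ∀ q, 0 < (fluidVar q).1 → T' q = a * T q) : IsTrivialDensity T' := by
  obtain ⟨k, Θ, hΘ, hd⟩ := h
  have h0 : IsLocalFunction fun _ : JetPoint n k => (0 : Space n) := contDiffOn_const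
  refine ⟨k, fun q => 0 + a • Θ q, ContDiffOn.add contDiffOn_const (ContDiffOn.const_smul a hΘ),
    fun w hw t x => ?_⟩
  rw [totalDiv_add_const_smul h0 hΘ a hw, hT _ (by rw [fluidVar_jet]; exact hw.2 x), hd w hw t x]
  simp [totalDiv, partialD]

lemma isLocalFunction_kinematicDensity {K : FluidVar n → ℝ} (hK : IsKinematic K) :
    IsLocalFunction (kinematicDensity K) :=
  ContDiffOn.comp (g := K) hK (f := fluidVar) contDiff_fluidVar.contDiffOn fun _ hq => hq

end Combinations

/-! ### Nontriviality in even dimension -/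

section Nontrivial

variable {m : ℕ}

lemma isConservedDensity_entropy_mul (hm : 1 ≤ m) {P : ℝ → ℝ → ℝ} (hP : SmoothState P) {f : ℝ → ℝ}
    (hf : ContDiff ℝ ∞ f) :
    IsConservedDensity P (evenVortDensity (m := m) fun v => f v.1.2.1 * v.2) := by
  obtain ⟨F, hF, rfl⟩ := exists_antideriv hf
  obtain ⟨e, he⟩ := exists_internalEnergy hP
  have h := isMovingFlux_circulatoryFlux hm hP he hF
  refine ⟨1, _, ?_, h.2⟩
  have hT := isLocalFunction_vortDensity (isCurlForm_vortEven m)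
    (isVortFunction_entropy_mul (n := 2 * m) hf)
  rw [← evenVortDensity_eq] at hT
  exact ContDiffOn.add (ContDiffOn.smul hT contDiff_fluidVar.snd.snd.contDiffOn) h.1

/-- If `f(S) ϖ` is kinematic up to a trivial density, `f` is constant. -/
lemma deriv_eq_zero_of_isTrivialDensity {K : FluidVar (2 * m) → ℝ} (hm : 1 ≤ m) (hK : IsKinematic K)
    {f : ℝ → ℝ} (hf : ContDiff ℝ ∞ f) {T : FluidVar (2 * m) × ℝ → ℝ}
    (hT : ∀ v y, 0 < v.1 → T (v, y) = K v + f v.2.1 * y)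
    (htriv : IsTrivialDensity (evenVortDensity T)) (s : ℝ) : deriv f s = 0 := by
  have hZ := isCurlForm_vortEven m
  set L : Jet1 (2 * m) → ℝ := fun j => K j.1 + f j.1.2.1 * vortEven m (velGrad j.2) with hLdef
  have hL : IsDivergence L := by
    obtain ⟨k, Θ, hΘ, hd⟩ := htriv
    refine ⟨k, Θ, hΘ, fun w hw x => ?_⟩
    rw [← hd w hw 0 x, evenVortDensity_eq, vortDensity_jet, hT _ _ (hw.2 x)]
    rfl
  have hLs : ContDiffOn ℝ ∞ L (posJet (2 * m)) := by
    refine ContDiffOn.add ?_ (ContDiff.contDiffOn (ContDiff.mul ?_ ?_))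
    · exact ContDiffOn.comp (g := K) hK (f := fun j : Jet1 (2 * m) => j.1)
        contDiff_fst.contDiffOn fun j hj => hj
    · exact hf.comp contDiff_fst.snd.fst
    · exact hZ.contDiff.comp (contDiff_velGrad.comp contDiff_snd)
  have hdL : ∀ q : Jet1 (2 * m), 0 < q.1.1 → DifferentiableAt ℝ L q := fun q hq =>
    (hLs.differentiableOn (by simp)).differentiableAt (isOpen_posJet.mem_nhds hq)
  set v : FluidVar (2 * m) := (1, s, 0) with hv
  have hvpos : 0 < v.1 := by simp [hv]
  have key : ∀ A : Grad (2 * m), fderiv ℝ K v (0, 1, 0) + deriv f s * vortEven m A = 0 := by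
    intro A
    have h := hL.lowerOrder hLs v hvpos (gradJet 0 0 A) (a := (0, 1, 0)) rfl
    -- This Lagrangian does not involve `∇S`, so the entropy Euler–Lagrange equation has no
    -- divergence side and reads `K_S + f'(S) ϖ = 0`.
    have hzero : ∀ i, (fun q => fderiv ℝ L q (0, Pi.single i (0, 1, 0))) =ᶠ[nhds (v, gradJet 0 0 A)]
        fun _ => 0 := by
      intro i
      filter_upwards [isOpen_posJet.mem_nhds (x := (v, gradJet 0 0 A)) hvpos] with q hq
      refine fderiv_eq_of_line (hdL q hq) ?_
      have e : (fun t : ℝ => L (q + t • (0, Pi.single i (0, 1, 0)))) = fun _ => L q := by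
        funext t
        have h1 : velGrad (q + t • (0, Pi.single i (0, 1, 0))).2 = velGrad q.2 := by
          ext a b
          by_cases hb : b = i
          · subst hb; simp [velGrad]
          · simp [velGrad, hb]
        simp only [hLdef, h1]
        simp
      rw [e]
      exact hasDerivAt_const _ _
    rw [Finset.sum_congr rfl fun i _ => by rw [(hzero i).fderiv_eq]] at h
    have hval : fderiv ℝ L (v, gradJet 0 0 A) ((0, 1, 0), 0) =
        fderiv ℝ K v (0, 1, 0) + deriv f s * vortEven m A := by
      refine fderiv_eq_of_line (hdL _ hvpos) ?_
      have e1 : HasDerivAt (fun t : ℝ => K (v + t • (0, 1, 0))) (fderiv ℝ K v (0, 1, 0)) 0 := by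
        have h1 : HasDerivAt (fun t : ℝ => v + t • ((0, 1, 0) : FluidVar (2 * m))) (0, 1, 0) 0 := by
          simpa using ((hasDerivAt_id (0 : ℝ)).smul_const
            ((0, 1, 0) : FluidVar (2 * m))).const_add v
        exact HasFDerivAt.comp_hasDerivAt (l := K) (0 : ℝ)
          (by simpa using (ContDiffOn.differentiableAt_state hK hvpos).hasFDerivAt) h1
      have e2 : HasDerivAt (fun t : ℝ => f (s + t)) (deriv f s) 0 := by
        have := (hf.differentiable (by simp) (s + 0)).hasDerivAt.comp_const_add s (0 : ℝ)
        simpa using this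
      have e3 := e1.fun_add (e2.mul_const (vortEven m A))
      simpa [hLdef, hv] using e3
    rw [hval] at h
    simpa using h
  -- Compare a gradient of zero vorticity with one of vorticity `m!`.
  set l₀ : Fin m := ⟨0, by omega⟩
  have h1 := key (partialSum (r := 0) (by omega) 1 l₀)
  rw [vortEven_partialSum] at h1
  have h3 := curlPow_sum_outer (r := 0) (k := m) (n := 2 * m) (by omega) (fun a => a.elim0) 1
    (fun a => a.elim0)
  have h2 : fderiv ℝ K v (0, 1, 0) + deriv f s *
      ((m.factorial : ℝ) * (1 : Matrix (Fin (2 * m)) (Fin (2 * m)) ℝ).det) = 0 := by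
    rw [← h3]; exact key _
  rw [Matrix.det_one, mul_one] at h2
  have hfac : (m.factorial : ℝ) ≠ 0 := by exact_mod_cast m.factorial_ne_zero
  exact (mul_eq_zero.1 (by linarith : deriv f s * (m.factorial : ℝ) = 0)).resolve_right hfac

end Nontrivial

end FluidFlow

end

/-! ### Assembly of the classification results -/

theorem theorem2 (m : ℕ) (hm : 1 ≤ m) (P : ℝ → ℝ → ℝ) (hP : IsNonIsentropic P) :
    -- dimension `n = 2m`: classification
    (∀ T : FluidVar (2 * m) × ℝ → ℝ, IsVortFunction T →
      (IsNontrivialVorticityLaw P (evenVortDensity T) ↔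
        ∃ (K : FluidVar (2 * m) → ℝ) (f : ℝ → ℝ),
          IsKinematic K ∧ IsConservedDensity P (kinematicDensity K) ∧
          ContDiff ℝ ∞ f ∧ (∃ a b, f a ≠ f b) ∧
          ∀ (v : FluidVar (2 * m)) (ϖ : ℝ), 0 < v.1 → T (v, ϖ) = K v + f v.2.1 * ϖ)) ∧
    -- dimension `n = 2m`: flux of the density `f(S) ϖ`, where `f = F'`
    (∀ F : ℝ → ℝ, ContDiff ℝ ∞ F → ∀ e : ℝ → ℝ → ℝ, IsInternalEnergy P e →
      IsMovingFlux P (evenVortDensity (m := m) (fun v => deriv F v.1.2.1 * v.2))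
        (circulatoryFlux hm e F)) ∧
    -- dimension `n = 2m`: enstrophy is not conserved
    (∀ g : ℝ → ℝ, ContDiff ℝ ∞ g → (¬ ∃ a b : ℝ, ∀ y, g y = a * y + b) →
      ¬ IsConservedDensity P
        (evenVortDensity (m := m) (fun v => v.1.1 * g (v.2 / v.1.1)))) ∧
    -- dimension `n = 2m + 1`: there are no nontrivial vorticity conservation laws
    (∀ T : FluidVar (2 * m + 1) × Space (2 * m + 1) → ℝ, IsVortFunction T →
      ¬ IsNontrivialVorticityLaw P (oddVortDensity T)) ∧
    -- dimension `n = 2m + 1`: helicity is not conserved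
    ¬ IsConservedDensity P
      (oddVortDensity (m := m) (fun v => inner ℝ v.1.2.2 v.2)) := by
  refine ⟨fun T hT => ⟨?_, ?_⟩, fun F hF e he => ?_, fun g hg hna hcons => ?_, fun T hT hlaw => ?_,
    fun hcons => ?_⟩
  · rintro ⟨hcons, hnt⟩
    obtain ⟨K, f, hK, hf, hform⟩ := even_classification hm hP hT hcons
    have hTl := isLocalFunction_vortDensity (isCurlForm_vortEven m) hT
    have hfl := isLocalFunction_vortDensity (isCurlForm_vortEven m)
      (isVortFunction_entropy_mul (n := 2 * m) hf)
    rw [← evenVortDensity_eq] at hTl hfl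
    refine ⟨K, f, hK, ?_, hf, ?_, hform⟩
    -- `K = T - f(S)ϖ` is conserved because both terms are.
    · refine hcons.add_const_mul (isConservedDensity_entropy_mul hm hP.smoothState hf) hTl hfl (-1)
        fun q hq => ?_
      simp only [kinematicDensity, evenVortDensity, hform _ _ hq]
      ring
    · by_contra hconst
      push Not at hconst
      -- A constant `f` would make `T - K` a constant multiple of the divergence `ϖ`.
      refine hnt ⟨K, hK, (isTrivialDensity_curlPow (r := 0) (k := m) (n := 2 * m) (by omega) hm
        fun a => a.elim0).const_mul (f 0) fun q hq => ?_⟩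
      simp only [kinematicDensity, evenVortDensity, hform _ _ hq, vortScalar_eq,
        hconst (fluidVar q).2.1 0]
      rw [vortEven]
      ring
  · rintro ⟨K, f, hK, hKc, hf, ⟨a, b, hab⟩, hform⟩
    have hfl := isLocalFunction_vortDensity (isCurlForm_vortEven m)
      (isVortFunction_entropy_mul (n := 2 * m) hf)
    rw [← evenVortDensity_eq] at hfl
    refine ⟨hKc.add_const_mul (isConservedDensity_entropy_mul hm hP.smoothState hf)
      (isLocalFunction_kinematicDensity hK) hfl 1 fun q hq => ?_, ?_⟩
    · simp only [kinematicDensity, evenVortDensity, hform _ _ hq]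
      ring
    · rintro ⟨K', hK', htriv⟩
      -- The kinematic function `K - K'` plays the role of `K` in the criterion.
      have h0 := deriv_eq_zero_of_isTrivialDensity hm (ContDiffOn.sub hK hK') hf
        (T := fun p => T p - K' p.1) (fun v y hv => by rw [hform v y hv]; simp; ring) htriv
      exact hab (is_const_of_deriv_eq_zero (hf.differentiable (by simp)) h0 a b)
  · exact isMovingFlux_circulatoryFlux hm hP.smoothState he hF
  · have hT : IsVortFunction fun v : FluidVar (2 * m) × ℝ => v.1.1 * g (v.2 / v.1.1) := by
      refine contDiff_fst.fst.contDiffOn.mul (hg.comp_contDiffOn ?_)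
      exact contDiff_snd.contDiffOn.div contDiff_fst.fst.contDiffOn
        fun v hv => (show 0 < v.1.1 from hv).ne'
    obtain ⟨K, f, -, -, hform⟩ := even_classification hm hP hT hcons
    -- At `ρ = 1`, `S = 0`, `u = 0` the enstrophy density is `g(ϖ)`, which the classification makes
    -- affine.
    refine hna ⟨f 0, K (1, 0, 0), fun y => ?_⟩
    have := hform (1, 0, 0) y (by simp)
    simp only [one_mul, div_one] at this
    rw [this]
    ring
  · obtain ⟨K, c, hK, hform⟩ := odd_classification hm hP hT hlaw.1
    -- `c·ϖ` with constant `c` is the power of the curl contracted with the single covector `c`,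
    -- hence trivial.
    refine hlaw.2 ⟨K, hK, (isTrivialDensity_curlPow (odd_dim m) hm
      fun _ j => c (basisVec j)).const_mul 1 fun q hq => ?_⟩
    simp only [kinematicDensity, oddVortDensity, hform _ _ hq, vortVector_eq]
    rw [curlPow_eq_sum, space_eq_sum (vortOdd m _), map_sum, one_mul, add_sub_cancel_left]
    refine Finset.sum_congr rfl fun i _ => ?_
    rw [map_smul, smul_eq_mul, mul_comm]
    rfl
  · have hT : IsVortFunction fun v : FluidVar (2 * m + 1) × Space (2 * m + 1) =>
        (inner ℝ v.1.2.2 v.2 : ℝ) :=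
      (ContDiff.inner ℝ contDiff_fst.snd.snd contDiff_snd).contDiffOn
    obtain ⟨K, c, -, hform⟩ := odd_classification hm hP hT hcons
    -- The increment in the vorticity must not depend on `u`, yet for `ϖ` changing from `0` to `e_0`
    -- helicity increases by `1` when `u = e_0` and by `0` when `u = 0`.
    have h1 := hform (1, 0, basisVec 0) 0 (by simp)
    have h2 := hform (1, 0, basisVec 0) (basisVec 0) (by simp)
    have h3 := hform (1, 0, 0) 0 (by simp)
    have h4 := hform (1, 0, 0) (basisVec 0) (by simp)
    simp only [inner_zero_right, inner_zero_left, map_zero, add_zero] at h1 h2 h3 h4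
    rw [← h1, zero_add, EuclideanSpace.inner_single_left] at h2
    rw [← h3, zero_add] at h4
    simp [← h4] at h2
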